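/- **Definitions.** A parameterized problem is a set of pairs $(x,k)$, where $x$ is encoded by a bit string and $k\in\mathbb N$ is the parameter. An fpt reduction from $P$ to $Q$ is a map $(x,k)\mapsto(x',k')$ with $(x,k)\in P\iff(x',k')\in Q$ that is computable in time $f(k)\cdot|x|^{O(1)}$ and satisfies $k'\le g(k)$, for some computable functions $f,g$. $\mathrm{W[P]}$ is the class of problems that are fpt reducible to Weighted Circuit Satisfiability (given a Boolean circuit $C$ and the parameter $k$, is there an assignment $x$ of Hamming weight $k$ with $C(x)=1$?). A problem is $\mathrm{W[P]}$-hard if every problem in $\mathrm{W[P]}$ is fpt reducible to it. Let $X=(V,E,c)$ be a finite undirected vertex-colored graph. Individualizing a set $S\subseteq V$ means giving the vertices of $S$ pairwise distinct new colors. Color refinement repeatedly replaces the color of each vertex by its color together with the multiset of the colors of its neighbors, until the partition into color classes is stable. For a vertex $v$ and a color class $C$ let $\deg_C(v)$ be the number of neighbors of $v$ in $C$, and let $\text{co-}\!\deg_C(v)=|C|-\deg_C(v)$. The color valence is $\max_{v,C}\min\{\deg_C(v),\text{co-}\!\deg_C(v)\}$. The problem $k$-Color-Valence is: given a colored graph $X$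 and numbers $k,d$, with parameter $k$, is there a set of $k$ vertices of $X$ such that individualizing them and then running color refinement yields a graph of color valence at most $d$? **Theorem.** $k$-Color-Valence is $\mathrm{W[P]}$-hard. It remains $\mathrm{W[P]}$-hard when restricted to the instances with $d=0$. Moreover, the hardness for $d=0$ is witnessed by reductions that also reduce to the problem of making a graph discrete: for every problem $P$ in $\mathrm{W[P]}$ there is one map $(x,k)\mapsto(X,k')$, computable in time $f(k)\cdot|x|^{O(1)}$ with $k'\le g(k)$ for some computable functions $f,g$, such that the following are equivalent for every instance $(x,k)$ of $P$: 1. $(x,k)\in P$; 2. some $k'$ vertices of $X$ can be individualized so that color refinement then yields only singleton color classes; 3. some $k'$ vertices of $X$ can be individualized so that color refinement then yields color valence $0$. -/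

import Mathlib

namespace FPT

/-! ### A random access machine with unit cost

Programs act on registers, each holding a natural number, and on growable vectors of natural
numbers. There is addition but no multiplication, and a vector grows by at most one entry per step,
so unit cost is polynomially related to the running time of Turing machines. -/

/-- The memory: registers `reg 0, reg 1, …` and vectors `vec 0, vec 1, …`. -/
structure Store where
  reg : ℕ → ℕ
  vec : ℕ → List ℕ

def Store.setReg (s : Store) (r m : ℕ) : Store := { s with reg := Function.update s.reg r m }

def Store.setVec (s : Store) (v : ℕ) (l : List ℕ) : Store :=
  { s with vec := Function.update s.vec v l }

/-- Programs. A program mentions finitely many registers and vectors, by fixed names. -/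
inductive Prog : Type
  /-- `reg r := m` -/
  | const (r m : ℕ) : Prog
  /-- `reg r := reg a + reg b` -/
  | add (r a b : ℕ) : Prog
  /-- `reg r := reg a - reg b` (truncated) -/
  | sub (r a b : ℕ) : Prog
  /-- `reg r :=` length of `vec v` -/
  | len (r v : ℕ) : Prog
  /-- `reg r :=` entry of `vec v` at position `reg i` (`0` beyond the end) -/
  | read (r v i : ℕ) : Prog
  /-- overwrite the entry of `vec v` at position `reg i` by `reg a` (no effect beyond the end) -/
  | write (v i a : ℕ) : Prog
  /-- append `reg a` at the end of `vec v` -/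
  | push (v a : ℕ) : Prog
  /-- make `vec v` empty -/
  | clear (v : ℕ) : Prog
  /-- first `p`, then `q` -/
  | seq (p q : Prog) : Prog
  /-- if `reg r ≠ 0` then `p` else `q` -/
  | cond (r : ℕ) (p q : Prog) : Prog
  /-- while `reg r ≠ 0` do `p` -/
  | loop (r : ℕ) (p : Prog) : Prog

/-- `Exec p s t s'`: started in `s`, the program `p` halts after exactly `t` steps in `s'`. Every
elementary instruction and every test counts as one step. -/
inductive Exec : Prog → Store → ℕ → Store → Prop
  | const (r m : ℕ) (s : Store) : Exec (.const r m) s 1 (s.setReg r m)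
  | add (r a b : ℕ) (s : Store) : Exec (.add r a b) s 1 (s.setReg r (s.reg a + s.reg b))
  | sub (r a b : ℕ) (s : Store) : Exec (.sub r a b) s 1 (s.setReg r (s.reg a - s.reg b))
  | len (r v : ℕ) (s : Store) : Exec (.len r v) s 1 (s.setReg r (s.vec v).length)
  | read (r v i : ℕ) (s : Store) :
      Exec (.read r v i) s 1 (s.setReg r ((s.vec v).getD (s.reg i) 0))
  | write (v i a : ℕ) (s : Store) :
      Exec (.write v i a) s 1 (s.setVec v ((s.vec v).set (s.reg i) (s.reg a)))
  | push (v a : ℕ) (s : Store) : Exec (.push v a) s 1 (s.setVec v (s.vec v ++ [s.reg a]))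
  | clear (v : ℕ) (s : Store) : Exec (.clear v) s 1 (s.setVec v [])
  | seq {p q : Prog} {s s' s'' : Store} {t t' : ℕ} :
      Exec p s t s' → Exec q s' t' s'' → Exec (.seq p q) s (t + t') s''
  | cond_true {r : ℕ} {p q : Prog} {s s' : Store} {t : ℕ} :
      s.reg r ≠ 0 → Exec p s t s' → Exec (.cond r p q) s (t + 1) s'
  | cond_false {r : ℕ} {p q : Prog} {s s' : Store} {t : ℕ} :
      s.reg r = 0 → Exec q s t s' → Exec (.cond r p q) s (t + 1) s'
  | loop_stop {r : ℕ} {p : Prog} {s : Store} : s.reg r = 0 → Exec (.loop r p) s 1 s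
  | loop_step {r : ℕ} {p : Prog} {s s' s'' : Store} {t t' : ℕ} :
      s.reg r ≠ 0 → Exec p s t s' → Exec (.loop r p) s' t' s'' →
      Exec (.loop r p) s (t + t' + 1) s''

/-- The initial store for the input word `w`: the bits of `w` are in `vec 0`, all else is blank. -/
def initStore (w : List Bool) : Store where
  reg := fun _ => 0
  vec := fun v => if v = 0 then w.map Bool.toNat else []

/-- On input word `w` the program `p` halts after exactly `t` steps, with the word `w'` in
`vec 1`. -/
def Outputs (p : Prog) (w : List Bool) (t : ℕ) (w' : List Bool) : Prop :=
  ∃ s : Store, Exec p (initStore w) t s ∧ s.vec 1 = w'.map Bool.toNat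

/-! ### Encodings by bit strings -/

/-- The number `m` in unary, with an end marker. -/
def encNat (m : ℕ) : List Bool := List.replicate m true ++ [false]

/-- A list of numbers, each in unary. -/
def encNats (l : List ℕ) : List Bool := l.flatMap encNat

theorem encNat_append_inj {m m' : ℕ} {a b : List Bool}
    (h : encNat m ++ a = encNat m' ++ b) : m = m' ∧ a = b := by
  induction m generalizing m' with
  | zero =>
    cases m' with
    | zero => simpa [encNat] using h
    | succ m' => simp [encNat, List.replicate_succ] at h
  | succ m ih =>
    cases m' with
    | zero => simp [encNat, List.replicate_succ] at h
    | succ m' =>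
      have h2 : encNat m ++ a = encNat m' ++ b := by
        simpa [encNat, List.replicate_succ] using h
      obtain ⟨h3, h4⟩ := ih h2
      exact ⟨by omega, h4⟩

theorem encNats_injective : Function.Injective encNats := by
  intro l
  induction l with
  | nil =>
    intro l' h
    cases l' with
    | nil => rfl
    | cons m l' => simp [encNats, encNat] at h
  | cons m l ih =>
    intro l' h
    cases l' with
    | nil => simp [encNats, encNat] at h
    | cons m' l' =>
      simp only [encNats, List.flatMap_cons] at h
      obtain ⟨h1, h2⟩ := encNat_append_inj h
      rw [h1, ih h2]

/-! ### Parameterized problems and fpt reductions -/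

/-- A parameterized problem: instances are pairs `(x, k)`, where `x` is encoded by a bit string and
`k` is the parameter; `yes x k` says that `(x, k)` is a positive instance. -/
structure ParamProblem where
  Inst : Type
  encode : Inst → List Bool
  encode_injective : Function.Injective encode
  yes : Inst → ℕ → Prop

/-- The word presented to a machine for the instance `(x, k)`. -/
def ParamProblem.word (P : ParamProblem) (x : P.Inst) (k : ℕ) : List Bool :=
  encNat k ++ P.encode x

/-- The same problem on the instances that satisfy `p`. -/
def ParamProblem.restrict (P : ParamProblem) (p : P.Inst → Prop) : ParamProblem where
  Inst := { x : P.Inst // p x }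
  encode := fun x => P.encode x.1
  encode_injective := fun _ _ h => Subtype.ext (P.encode_injective h)
  yes := fun x k => P.yes x.1 k

/-- The map `R` from instances of `P` to instances of `Q` is computable in time
`f(k) · |x| ^ O(1)`, and the new parameter is at most `g(k)`, where `f` and `g` are computable. -/
def FPTMap (P Q : ParamProblem) (R : P.Inst → ℕ → Q.Inst × ℕ) : Prop :=
  ∃ (p : Prog) (f g : ℕ → ℕ) (c : ℕ), Computable f ∧ Computable g ∧
    ∀ (x : P.Inst) (k : ℕ),
      (R x k).2 ≤ g k ∧
      ∃ t : ℕ, t ≤ f k * ((P.encode x).length + 1) ^ c ∧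
        Outputs p (P.word x k) t (Q.word (R x k).1 (R x k).2)

/-- Fpt many-one reducibility. -/
def Reducible (P Q : ParamProblem) : Prop :=
  ∃ R : P.Inst → ℕ → Q.Inst × ℕ, FPTMap P Q R ∧
    ∀ (x : P.Inst) (k : ℕ), P.yes x k ↔ Q.yes (R x k).1 (R x k).2

/-! ### Boolean circuits and the class W[P] -/

/-- A gate; the arguments are the numbers of the nodes that it reads. -/
inductive Gate : Type
  | and (i j : ℕ) : Gate
  | or (i j : ℕ) : Gate
  | not (i : ℕ) : Gate

/-- The gate reads only nodes with number less than `m`. -/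
def Gate.ReadsBelow (m : ℕ) : Gate → Prop
  | .and i j => i < m ∧ j < m
  | .or i j => i < m ∧ j < m
  | .not i => i < m

/-- The value of a gate, given the list of values of the preceding nodes. -/
def Gate.eval (vals : List Bool) : Gate → Bool
  | .and i j => vals.getD i false && vals.getD j false
  | .or i j => vals.getD i false || vals.getD j false
  | .not i => !vals.getD i false

def Gate.code : Gate → List ℕ
  | .and i j => [0, i, j]
  | .or i j => [1, i, j]
  | .not i => [2, i, i]

/-- A Boolean circuit, with nodes listed in topological order: nodes `0, …, inputs - 1` are the
inputs, node `inputs + t` is `gates[t]`. -/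
structure Circuit where
  inputs : ℕ
  gates : List Gate
  output : ℕ
  acyclic : ∀ (t : ℕ) (h : t < gates.length), gates[t].ReadsBelow (inputs + t)
  output_lt : output < inputs + gates.length

/-- The values of all nodes under an assignment to the inputs. -/
def Circuit.values (C : Circuit) (x : Fin C.inputs → Bool) : List Bool :=
  C.gates.foldl (fun vals g => vals ++ [g.eval vals]) (List.ofFn x)

def Circuit.eval (C : Circuit) (x : Fin C.inputs → Bool) : Bool :=
  (C.values x).getD C.output false

def Circuit.encode (C : Circuit) : List Bool :=
  encNats (C.inputs :: C.output :: C.gates.flatMap Gate.code)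

theorem gates_code_injective :
    Function.Injective (fun l : List Gate => l.flatMap Gate.code) := by
  intro l
  induction l with
  | nil =>
    intro l' h
    cases l' with
    | nil => rfl
    | cons g l' => cases g <;> simp [Gate.code] at h
  | cons g l ih =>
    intro l' h
    cases l' with
    | nil => cases g <;> simp [Gate.code] at h
    | cons g' l' =>
      have key : g = g' ∧ l.flatMap Gate.code = l'.flatMap Gate.code := by
        cases g <;> cases g' <;> simp_all [Gate.code]
      rw [key.1, ih key.2]

theorem Circuit.encode_injective : Function.Injective Circuit.encode := by
  rintro ⟨n, l, o, h1, h2⟩ ⟨n', l', o', h1', h2'⟩ h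
  have h3 := encNats_injective h
  simp only [List.cons.injEq] at h3
  obtain ⟨rfl, rfl, h4⟩ := h3
  have h5 := gates_code_injective h4
  subst h5
  rfl

/-- Weighted Circuit Satisfiability: is there a satisfying assignment of Hamming weight `k`? -/
def weightedCircuitSat : ParamProblem where
  Inst := Circuit
  encode := Circuit.encode
  encode_injective := Circuit.encode_injective
  yes := fun C k => ∃ x : Fin C.inputs → Bool,
    (Finset.univ.filter (fun i => x i = true)).card = k ∧ C.eval x = true

/-- The class W[P]: all problems that are fpt reducible to Weighted Circuit Satisfiability. -/
def InWP (P : ParamProblem) : Prop := Reducible P weightedCircuitSat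

/-- W[P]-hardness under fpt many-one reductions. -/
def WPHard (Q : ParamProblem) : Prop := ∀ P : ParamProblem, InWP P → Reducible P Q

/-! ### Color refinement, individualization, color valence -/

section Refinement

open scoped Classical in
/-- One round of color refinement, on partitions into color classes: the new color of `v` is its old
color together with the multiset of the old colors of its neighbors. -/
noncomputable def refineStep {V : Type} [Fintype V] (G : SimpleGraph V) (s : Setoid V) : Setoid V :=
  Setoid.ker (fun v : V => ((Quotient.mk s v : Quotient s),
    (Finset.univ.filter (fun u => G.Adj v u)).val.map (fun u => (Quotient.mk s u : Quotient s))))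

/-- The stable partition: two vertices are in the same class if no round separates them. -/
noncomputable def stablePartition {V : Type} [Fintype V] (G : SimpleGraph V) (s : Setoid V) :
    Setoid V :=
  ⨅ r : ℕ, (refineStep G)^[r] s

open scoped Classical in
/-- The color classes after individualizing the vertices in `S`: these get pairwise distinct fresh
colors, all other vertices keep their color. -/
noncomputable def individualize {V : Type} (c : V → ℕ) (S : Finset V) : Setoid V :=
  Setoid.ker (fun v : V => if v ∈ S then (Sum.inl v : V ⊕ ℕ) else Sum.inr (c v))

open scoped Classical in
/-- The number of neighbors of `v` in the color class of `w`. -/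
noncomputable def colorDegree {V : Type} [Fintype V] (G : SimpleGraph V) (s : Setoid V) (v w : V) :
    ℕ :=
  (Finset.univ.filter (fun u => s w u ∧ G.Adj v u)).card

open scoped Classical in
/-- The size of the color class of `w`, minus the color degree of `v` in that class. -/
noncomputable def colorCodegree {V : Type} [Fintype V] (G : SimpleGraph V) (s : Setoid V)
    (v w : V) : ℕ :=
  (Finset.univ.filter (fun u => s w u)).card - colorDegree G s v w

/-- The color valence: the maximum over all vertices and all color classes of the minimum of color
degree and color codegree. -/
noncomputable def colorValence {V : Type} [Fintype V] (G : SimpleGraph V) (s : Setoid V) : ℕ :=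
  Finset.univ.sup (fun q : V × V => min (colorDegree G s q.1 q.2) (colorCodegree G s q.1 q.2))

end Refinement

/-- A finite colored graph on the vertices `0, …, n - 1`, given by its colors and an edge list. -/
structure ColoredGraph where
  n : ℕ
  color : Fin n → ℕ
  edges : List (Fin n × Fin n)

/-- The underlying undirected simple graph. -/
def ColoredGraph.graph (X : ColoredGraph) : SimpleGraph (Fin X.n) :=
  SimpleGraph.fromRel (fun u v => (u, v) ∈ X.edges)

/-- The stable partition of `X` after individualizing the vertices in `S`. -/
noncomputable def ColoredGraph.stableAfter (X : ColoredGraph) (S : Finset (Fin X.n)) :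
    Setoid (Fin X.n) :=
  stablePartition X.graph (individualize X.color S)

/-- Some `k` vertices can be individualized so that color refinement then yields color valence at
most `d`. -/
def ColoredGraph.CanReachValence (X : ColoredGraph) (k d : ℕ) : Prop :=
  ∃ S : Finset (Fin X.n), S.card = k ∧ colorValence X.graph (X.stableAfter S) ≤ d

/-- Some `k` vertices can be individualized so that color refinement then yields singleton color
classes. -/
def ColoredGraph.CanReachDiscrete (X : ColoredGraph) (k : ℕ) : Prop :=
  ∃ S : Finset (Fin X.n), S.card = k ∧ ∀ u v : Fin X.n, X.stableAfter S u v → u = v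

def ColoredGraph.code (X : ColoredGraph) : List ℕ :=
  X.n :: (List.ofFn X.color ++ X.edges.flatMap (fun e => [(e.1 : ℕ), (e.2 : ℕ)]))

theorem edges_code_injective (n : ℕ) : Function.Injective
    (fun l : List (Fin n × Fin n) => l.flatMap (fun e => [(e.1 : ℕ), (e.2 : ℕ)])) := by
  intro l
  induction l with
  | nil =>
    intro l' h
    cases l' with
    | nil => rfl
    | cons e l' => simp at h
  | cons e l ih =>
    intro l' h
    cases l' with
    | nil => simp at h
    | cons e' l' =>
      simp only [List.flatMap_cons, List.cons_append, List.nil_append, List.cons.injEq] at h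
      obtain ⟨h1, h2, h3⟩ := h
      rw [ih h3, Prod.ext (Fin.ext h1) (Fin.ext h2)]

theorem ColoredGraph.code_injective : Function.Injective ColoredGraph.code := by
  rintro ⟨n, c, e⟩ ⟨n', c', e'⟩ h
  simp only [ColoredGraph.code, List.cons.injEq] at h
  obtain ⟨rfl, h⟩ := h
  obtain ⟨h1, h2⟩ := List.append_inj h (by simp)
  rw [List.ofFn_injective h1, edges_code_injective n h2]

/-- The problem k-Color-Valence: given a colored graph `X` and numbers `d` and `k`, with parameter
`k`, can the color valence be brought down to at most `d` by individualizing `k` vertices and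
refining? -/
def kColorValence : ParamProblem where
  Inst := ColoredGraph × ℕ
  encode := fun x => encNats (x.2 :: x.1.code)
  encode_injective := by
    rintro ⟨X, d⟩ ⟨X', d'⟩ h
    have h1 := encNats_injective h
    simp only [List.cons.injEq] at h1
    obtain ⟨rfl, h2⟩ := h1
    rw [ColoredGraph.code_injective h2]
  yes := fun x k => x.1.CanReachValence k x.2

end FPT

/-! A circuit with parameter `k` is turned into a Horn system, the Horn system into a triple system,
and the triple system into a colored graph in which color refinement imitates forward chaining.

Graph level. A variable is a pair of vertices, and it is known when its pair is split. The middle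
vertices of a triple are a parity gadget of Cai–Fürer–Immerman type: two split pairs of a triple
split the third, and no other propagation takes place. For a closed set `K` of variables, the
partition that splits exactly the pairs in `K` is equitable (`TripleSys.Closed.equitable`), so
refinement cannot pass beyond `K`. Conversely, the variables split in the stable partition form a
closed set, and if this set is always everything, the graph becomes discrete
(`TripleSys.discrete_of_closed`). A middle vertex sees exactly one vertex of its pair `R`, so
leaving that pair unsplit forces valence at least `1`. Hence valence `0` already forces every
conclusion to be known, while discreteness trivially gives valence `0`; this is why both goals are
served by the same graph.

Horn level. Triples propagate in all directions, rules in only one. The rule from `a`, `b` to `c`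
becomes the triples `(a, aux, f0)`, `(f0, b, f1)`, `(f1, aux, f2)`, `(f1, f2, c)` with `aux` always
known. Since `f1` and `f2` are known only together, knowing `c` reveals nothing.

Circuit level. There are `k` slots, each to be filled by one selected input. Counting rules handle
negation: once `k` selected inputs other than `x` are found, `x` must be false. The gates are then
evaluated, and a satisfied circuit derives `out`, which yields all atoms except `used i` and `pick i
v` for slots `i < k`. Within a slot, the picks follow from `used i` and their copies. So every slot
needs its own individualization (`closed_compl_block`), and `k` vertices give exactly one per slot.
Even a vertex inside a gadget then reveals no more than one selection would (`justified_of_block`).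
If the selection does not satisfy the circuit, the true facts form a closed set without `out`
(`closed_fact`); if it does, everything is derivable (`Data.Closed.all`).

Running time. The graph has polynomial size and explicitly numbered vertices. It is printed by a
small loop language whose statements compile to machine programs of polynomial running time, and
this program is run after the given reduction to weighted circuit satisfiability. -/

namespace FPT

/-! ### Polynomially bounded functions -/

/-- `F` is bounded by a polynomial. -/
def Poly (F : ℕ → ℕ) : Prop := ∃ c, ∀ M, F M ≤ (M + 2) ^ c

theorem Poly.const (n : ℕ) : Poly (fun _ => n) := by
  refine ⟨n, fun M => ?_⟩
  calc n ≤ 2 ^ n := Nat.lt_two_pow_self.le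
    _ ≤ (M + 2) ^ n := Nat.pow_le_pow_left (by omega) _

theorem Poly.id : Poly (fun M => M) := ⟨1, fun M => by simp⟩

theorem Poly.mul {F G : ℕ → ℕ} (hF : Poly F) (hG : Poly G) : Poly (fun M => F M * G M) := by
  obtain ⟨c, hc⟩ := hF
  obtain ⟨d, hd⟩ := hG
  exact ⟨c + d, fun M => by rw [pow_add]; exact Nat.mul_le_mul (hc M) (hd M)⟩

theorem Poly.add {F G : ℕ → ℕ} (hF : Poly F) (hG : Poly G) : Poly (fun M => F M + G M) := by
  obtain ⟨c, hc⟩ := hF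
  obtain ⟨d, hd⟩ := hG
  refine ⟨c + d + 1, fun M => ?_⟩
  have h1 : (M + 2) ^ c ≤ (M + 2) ^ (c + d) := Nat.pow_le_pow_right (by omega) (by omega)
  have h2 : (M + 2) ^ d ≤ (M + 2) ^ (c + d) := Nat.pow_le_pow_right (by omega) (by omega)
  calc F M + G M ≤ (M + 2) ^ (c + d) * 2 := by have := hc M; have := hd M; omega
    _ ≤ (M + 2) ^ (c + d) * (M + 2) := Nat.mul_le_mul_left _ (by omega)
    _ = _ := (pow_succ _ _).symm

/-- The exponent comes from `(M + 2) ^ d + 2 ≤ (M + 2) ^ (d + 2)`, which absorbs the shift by `2` in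
the outer bound. -/
theorem Poly.comp {F G : ℕ → ℕ} (hF : Poly F) (hG : Poly G) : Poly (fun M => F (G M)) := by
  obtain ⟨c, hc⟩ := hF
  obtain ⟨d, hd⟩ := hG
  refine ⟨(d + 2) * c, fun M => (hc _).trans ?_⟩
  rw [pow_mul]
  refine Nat.pow_le_pow_left ?_ c
  have h1 : 1 ≤ (M + 2) ^ d := Nat.one_le_pow _ _ (by omega)
  have h2 : (M + 2) ^ (d + 2) = (M + 2) ^ d * ((M + 2) * (M + 2)) := by ring
  have h3 : 4 ≤ (M + 2) * (M + 2) := by nlinarith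
  have h4 : (M + 2) ^ d * 4 ≤ (M + 2) ^ (d + 2) := by rw [h2]; exact Nat.mul_le_mul_left _ h3
  have := hd M
  omega

/-! ### A language of arithmetic expressions and of output statements -/

/-- Arithmetic expressions over named variables and the input word. -/
inductive Ex : Type
  | const (n : ℕ) : Ex
  | var (r : ℕ) : Ex
  | len : Ex
  | read (e : Ex) : Ex
  | add (a b : Ex) : Ex
  | sub (a b : Ex) : Ex
  | mul (a b : Ex) : Ex
  /-- if `c ≠ 0` then `a` else `b` -/
  | ite (c a b : Ex) : Ex
  /-- the sum of `b` over all values of variable `r` below `e` -/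
  | sum (r : ℕ) (e b : Ex) : Ex

namespace Ex

/-- The value on the input word `w` with the variables given by `ρ`. -/
def eval (w : List ℕ) : Ex → (ℕ → ℕ) → ℕ
  | const n, _ => n
  | var r, ρ => ρ r
  | len, _ => w.length
  | read e, ρ => w.getD (e.eval w ρ) 0
  | add a b, ρ => a.eval w ρ + b.eval w ρ
  | sub a b, ρ => a.eval w ρ - b.eval w ρ
  | mul a b, ρ => a.eval w ρ * b.eval w ρ
  | ite c a b, ρ => if c.eval w ρ ≠ 0 then a.eval w ρ else b.eval w ρ
  | sum r e b, ρ => ∑ i ∈ Finset.range (e.eval w ρ), b.eval w (Function.update ρ r i)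

/-- All variables have names below `B`. -/
def Below (B : ℕ) : Ex → Prop
  | const _ => True
  | var r => r < B
  | len => True
  | read e => e.Below B
  | add a b => a.Below B ∧ b.Below B
  | sub a b => a.Below B ∧ b.Below B
  | mul a b => a.Below B ∧ b.Below B
  | ite c a b => c.Below B ∧ a.Below B ∧ b.Below B
  | sum r e b => r < B ∧ e.Below B ∧ b.Below B

/-- A bound for the value when the input data are bounded by `M`. -/
def bound : Ex → ℕ → ℕ
  | const n, _ => n
  | var _, M => M
  | len, M => M
  | read _, M => M
  | add a b, M => a.bound M + b.bound M
  | sub a _, M => a.bound M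
  | mul a b, M => a.bound M * b.bound M
  | ite _ a b, M => a.bound M + b.bound M
  | sum _ e b, M => e.bound M * b.bound (M + e.bound M)

theorem bound_poly (e : Ex) : Poly e.bound := by
  induction e with
  | const n => exact Poly.const n
  | var r => exact Poly.id
  | len => exact Poly.id
  | read e _ => exact Poly.id
  | add a b ha hb => exact ha.add hb
  | sub a b ha hb => exact ha
  | mul a b ha hb => exact ha.mul hb
  | ite c a b hc ha hb => exact ha.add hb
  | sum r e b he hb => exact he.mul (hb.comp (Poly.id.add he))

/-- In a sum the running variable stays below the number of terms, so the body is evaluated with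
data bounded by `M + e.bound M`. -/
theorem eval_le_bound (w : List ℕ) (B : ℕ) (e : Ex) : ∀ (ρ : ℕ → ℕ) (M : ℕ), e.Below B →
    (∀ r < B, ρ r ≤ M) → w.length ≤ M → (∀ a ∈ w, a ≤ M) → e.eval w ρ ≤ e.bound M := by
  induction e with
  | const n => intro ρ M _ _ _ _; exact le_rfl
  | var r => intro ρ M h h1 _ _; exact h1 r h
  | len => intro ρ M h h1 h2 _; exact h2
  | read e _ =>
    intro ρ M h h1 h2 h3
    simp only [eval, bound, List.getD_eq_getElem?_getD]
    cases h4 : w[e.eval w ρ]? with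
    | none => simp
    | some a => exact h3 a (List.mem_of_getElem? h4)
  | add a b ha hb =>
    intro ρ M h h1 h2 h3
    exact Nat.add_le_add (ha ρ M h.1 h1 h2 h3) (hb ρ M h.2 h1 h2 h3)
  | sub a b ha hb =>
    intro ρ M h h1 h2 h3
    exact (Nat.sub_le _ _).trans (ha ρ M h.1 h1 h2 h3)
  | mul a b ha hb =>
    intro ρ M h h1 h2 h3
    exact Nat.mul_le_mul (ha ρ M h.1 h1 h2 h3) (hb ρ M h.2 h1 h2 h3)
  | ite c a b hc ha hb =>
    intro ρ M h h1 h2 h3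
    have h4 := ha ρ M h.2.1 h1 h2 h3
    have h5 := hb ρ M h.2.2 h1 h2 h3
    simp only [eval, bound]
    split_ifs <;> omega
  | sum r e b he hb =>
    intro ρ M h h1 h2 h3
    have h4 := he ρ M h.2.1 h1 h2 h3
    simp only [eval, bound]
    have h5 : ∀ i ∈ Finset.range (e.eval w ρ), b.eval w (Function.update ρ r i) ≤
        b.bound (M + e.bound M) := by
      intro i hi
      rw [Finset.mem_range] at hi
      refine hb _ _ h.2.2 (fun q hq => ?_) (by omega) (fun a ha => (h3 a ha).trans (by omega))
      by_cases hqr : q = r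
      · subst hqr; simp; omega
      · rw [Function.update_of_ne hqr]; exact (h1 q hq).trans (by omega)
    calc _ ≤ (Finset.range (e.eval w ρ)).card • b.bound (M + e.bound M) :=
          Finset.sum_le_card_nsmul _ _ _ h5
      _ ≤ _ := by rw [Finset.card_range, smul_eq_mul]; exact Nat.mul_le_mul_right _ h4

end Ex

/-! ### Compilation -/

/-- Run `body` for the values `0, 1, …` of register `r`, as many times as register `s` says. The
registers from `s` on are overwritten, and `s + 2` is an accumulator with initial value `0`. -/
def Prog.forLoop (r s : ℕ) (body : Prog) : Prog :=
  .seq (.const (s + 2) 0) <| .seq (.add (s + 1) r (s + 2)) <| .seq (.const (s + 3) 1) <|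
  .seq (.const r 0) <|
  .seq (.loop s (.seq body (.seq (.add r r (s + 3)) (.sub s s (s + 3))))) <|
  .seq (.const (s + 3) 0) (.add r (s + 1) (s + 3))

@[simp] theorem Store.setReg_vec (σ : Store) (r m : ℕ) : (σ.setReg r m).vec = σ.vec := rfl

@[simp] theorem Store.setReg_reg (σ : Store) (r m : ℕ) :
    (σ.setReg r m).reg = Function.update σ.reg r m := rfl

@[simp] theorem Store.setVec_reg (σ : Store) (v : ℕ) (l : List ℕ) : (σ.setVec v l).reg = σ.reg :=
  rfl

@[simp] theorem Store.setVec_vec (σ : Store) (v : ℕ) (l : List ℕ) :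
    (σ.setVec v l).vec = Function.update σ.vec v l := rfl

/-- Induction on the number `n` of remaining rounds. The invariant `J` ties the round index to the
accumulator and to the vectors, the only things through which rounds communicate; the `3` in the
bound pays for the two updates and the test. -/
theorem Prog.loop_countdown {r s T : ℕ} {body : Prog} (hr : r < s)
    (J : ℕ → ℕ → (ℕ → List ℕ) → Prop) (ρ : ℕ → ℕ) (m : ℕ)
    (hbody : ∀ i < m, ∀ σ : Store, (∀ q < s, σ.reg q = Function.update ρ r i q) →
      J i (σ.reg (s + 2)) σ.vec → ∃ t ≤ T, ∃ σ', Exec body σ t σ' ∧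
        (∀ q < s + 4, q ≠ s + 2 → σ'.reg q = σ.reg q) ∧ J (i + 1) (σ'.reg (s + 2)) σ'.vec) :
    ∀ (n i : ℕ) (σ : Store), i + n = m → σ.reg s = n → σ.reg (s + 3) = 1 →
      (∀ q < s, σ.reg q = Function.update ρ r i q) → J i (σ.reg (s + 2)) σ.vec →
      ∃ t ≤ n * (T + 3) + 1, ∃ σ',
        Exec (.loop s (.seq body (.seq (.add r r (s + 3)) (.sub s s (s + 3))))) σ t σ' ∧
        (∀ q < s, q ≠ r → σ'.reg q = ρ q) ∧ σ'.reg (s + 1) = σ.reg (s + 1) ∧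
        J m (σ'.reg (s + 2)) σ'.vec := by
  intro n
  induction n with
  | zero =>
    intro i σ hi hs h1 hq hJ
    refine ⟨1, by omega, σ, Exec.loop_stop hs, fun q hq' hqr => ?_, rfl, ?_⟩
    · rw [hq q hq', Function.update_of_ne hqr]
    · rw [← hi]; exact hJ
  | succ n ih =>
    intro i σ hi hs h1 hq hJ
    obtain ⟨t, ht, σ₁, hE, hreg, hJ₁⟩ := hbody i (by omega) σ hq hJ
    set σ₂ := σ₁.setReg r (σ₁.reg r + σ₁.reg (s + 3)) with hσ₂
    set σ₃ := σ₂.setReg s (σ₂.reg s - σ₂.reg (s + 3)) with hσ₃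
    have e2 : ∀ q, q ≠ r → σ₂.reg q = σ₁.reg q := fun q h => by
      simp [hσ₂, Function.update_of_ne h]
    have e3 : ∀ q, q ≠ s → σ₃.reg q = σ₂.reg q := fun q h => by
      simp [hσ₃, Function.update_of_ne h]
    have g1 : σ₃.reg s = n := by
      have : σ₃.reg s = σ₂.reg s - σ₂.reg (s + 3) := by simp [hσ₃]
      rw [this, e2 s (by omega), e2 (s + 3) (by omega), hreg s (by omega) (by omega),
        hreg (s + 3) (by omega) (by omega), hs, h1]
      omega
    have g2 : σ₃.reg (s + 3) = 1 := by
      rw [e3 _ (by omega), e2 _ (by omega), hreg _ (by omega) (by omega), h1]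
    have g3 : ∀ q < s, σ₃.reg q = Function.update ρ r (i + 1) q := by
      intro q hq'
      rw [e3 q (by omega)]
      by_cases hqr : q = r
      · subst hqr
        have : σ₂.reg q = σ₁.reg q + σ₁.reg (s + 3) := by simp [hσ₂]
        rw [this, hreg q (by omega) (by omega), hreg (s + 3) (by omega) (by omega), hq q hq', h1]
        simp
      · rw [e2 q hqr, hreg q (by omega) (by omega), hq q hq', Function.update_of_ne hqr,
          Function.update_of_ne hqr]
    have g4 : J (i + 1) (σ₃.reg (s + 2)) σ₃.vec := by
      rw [e3 _ (by omega), e2 _ (by omega)]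
      exact hJ₁
    obtain ⟨t', ht', σ', hE', k1, k2, k3⟩ := ih (i + 1) σ₃ (by omega) g1 g2 g3 g4
    refine ⟨(t + (1 + 1)) + t' + 1, ?_, σ', .loop_step (by omega)
      (.seq hE (.seq (.add _ _ _ _) (.sub _ _ _ _))) hE', k1, ?_, k3⟩
    · have : (n + 1) * (T + 3) = n * (T + 3) + (T + 3) := by ring
      omega
    · rw [k2, e3 _ (by omega), e2 _ (by omega), hreg _ (by omega) (by omega)]

/-- Register `s + 1` holds the old value of `r`, so that nested loops may reuse a variable. Register
`s + 3` ends with `0`, which lets later code copy the accumulator by an addition. -/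
theorem Prog.forLoop_spec {r s T m : ℕ} {body : Prog} (hr : r < s)
    (J : ℕ → ℕ → (ℕ → List ℕ) → Prop) (σ : Store) (hm : σ.reg s = m) (h0 : J 0 0 σ.vec)
    (hbody : ∀ i < m, ∀ σ₁ : Store, (∀ q < s, σ₁.reg q = Function.update σ.reg r i q) →
      J i (σ₁.reg (s + 2)) σ₁.vec → ∃ t ≤ T, ∃ σ', Exec body σ₁ t σ' ∧
        (∀ q < s + 4, q ≠ s + 2 → σ'.reg q = σ₁.reg q) ∧ J (i + 1) (σ'.reg (s + 2)) σ'.vec) :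
    ∃ t ≤ m * (T + 3) + 7, ∃ σ', Exec (Prog.forLoop r s body) σ t σ' ∧
      (∀ q < s, σ'.reg q = σ.reg q) ∧ σ'.reg (s + 3) = 0 ∧ J m (σ'.reg (s + 2)) σ'.vec := by
  set σ₁ := σ.setReg (s + 2) 0 with h1
  set σ₂ := σ₁.setReg (s + 1) (σ₁.reg r + σ₁.reg (s + 2)) with h2
  set σ₃ := σ₂.setReg (s + 3) 1 with h3
  set σ₄ := σ₃.setReg r 0 with h4
  have e1 : ∀ q, q ≠ s + 2 → σ₁.reg q = σ.reg q := fun q h => by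
    simp [h1, Function.update_of_ne h]
  have e2 : ∀ q, q ≠ s + 1 → σ₂.reg q = σ₁.reg q := fun q h => by
    simp [h2, Function.update_of_ne h]
  have e3 : ∀ q, q ≠ s + 3 → σ₃.reg q = σ₂.reg q := fun q h => by
    simp [h3, Function.update_of_ne h]
  have e4 : ∀ q, q ≠ r → σ₄.reg q = σ₃.reg q := fun q h => by
    simp [h4, Function.update_of_ne h]
  have hsave : σ₄.reg (s + 1) = σ.reg r := by
    rw [e4 _ (by omega), e3 _ (by omega)]
    have : σ₂.reg (s + 1) = σ₁.reg r + σ₁.reg (s + 2) := by simp [h2]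
    rw [this, e1 r (by omega)]
    simp [h1]
  have g0 : σ₄.reg (s + 2) = 0 := by
    rw [e4 _ (by omega), e3 _ (by omega), e2 _ (by omega)]
    simp [h1]
  obtain ⟨t, ht, σ', hE, k1, k2, k3⟩ := Prog.loop_countdown hr J σ.reg m hbody m 0 σ₄ (by omega)
    (by rw [e4 _ (by omega), e3 _ (by omega), e2 _ (by omega), e1 _ (by omega), hm])
    (by rw [e4 _ (by omega)]; simp [h3])
    (by
      intro q hq
      by_cases hqr : q = r
      · subst hqr; simp [h4]
      · rw [e4 _ hqr, e3 _ (by omega), e2 _ (by omega), e1 _ (by omega),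
          Function.update_of_ne hqr])
    (by rw [g0]; exact h0)
  set σ₅ := σ'.setReg (s + 3) 0 with h5
  set σ₆ := σ₅.setReg r (σ₅.reg (s + 1) + σ₅.reg (s + 3)) with h6
  have e5 : ∀ q, q ≠ s + 3 → σ₅.reg q = σ'.reg q := fun q h => by
    simp [h5, Function.update_of_ne h]
  have e6 : ∀ q, q ≠ r → σ₆.reg q = σ₅.reg q := fun q h => by
    simp [h6, Function.update_of_ne h]
  refine ⟨1 + (1 + (1 + (1 + (t + (1 + 1))))), by omega, σ₆,
    .seq (.const _ _ _) (.seq (.add _ _ _ _) (.seq (.const _ _ _) (.seq (.const _ _ _)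
      (.seq hE (.seq (.const _ _ _) (.add _ _ _ _)))))), ?_, ?_, ?_⟩
  · intro q hq
    by_cases hqr : q = r
    · subst hqr
      have : σ₆.reg q = σ₅.reg (s + 1) + σ₅.reg (s + 3) := by simp [h6]
      rw [this, e5 _ (by omega), k2, hsave]
      simp [h5]
    · rw [e6 q hqr, e5 q (by omega), k1 q hq hqr]
  · rw [e6 _ (by omega)]; simp [h5]
  · rw [e6 _ (by omega), e5 _ (by omega)]
    exact k3

namespace Ex

/-- A program that leaves the value of the expression in register `s` and uses only registers from
`s` on as scratch space. -/
def compile : Ex → ℕ → Prog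
  | const n, s => .const s n
  | var r, s => .seq (.const s 0) (.add s r s)
  | len, s => .len s 0
  | read e, s => .seq (e.compile s) (.read s 0 s)
  | add a b, s => .seq (a.compile s) (.seq (b.compile (s + 1)) (.add s s (s + 1)))
  | sub a b, s => .seq (a.compile s) (.seq (b.compile (s + 1)) (.sub s s (s + 1)))
  | mul a b, s => .seq (b.compile (s + 1)) (.seq (a.compile (s + 2))
      (.seq (Prog.forLoop s (s + 2) (.add (s + 4) (s + 4) (s + 1))) (.add s (s + 4) (s + 5))))
  | ite c a b, s => .seq (c.compile s) (.cond s (a.compile s) (b.compile s))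
  | sum r e b, s => .seq (e.compile s) (.seq
      (Prog.forLoop r s (.seq (b.compile (s + 4)) (.add (s + 2) (s + 2) (s + 4))))
      (.add s (s + 2) (s + 3)))

/-- A bound for the running time when the input data are bounded by `M`. -/
def time : Ex → ℕ → ℕ
  | const _, _ => 1
  | var _, _ => 2
  | len, _ => 1
  | read e, M => e.time M + 1
  | add a b, M => a.time M + b.time M + 1
  | sub a b, M => a.time M + b.time M + 1
  | mul a b, M => b.time M + a.time M + (a.bound M * 4 + 8)
  | ite c a b, M => c.time M + (a.time M + b.time M + 1)
  | sum _ e b, M => e.time M + (e.bound M * (b.time (M + e.bound M) + 4) + 8)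

theorem time_poly (e : Ex) : Poly e.time := by
  induction e with
  | const n => exact Poly.const 1
  | var r => exact Poly.const 2
  | len => exact Poly.const 1
  | read e he => exact he.add (Poly.const 1)
  | add a b ha hb => exact (ha.add hb).add (Poly.const 1)
  | sub a b ha hb => exact (ha.add hb).add (Poly.const 1)
  | mul a b ha hb =>
    exact (hb.add ha).add ((a.bound_poly.mul (Poly.const 4)).add (Poly.const 8))
  | ite c a b hc ha hb => exact hc.add ((ha.add hb).add (Poly.const 1))
  | sum r e b he hb =>
    exact he.add ((e.bound_poly.mul ((hb.comp (Poly.id.add e.bound_poly)).add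
      (Poly.const 4))).add (Poly.const 8))

/-- Variables live below `B` and scratch space begins at `s ≥ B`; compiling operands at different
levels preserves the one computed earlier. The machine has no multiplication, so a product is
repeated addition, and a sum keeps its partial sums in the accumulator. -/
theorem compile_spec (w : List ℕ) (B : ℕ) (e : Ex) : ∀ (s M : ℕ) (ρ : ℕ → ℕ) (σ : Store),
    e.Below B → B ≤ s → (∀ r < B, σ.reg r = ρ r) → σ.vec 0 = w → (∀ r < B, ρ r ≤ M) →
    w.length ≤ M → (∀ a ∈ w, a ≤ M) →
    ∃ t ≤ e.time M, ∃ σ', Exec (e.compile s) σ t σ' ∧ σ'.vec = σ.vec ∧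
      (∀ q < s, σ'.reg q = σ.reg q) ∧ σ'.reg s = e.eval w ρ := by
  induction e with
  | const n =>
    intro s M ρ σ _ _ _ _ _ _ _
    refine ⟨1, le_rfl, _, .const _ _ _, rfl, fun q hq => ?_, ?_⟩
    · simp [Function.update_of_ne hq.ne]
    · simp [eval]
  | var r =>
    intro s M ρ σ hB hs hρ _ _ _ _
    have hr : r < B := hB
    refine ⟨1 + 1, le_rfl, _, .seq (.const _ _ _) (.add _ _ _ _), rfl, fun q hq => ?_, ?_⟩
    · simp [Function.update_of_ne hq.ne]
    · have : r ≠ s := by omega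
      simp [eval, Function.update_of_ne this, hρ r hr]
  | len =>
    intro s M ρ σ hB hs hρ hw _ _ _
    refine ⟨1, le_rfl, _, .len _ _ _, rfl, fun q hq => ?_, ?_⟩
    · simp [Function.update_of_ne hq.ne]
    · simp [eval, hw]
  | read e he =>
    intro s M ρ σ hB hs hρ hw h1 h2 h3
    obtain ⟨t, ht, σ', hE, k1, k2, k3⟩ := he s M ρ σ hB hs hρ hw h1 h2 h3
    refine ⟨t + 1, Nat.add_le_add_right ht 1, _, .seq hE (.read _ _ _ _), by simp [k1],
      fun q hq => ?_, ?_⟩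
    · simp [Function.update_of_ne hq.ne, k2 q hq]
    · simp only [Store.setReg_reg, Function.update_self, eval, k1, k3, hw]
  | add a b ha hb =>
    intro s M ρ σ hB hs hρ hw h1 h2 h3
    obtain ⟨t, ht, σ₁, hE, k1, k2, k3⟩ := ha s M ρ σ hB.1 hs hρ hw h1 h2 h3
    obtain ⟨t', ht', σ₂, hE', l1, l2, l3⟩ := hb (s + 1) M ρ σ₁ hB.2 (by omega)
      (fun r hr => by rw [k2 r (by omega), hρ r hr]) (by rw [k1, hw]) h1 h2 h3
    refine ⟨t + (t' + 1), by simp only [time]; omega, _, .seq hE (.seq hE' (.add _ _ _ _)),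
      by simp [l1, k1], fun q hq => ?_, ?_⟩
    · simp [Function.update_of_ne hq.ne, l2 q (by omega), k2 q hq]
    · simp only [Store.setReg_reg, Function.update_self, eval, l3, l2 s (by omega), k3]
  | sub a b ha hb =>
    intro s M ρ σ hB hs hρ hw h1 h2 h3
    obtain ⟨t, ht, σ₁, hE, k1, k2, k3⟩ := ha s M ρ σ hB.1 hs hρ hw h1 h2 h3
    obtain ⟨t', ht', σ₂, hE', l1, l2, l3⟩ := hb (s + 1) M ρ σ₁ hB.2 (by omega)
      (fun r hr => by rw [k2 r (by omega), hρ r hr]) (by rw [k1, hw]) h1 h2 h3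
    refine ⟨t + (t' + 1), by simp only [time]; omega, _, .seq hE (.seq hE' (.sub _ _ _ _)),
      by simp [l1, k1], fun q hq => ?_, ?_⟩
    · simp [Function.update_of_ne hq.ne, l2 q (by omega), k2 q hq]
    · simp only [Store.setReg_reg, Function.update_self, eval, l3, l2 s (by omega), k3]
  | mul a b ha hb =>
    intro s M ρ σ hB hs hρ hw h1 h2 h3
    obtain ⟨t, ht, σ₁, hE, k1, k2, k3⟩ := hb (s + 1) M ρ σ hB.2 (by omega) hρ hw h1 h2 h3
    obtain ⟨t', ht', σ₂, hE', l1, l2, l3⟩ := ha (s + 2) M ρ σ₁ hB.1 (by omega)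
      (fun r hr => by rw [k2 r (by omega), hρ r hr]) (by rw [k1, hw]) h1 h2 h3
    have hav := a.eval_le_bound w B ρ M hB.1 h1 h2 h3
    have hsv : σ₂.reg (s + 1) = b.eval w ρ := by rw [l2 (s + 1) (by omega), k3]
    obtain ⟨t'', ht'', σ₃, hE'', m1, m2, m3, m4⟩ := Prog.forLoop_spec (r := s) (s := s + 2)
      (T := 1) (body := .add (s + 4) (s + 4) (s + 1)) (by omega)
      (fun i x v => x = i * b.eval w ρ ∧ v = σ₂.vec) σ₂ l3 (by simp) (by
        rintro i hi σ₄ g1 ⟨g2, g3⟩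
        refine ⟨1, le_rfl, _, .add _ _ _ _, fun q hq hq' => ?_, ?_, g3⟩
        · have : q ≠ s + 4 := by omega
          simp [Function.update_of_ne this]
        · have g4 := g1 (s + 1) (by omega)
          rw [Function.update_of_ne (by omega), hsv] at g4
          have g2' : σ₄.reg (s + 4) = i * b.eval w ρ := g2
          simp only [Store.setReg_reg]
          rw [show s + 2 + 2 = s + 4 from rfl, Function.update_self, g2', g4]
          ring)
    refine ⟨t + (t' + (t'' + 1)), ?_, _, .seq hE (.seq hE' (.seq hE'' (.add _ _ _ _))),
      by simp [m4, l1, k1], fun q hq => ?_, ?_⟩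
    · have : a.eval w ρ * (1 + 3) ≤ a.bound M * 4 := Nat.mul_le_mul_right _ hav
      simp only [time]; omega
    · rw [Store.setReg_reg, Function.update_of_ne hq.ne, m1 q (by omega), l2 q (by omega),
        k2 q (by omega)]
    · have m3' : σ₃.reg (s + 4) = a.eval w ρ * b.eval w ρ := m3
      have m2' : σ₃.reg (s + 5) = 0 := m2
      simp [eval, m2', m3']
  | ite c a b hc ha hb =>
    intro s M ρ σ hB hs hρ hw h1 h2 h3
    obtain ⟨t, ht, σ₁, hE, k1, k2, k3⟩ := hc s M ρ σ hB.1 hs hρ hw h1 h2 h3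
    have hρ' : ∀ r < B, σ₁.reg r = ρ r := fun r hr => by rw [k2 r (by omega), hρ r hr]
    by_cases h : c.eval w ρ = 0
    · obtain ⟨t', ht', σ₂, hE', l1, l2, l3⟩ := hb s M ρ σ₁ hB.2.2 hs hρ' (by rw [k1, hw]) h1 h2 h3
      refine ⟨t + (t' + 1), by simp only [time]; omega, _,
        .seq hE (.cond_false (by rw [k3, h]) hE'), by rw [l1, k1],
        fun q hq => by rw [l2 q hq, k2 q hq], by simp [eval, h, l3]⟩
    · obtain ⟨t', ht', σ₂, hE', l1, l2, l3⟩ := ha s M ρ σ₁ hB.2.1 hs hρ' (by rw [k1, hw]) h1 h2 h3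
      refine ⟨t + (t' + 1), by simp only [time]; omega, _,
        .seq hE (.cond_true (by rw [k3]; exact h) hE'), by rw [l1, k1],
        fun q hq => by rw [l2 q hq, k2 q hq], by simp [eval, h, l3]⟩
  | sum r e b he hb =>
    intro s M ρ σ hB hs hρ hw h1 h2 h3
    obtain ⟨hr, hBe, hBb⟩ := hB
    obtain ⟨t, ht, σ₁, hE, k1, k2, k3⟩ := he s M ρ σ hBe hs hρ hw h1 h2 h3
    have hev := e.eval_le_bound w B ρ M hBe h1 h2 h3
    obtain ⟨t', ht', σ₂, hE', m1, m2, m3⟩ := Prog.forLoop_spec (r := r) (s := s)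
      (T := b.time (M + e.bound M) + 1)
      (body := .seq (b.compile (s + 4)) (.add (s + 2) (s + 2) (s + 4))) (by omega)
      (fun i x v => x = ∑ j ∈ Finset.range i, b.eval w (Function.update ρ r j) ∧ v = σ₁.vec)
      σ₁ k3 (by simp) (by
        rintro i hi σ₃ g1 ⟨g2, g3⟩
        obtain ⟨t', ht', σ₄, hE', l1, l2, l3⟩ := hb (s + 4) (M + e.bound M)
          (Function.update ρ r i) σ₃ hBb (by omega)
          (fun q hq => by
            rw [g1 q (by omega)]
            by_cases hqr : q = r
            · subst hqr; simp
            · rw [Function.update_of_ne hqr, Function.update_of_ne hqr, k2 q (by omega), hρ q hq])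
          (by rw [g3, k1, hw])
          (fun q hq => by
            by_cases hqr : q = r
            · subst hqr; simp; omega
            · rw [Function.update_of_ne hqr]; exact (h1 q hq).trans (by omega))
          (by omega) (fun a ha => (h3 a ha).trans (by omega))
        refine ⟨t' + 1, by omega, _, .seq hE' (.add _ _ _ _), fun q hq hq' => ?_, ?_, ?_⟩
        · simp [Function.update_of_ne hq', l2 q hq]
        · simp only [Store.setReg_reg, Function.update_self]
          rw [l3, l2 _ (by omega), g2, Finset.sum_range_succ]
        · simp [l1, g3])
    obtain ⟨m3, m4⟩ := m3
    refine ⟨t + (t' + 1), ?_, _, .seq hE (.seq hE' (.add _ _ _ _)), by simp [m4, k1],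
      fun q hq => ?_, ?_⟩
    · have : e.eval w ρ * (b.time (M + e.bound M) + 1 + 3) ≤
        e.bound M * (b.time (M + e.bound M) + 4) := Nat.mul_le_mul_right _ hev
      simp only [time]; omega
    · simp [Function.update_of_ne hq.ne, m1 q hq, k2 q hq]
    · simp [eval, m2, m3]

end Ex

/-- Statements that print a list of numbers. -/
inductive St : Type
  | skip : St
  | emit (e : Ex) : St
  | seq (p q : St) : St
  /-- run the body for all values of variable `r` below `e`, in increasing order -/
  | loop (r : ℕ) (e : Ex) (p : St) : St

namespace St

/-- The printed list on the input word `w` with the variables given by `ρ`. -/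
def out (w : List ℕ) : St → (ℕ → ℕ) → List ℕ
  | skip, _ => []
  | emit e, ρ => [e.eval w ρ]
  | seq p q, ρ => p.out w ρ ++ q.out w ρ
  | loop r e p, ρ => (List.range (e.eval w ρ)).flatMap fun i => p.out w (Function.update ρ r i)

/-- All variables have names below `B`. -/
def Below (B : ℕ) : St → Prop
  | skip => True
  | emit e => e.Below B
  | seq p q => p.Below B ∧ q.Below B
  | loop r e p => r < B ∧ e.Below B ∧ p.Below B

/-- A program that appends the printed list to `vec 1` and uses only registers from `s` on as
scratch space. -/
def compile : St → ℕ → Prog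
  | skip, s => .const s 0
  | emit e, s => .seq (e.compile s) (.push 1 s)
  | seq p q, s => .seq (p.compile s) (q.compile s)
  | loop r e p, s => .seq (e.compile s) (Prog.forLoop r s (p.compile (s + 4)))

/-- A bound for the running time when the input data are bounded by `M`. -/
def time : St → ℕ → ℕ
  | skip, _ => 1
  | emit e, M => e.time M + 1
  | seq p q, M => p.time M + q.time M
  | loop _ e p, M => e.time M + (e.bound M * (p.time (M + e.bound M) + 3) + 7)

theorem time_poly (p : St) : Poly p.time := by
  induction p with
  | skip => exact Poly.const 1
  | emit e => exact e.time_poly.add (Poly.const 1)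
  | seq p q hp hq => exact hp.add hq
  | loop r e p hp =>
    exact e.time_poly.add ((e.bound_poly.mul ((hp.comp (Poly.id.add e.bound_poly)).add
      (Poly.const 3))).add (Poly.const 7))

/-- The loop invariant says that `vec 1` consists of its old content and the output of the rounds
done so far. The input in `vec 0` is never written, so it can be reread in every round. -/
theorem compile_spec (w : List ℕ) (B : ℕ) (p : St) : ∀ (s M : ℕ) (ρ : ℕ → ℕ) (σ : Store),
    p.Below B → B ≤ s → (∀ r < B, σ.reg r = ρ r) → σ.vec 0 = w → (∀ r < B, ρ r ≤ M) →
    w.length ≤ M → (∀ a ∈ w, a ≤ M) →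
    ∃ t ≤ p.time M, ∃ σ', Exec (p.compile s) σ t σ' ∧
      σ'.vec = Function.update σ.vec 1 (σ.vec 1 ++ p.out w ρ) ∧
      (∀ q < s, σ'.reg q = σ.reg q) := by
  induction p with
  | skip =>
    intro s M ρ σ _ _ _ _ _ _ _
    refine ⟨1, le_rfl, _, .const _ _ _, by simp [out], fun q hq => ?_⟩
    simp [Function.update_of_ne hq.ne]
  | emit e =>
    intro s M ρ σ hB hs hρ hw h1 h2 h3
    obtain ⟨t, ht, σ', hE, k1, k2, k3⟩ := e.compile_spec w B s M ρ σ hB hs hρ hw h1 h2 h3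
    refine ⟨t + 1, Nat.add_le_add_right ht 1, _, .seq hE (.push _ _ _), ?_, fun q hq => ?_⟩
    · simp [out, k1, k3]
    · simp [k2 q hq]
  | seq p q hp hq =>
    intro s M ρ σ hB hs hρ hw h1 h2 h3
    obtain ⟨t, ht, σ₁, hE, k1, k2⟩ := hp s M ρ σ hB.1 hs hρ hw h1 h2 h3
    obtain ⟨t', ht', σ₂, hE', l1, l2⟩ := hq s M ρ σ₁ hB.2 hs
      (fun r hr => by rw [k2 r (by omega), hρ r hr]) (by simp [k1, hw]) h1 h2 h3
    refine ⟨t + t', Nat.add_le_add ht ht', _, .seq hE hE', ?_, fun q hq => ?_⟩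
    · simp [out, l1, k1]
    · rw [l2 q hq, k2 q hq]
  | loop r e p hp =>
    intro s M ρ σ hB hs hρ hw h1 h2 h3
    obtain ⟨hr, hBe, hBp⟩ := hB
    obtain ⟨t, ht, σ₁, hE, k1, k2, k3⟩ := e.compile_spec w B s M ρ σ hBe hs hρ hw h1 h2 h3
    have hev := e.eval_le_bound w B ρ M hBe h1 h2 h3
    obtain ⟨t', ht', σ₂, hE', m1, m2, m3⟩ := Prog.forLoop_spec (r := r) (s := s)
      (T := p.time (M + e.bound M)) (body := p.compile (s + 4)) (by omega)
      (fun i _ v => v = Function.update σ.vec 1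
        (σ.vec 1 ++ (List.range i).flatMap fun j => p.out w (Function.update ρ r j)))
      σ₁ k3 (by simp [k1]) (by
        intro i hi σ₃ g1 g3
        obtain ⟨t', ht', σ₄, hE', l1, l2⟩ := hp (s + 4) (M + e.bound M)
          (Function.update ρ r i) σ₃ hBp (by omega)
          (fun q hq => by
            rw [g1 q (by omega)]
            by_cases hqr : q = r
            · subst hqr; simp
            · rw [Function.update_of_ne hqr, Function.update_of_ne hqr, k2 q (by omega), hρ q hq])
          (by simp [g3, hw])
          (fun q hq => by
            by_cases hqr : q = r
            · subst hqr; simp; omega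
            · rw [Function.update_of_ne hqr]; exact (h1 q hq).trans (by omega))
          (by omega) (fun a ha => (h3 a ha).trans (by omega))
        refine ⟨t', ht', _, hE', fun q hq _ => l2 q hq, ?_⟩
        rw [l1, g3]
        simp [List.range_succ])
    refine ⟨t + t', ?_, _, .seq hE hE', m3, fun q hq => by rw [m1 q hq, k2 q hq]⟩
    have : e.eval w ρ * (p.time (M + e.bound M) + 3) ≤
      e.bound M * (p.time (M + e.bound M) + 3) := Nat.mul_le_mul_right _ hev
    simp only [time]; omega

theorem exists_below (p : St) : ∃ B, p.Below B := by
  have mono : ∀ (e : Ex) (B B' : ℕ), B ≤ B' → e.Below B → e.Below B' := by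
    intro e
    induction e with
    | const n => intros; trivial
    | len => intros; trivial
    | var r => intro B B' h h'; exact lt_of_lt_of_le h' h
    | read e he => intro B B' h h'; exact he _ _ h h'
    | add a b ha hb => intro B B' h h'; exact ⟨ha _ _ h h'.1, hb _ _ h h'.2⟩
    | sub a b ha hb => intro B B' h h'; exact ⟨ha _ _ h h'.1, hb _ _ h h'.2⟩
    | mul a b ha hb => intro B B' h h'; exact ⟨ha _ _ h h'.1, hb _ _ h h'.2⟩
    | ite c a b hc ha hb =>
      intro B B' h h'; exact ⟨hc _ _ h h'.1, ha _ _ h h'.2.1, hb _ _ h h'.2.2⟩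
    | sum r a b ha hb =>
      intro B B' h h'; exact ⟨lt_of_lt_of_le h'.1 h, ha _ _ h h'.2.1, hb _ _ h h'.2.2⟩
  have ex : ∀ e : Ex, ∃ B, e.Below B := by
    intro e
    induction e with
    | const n => exact ⟨0, trivial⟩
    | len => exact ⟨0, trivial⟩
    | var r => exact ⟨r + 1, Nat.lt_succ_self r⟩
    | read e he => exact he
    | add a b ha hb =>
      obtain ⟨A, hA⟩ := ha
      obtain ⟨B, hB⟩ := hb
      exact ⟨A + B, mono _ _ _ (by omega) hA, mono _ _ _ (by omega) hB⟩
    | sub a b ha hb =>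
      obtain ⟨A, hA⟩ := ha
      obtain ⟨B, hB⟩ := hb
      exact ⟨A + B, mono _ _ _ (by omega) hA, mono _ _ _ (by omega) hB⟩
    | mul a b ha hb =>
      obtain ⟨A, hA⟩ := ha
      obtain ⟨B, hB⟩ := hb
      exact ⟨A + B, mono _ _ _ (by omega) hA, mono _ _ _ (by omega) hB⟩
    | ite c a b hc ha hb =>
      obtain ⟨C, hC⟩ := hc
      obtain ⟨A, hA⟩ := ha
      obtain ⟨B, hB⟩ := hb
      exact ⟨A + B + C, mono _ _ _ (by omega) hC, mono _ _ _ (by omega) hA,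
        mono _ _ _ (by omega) hB⟩
    | sum r a b ha hb =>
      obtain ⟨A, hA⟩ := ha
      obtain ⟨B, hB⟩ := hb
      exact ⟨A + B + r + 1, by omega, mono _ _ _ (by omega) hA, mono _ _ _ (by omega) hB⟩
  have mono' : ∀ (p : St) (B B' : ℕ), B ≤ B' → p.Below B → p.Below B' := by
    intro p
    induction p with
    | skip => intros; trivial
    | emit e => intro B B' h h'; exact mono e _ _ h h'
    | seq p q hp hq => intro B B' h h'; exact ⟨hp _ _ h h'.1, hq _ _ h h'.2⟩
    | loop r e p hp =>
      intro B B' h h'; exact ⟨lt_of_lt_of_le h'.1 h, mono _ _ _ h h'.2.1, hp _ _ h h'.2.2⟩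
  induction p with
  | skip => exact ⟨0, trivial⟩
  | emit e => exact ex e
  | seq p q hp hq =>
    obtain ⟨A, hA⟩ := hp
    obtain ⟨B, hB⟩ := hq
    exact ⟨A + B, mono' _ _ _ (by omega) hA, mono' _ _ _ (by omega) hB⟩
  | loop r e p hp =>
    obtain ⟨A, hA⟩ := ex e
    obtain ⟨B, hB⟩ := hp
    exact ⟨A + B + r + 1, by omega, mono _ _ _ (by omega) hA, mono' _ _ _ (by omega) hB⟩

/-- Every statement is realised by a program whose running time is polynomial in the length of the
input word. -/
theorem exists_prog (p : St) : ∃ (q : Prog) (c : ℕ), ∀ w w' : List Bool,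
    p.out (w.map Bool.toNat) (fun _ => 0) = w'.map Bool.toNat →
    ∃ t ≤ (w.length + 2) ^ c, Outputs q w t w' := by
  obtain ⟨B, hB⟩ := p.exists_below
  obtain ⟨c, hc⟩ := p.time_poly.comp (Poly.id.add (Poly.const 1))
  refine ⟨p.compile B, c, fun w w' h => ?_⟩
  -- The bound `w.length + 1` also covers the bits of an empty or short word.
  obtain ⟨t, ht, σ, hE, hv, -⟩ := p.compile_spec (w.map Bool.toNat) B B (w.length + 1) (fun _ => 0)
    (initStore w) hB le_rfl (fun _ _ => rfl) rfl (by simp) (by simp) (by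
      intro a ha
      obtain ⟨b, -, rfl⟩ := List.mem_map.1 ha
      cases b <;> simp)
  refine ⟨t, ht.trans (hc w.length), σ, hE, ?_⟩
  rw [hv, h]
  simp [initStore]

end St
end FPT

namespace FPT

/-! ### Running one program after another -/

/-- All registers and vectors that the program mentions have names below this number. -/
def Prog.names : Prog → ℕ
  | .const r _ => r + 1
  | .add r a b => r + a + b + 1
  | .sub r a b => r + a + b + 1
  | .len r v => r + v + 1
  | .read r v i => r + v + i + 1
  | .write v i a => v + i + a + 1
  | .push v a => v + a + 1
  | .clear v => v + 1
  | .seq p q => p.names + q.names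
  | .cond r p q => r + p.names + q.names + 1
  | .loop r p => r + p.names + 1

theorem Exec.unchanged {p : Prog} {s s' : Store} {t : ℕ} (h : Exec p s t s') :
    ∀ q, p.names ≤ q → s'.reg q = s.reg q ∧ s'.vec q = s.vec q := by
  induction h with
  | seq _ _ ih1 ih2 =>
    intro q hq
    simp only [Prog.names] at hq
    have h1 := ih1 q (by omega)
    have h2 := ih2 q (by omega)
    exact ⟨h2.1.trans h1.1, h2.2.trans h1.2⟩
  | cond_true _ _ ih => intro q hq; simp only [Prog.names] at hq; exact ih q (by omega)
  | cond_false _ _ ih => intro q hq; simp only [Prog.names] at hq; exact ih q (by omega)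
  | loop_stop _ => intro q _; exact ⟨rfl, rfl⟩
  | loop_step _ _ _ ih1 ih2 =>
    intro q hq
    simp only [Prog.names] at hq ih2
    have h1 := ih1 q (by omega)
    have h2 := ih2 q (by omega)
    exact ⟨h2.1.trans h1.1, h2.2.trans h1.2⟩
  | _ =>
    intro q hq
    simp only [Prog.names] at hq
    constructor
    · simp only [Store.setReg_reg, Store.setVec_reg]
      try rw [Function.update_of_ne (by omega)]
    · simp only [Store.setReg_vec, Store.setVec_vec]
      try rw [Function.update_of_ne (by omega)]

/-- Only `push` lengthens a vector, by one entry per step. Hence an intermediate output is no longer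
than the time spent on it. -/
theorem Exec.length_le {p : Prog} {s s' : Store} {t : ℕ} (h : Exec p s t s') (v : ℕ) :
    (s'.vec v).length ≤ (s.vec v).length + t := by
  induction h with
  | seq _ _ ih1 ih2 => omega
  | cond_true _ _ ih => omega
  | cond_false _ _ ih => omega
  | loop_stop _ => omega
  | loop_step _ _ _ ih1 ih2 => omega
  | write u i a s =>
    simp only [Store.setVec_vec]
    by_cases hv : v = u
    · subst hv; simp
    · simp [Function.update_of_ne hv]
  | push u a s =>
    simp only [Store.setVec_vec]
    by_cases hv : v = u
    · subst hv; simp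
    · simp [Function.update_of_ne hv]
  | clear u s =>
    simp only [Store.setVec_vec]
    by_cases hv : v = u
    · subst hv; simp
    · simp [Function.update_of_ne hv]
  | _ => simp

/-- Set the registers below `n` to `0` and empty the vectors `1, …, n`. -/
def Prog.wipe : ℕ → Prog
  | 0 => .const 0 0
  | n + 1 => .seq (Prog.wipe n) (.seq (.const n 0) (.clear (n + 1)))

theorem Prog.wipe_spec (n : ℕ) (s : Store) : ∃ s', Exec (Prog.wipe n) s (2 * n + 1) s' ∧
    s'.reg 0 = 0 ∧ (∀ q < n, s'.reg q = 0) ∧ (∀ q, n ≤ q → q ≠ 0 → s'.reg q = s.reg q) ∧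
    (∀ q, 0 < q → q ≤ n → s'.vec q = []) ∧ (∀ q, q = 0 ∨ n < q → s'.vec q = s.vec q) := by
  induction n with
  | zero =>
    refine ⟨_, .const _ _ _, by simp, by simp, fun q _ hq => ?_, ?_, ?_⟩
    · simp [Function.update_of_ne hq]
    · intro q h1 h2; omega
    · intro q _; rfl
  | succ n ih =>
    obtain ⟨s', hE, h0, h1, h2, h3, h4⟩ := ih
    rw [show 2 * (n + 1) + 1 = (2 * n + 1) + (1 + 1) by ring]
    refine ⟨_, .seq hE (.seq (.const _ _ _) (.clear _ _)), ?_, ?_, ?_, ?_, ?_⟩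
    · simp only [Store.setVec_reg, Store.setReg_reg, Function.update_apply]
      split_ifs <;> simp [h0]
    · intro q hq
      simp only [Store.setVec_reg, Store.setReg_reg, Function.update_apply]
      split_ifs with h
      · rfl
      · exact h1 q (by omega)
    · intro q hq hq0
      simp only [Store.setVec_reg, Store.setReg_reg]
      rw [Function.update_of_ne (by omega)]
      exact h2 q (by omega) hq0
    · intro q hq0 hq
      simp only [Store.setVec_vec, Store.setReg_vec, Function.update_apply]
      split_ifs with h
      · rfl
      · exact h3 q hq0 (by omega)
    · intro q hq
      simp only [Store.setVec_vec, Store.setReg_vec]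
      rw [Function.update_of_ne (by omega)]
      exact h4 q (by omega)

/-- Append `vec 1` to `vec 0`, entry by entry, as long as register `1` counts down. -/
def Prog.copyLoop : Prog :=
  .loop 1 (.seq (.read 3 1 0) (.seq (.push 0 3) (.seq (.add 0 0 2) (.sub 1 1 2))))

theorem Prog.copyLoop_spec (l : List ℕ) : ∀ (n i : ℕ) (s : Store), i + n = l.length →
    s.reg 0 = i → s.reg 1 = n → s.reg 2 = 1 → s.vec 0 = l.take i → s.vec 1 = l →
    ∃ s', Exec Prog.copyLoop s (5 * n + 1) s' ∧ s'.vec 0 = l := by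
  intro n
  induction n with
  | zero =>
    intro i s hi h0 h1 h2 h3 h4
    refine ⟨s, Exec.loop_stop h1, ?_⟩
    rw [h3, List.take_of_length_le (by omega)]
  | succ n ih =>
    intro i s hi h0 h1 h2 h3 h4
    set s₁ := s.setReg 3 ((s.vec 1).getD (s.reg 0) 0) with hs₁
    set s₂ := s₁.setVec 0 (s₁.vec 0 ++ [s₁.reg 3]) with hs₂
    set s₃ := s₂.setReg 0 (s₂.reg 0 + s₂.reg 2) with hs₃
    set s₄ := s₃.setReg 1 (s₃.reg 1 - s₃.reg 2) with hs₄
    obtain ⟨s', hE, hv⟩ := ih (i + 1) s₄ (by omega)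
      (by simp [hs₄, hs₃, hs₂, hs₁, h0, h2]) (by simp [hs₄, hs₃, hs₂, hs₁, h1, h2])
      (by simp [hs₄, hs₃, hs₂, hs₁, h2])
      (by
        have hi' : i < l.length := by omega
        rw [List.take_add_one]
        simp [hs₄, hs₃, hs₂, hs₁, h0, h3, h4, hi'])
      (by simp [hs₄, hs₃, hs₂, hs₁, h4])
    refine ⟨s', ?_, hv⟩
    have := Exec.loop_step (r := 1) (by omega : s.reg 1 ≠ 0)
      (.seq (.read 3 1 0 s) (.seq (.push 0 3 s₁) (.seq (.add 0 0 2 s₂) (.sub 1 1 2 s₃)))) hE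
    rw [show 5 * (n + 1) + 1 = (1 + (1 + (1 + 1))) + (5 * n + 1) + 1 by ring]
    exact this

/-- Make the word in `vec 1` the input word of a fresh store, if nothing else is stored in
registers or vectors with names above `n`. -/
def Prog.restart (n : ℕ) : Prog :=
  .seq (.clear 0) <| .seq (.const 0 0) <| .seq (.len 1 1) <| .seq (.const 2 1) <|
  .seq Prog.copyLoop (Prog.wipe (n + 20))

/-- The second program expects exactly its initial store. Finitely many names have been touched, so
it suffices to copy the output into `vec 0` and to wipe an initial segment of names. -/
theorem Prog.restart_spec (n : ℕ) (w : List Bool) (s : Store) (hv : s.vec 1 = w.map Bool.toNat)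
    (hreg : ∀ q, n ≤ q → s.reg q = 0) (hvec : ∀ q, n ≤ q → q ≠ 0 → s.vec q = []) :
    Exec (Prog.restart n) s (5 * w.length + 2 * n + 46) (initStore w) := by
  set s₁ := s.setVec 0 [] with hs₁
  set s₂ := s₁.setReg 0 0 with hs₂
  set s₃ := s₂.setReg 1 (s₂.vec 1).length with hs₃
  set s₄ := s₃.setReg 2 1 with hs₄
  obtain ⟨s₅, hE, hv₅⟩ := Prog.copyLoop_spec (w.map Bool.toNat) w.length 0 s₄ (by simp)
    (by simp [hs₄, hs₃, hs₂, hs₁]) (by simp [hs₄, hs₃, hs₂, hs₁, hv])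
    (by simp [hs₄, hs₃, hs₂, hs₁]) (by simp [hs₄, hs₃, hs₂, hs₁])
    (by simp [hs₄, hs₃, hs₂, hs₁, hv])
  -- The margin `20` exceeds the bound `19` that `Prog.names` gives for the copying loop.
  obtain ⟨s₆, hE', k0, k1, k2, k3, k4⟩ := Prog.wipe_spec (n + 20) s₅
  have hs₆ : s₆ = initStore w := by
    have hreg₆ : s₆.reg = fun _ => 0 := by
      funext q
      by_cases hq : q < n + 20
      · exact k1 q hq
      · rw [k2 q (by omega) (by omega), (hE.unchanged q (by simp [copyLoop, names]; omega)).1]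
        simp only [hs₄, hs₃, hs₂, hs₁, Store.setReg_reg, Store.setVec_reg]
        rw [Function.update_of_ne (by omega), Function.update_of_ne (by omega),
          Function.update_of_ne (by omega)]
        exact hreg q (by omega)
    have hvec₆ : s₆.vec = fun v => if v = 0 then w.map Bool.toNat else [] := by
      funext q
      by_cases hq0 : q = 0
      · subst hq0; rw [k4 0 (Or.inl rfl), hv₅]; simp
      · rw [if_neg hq0]
        by_cases hq : q ≤ n + 20
        · exact k3 q (by omega) hq
        · rw [k4 q (by omega), (hE.unchanged q (by simp [copyLoop, names]; omega)).2]
          simp only [hs₄, hs₃, hs₂, hs₁, Store.setReg_vec, Store.setVec_vec]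
          rw [Function.update_of_ne (by omega)]
          exact hvec q (by omega) hq0
    cases s₆
    simp only [initStore, Store.mk.injEq]
    exact ⟨hreg₆, hvec₆⟩
  rw [show 5 * w.length + 2 * n + 46 =
    1 + (1 + (1 + (1 + ((5 * w.length + 1) + (2 * (n + 20) + 1))))) by ring, ← hs₆]
  exact .seq (.clear _ _) (.seq (.const _ _ _) (.seq (.len _ _ _) (.seq (.const _ _ _)
    (.seq hE hE'))))

theorem Outputs.trans {p q : Prog} {w w' w'' : List Bool} {t t' : ℕ} (h : Outputs p w t w')
    (h' : Outputs q w' t' w'') :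
    Outputs (.seq p (.seq (Prog.restart (p.names + 1)) q)) w
      (t + ((5 * w'.length + 2 * (p.names + 1) + 46) + t')) w'' := by
  obtain ⟨s, hE, hv⟩ := h
  obtain ⟨s', hE', hv'⟩ := h'
  refine ⟨s', .seq hE (.seq (Prog.restart_spec _ w' s hv ?_ ?_) hE'), hv'⟩
  · intro q hq
    rw [(hE.unchanged q (by omega)).1]
    rfl
  · intro q hq hq0
    rw [(hE.unchanged q (by omega)).2]
    simp [initStore, hq0]

theorem Outputs.length_le {p : Prog} {w w' : List Bool} {t : ℕ} (h : Outputs p w t w') :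
    w'.length ≤ t := by
  obtain ⟨s, hE, hv⟩ := h
  have := hE.length_le 1
  simpa [hv, initStore] using this

theorem computable_add_pow {f : ℕ → ℕ} (hf : Computable f) (a b : ℕ) :
    Computable (fun k => (f k + a) ^ b) := by
  induction b with
  | zero => simpa using Computable.const 1
  | succ b ih =>
    simp only [pow_succ]
    exact Primrec.nat_mul.to_comp.comp ih
      (Primrec.nat_add.to_comp.comp hf (Computable.const a))

/-- An fpt map followed by a polynomial time map that keeps the parameter. -/
theorem FPTMap.comp_poly {P Q Q' : ParamProblem} {R : P.Inst → ℕ → Q.Inst × ℕ}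
    (h : FPTMap P Q R) (F : Q.Inst → ℕ → Q'.Inst) (q : Prog) (c : ℕ)
    (hq : ∀ y k, ∃ t ≤ ((Q.word y k).length + 2) ^ c,
      Outputs q (Q.word y k) t (Q'.word (F y k) k)) :
    FPTMap P Q' (fun x k => (F (R x k).1 (R x k).2, (R x k).2)) := by
  obtain ⟨p, f, g, d, hf, hg, hR⟩ := h
  -- `D` absorbs the fixed cost of the restart and makes `t + D` at least `7`, so that all terms fit
  -- under `(t + D) ^ (c + 2)`.
  set D := 2 * (p.names + 1) + 60 with hD
  refine ⟨.seq p (.seq (Prog.restart (p.names + 1)) q), fun k => (f k + D) ^ (c + 2), g,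
    d * (c + 2), computable_add_pow hf _ _, hg, fun x k => ⟨(hR x k).1, ?_⟩⟩
  obtain ⟨-, t, ht, hO⟩ := hR x k
  obtain ⟨t', ht', hO'⟩ := hq (R x k).1 (R x k).2
  refine ⟨_, ?_, hO.trans hO'⟩
  have hl := hO.length_le
  set l := (Q.word (R x k).1 (R x k).2).length
  set L := (P.encode x).length
  have hL : 1 ≤ (L + 1) ^ d := Nat.one_le_pow _ _ (by omega)
  have h1 : t + D ≤ (f k + D) * (L + 1) ^ d := by
    rw [add_mul]
    exact Nat.add_le_add ht (Nat.le_mul_of_pos_right _ hL)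
  have h2 : (l + 2) ^ c ≤ (t + D) ^ c := Nat.pow_le_pow_left (by omega) _
  have h3 : 1 ≤ (t + D) ^ c := Nat.one_le_pow _ _ (by omega)
  calc _ ≤ (t + D) ^ c + 6 * (t + D) := by omega
    _ ≤ (t + D) ^ c * (t + D) + 6 * ((t + D) ^ c * (t + D)) := by
        refine Nat.add_le_add (Nat.le_mul_of_pos_right _ (by omega)) (Nat.mul_le_mul_left _ ?_)
        exact Nat.le_mul_of_pos_left _ h3
    _ = ((t + D) ^ c * (t + D)) * 7 := by ring
    _ ≤ ((t + D) ^ c * (t + D)) * (t + D) := Nat.mul_le_mul_left _ (by omega)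
    _ = (t + D) ^ (c + 2) := by ring
    _ ≤ ((f k + D) * (L + 1) ^ d) ^ (c + 2) := Nat.pow_le_pow_left h1 _
    _ = _ := by rw [mul_pow, pow_mul]

end FPT

namespace FPT

/-! ### Color refinement -/

section Stable

variable {V : Type} [Fintype V] {G : SimpleGraph V} {s : Setoid V}

theorem refineStep_le (G : SimpleGraph V) (s : Setoid V) : refineStep G s ≤ s := by
  intro u v h
  unfold refineStep at h
  exact Quotient.exact (Prod.ext_iff.1 (Setoid.ker_def.1 h)).1

theorem refineStep_iterate_antitone (G : SimpleGraph V) (s : Setoid V) :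
    Antitone (fun r => (refineStep G)^[r] s) := by
  refine antitone_nat_of_succ_le fun r => ?_
  rw [Function.iterate_succ_apply']
  exact refineStep_le G _

theorem stablePartition_le (G : SimpleGraph V) (s : Setoid V) : stablePartition G s ≤ s :=
  iInf_le (fun r : ℕ => (refineStep G)^[r] s) 0

theorem stablePartition_iff {u v : V} :
    stablePartition G s u v ↔ ∀ r : ℕ, ((refineStep G)^[r] s) u v := by
  show (∀ t ∈ Set.range (fun r : ℕ => (refineStep G)^[r] s), t u v) ↔ _
  simp

theorem refineStep_exists_neighbor {u v w : V} (h : refineStep G s u v) (hw : G.Adj u w) :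
    ∃ x, G.Adj v x ∧ s w x := by
  classical
  unfold refineStep at h
  have h1 := (Prod.ext_iff.1 (Setoid.ker_def.1 h)).2
  simp only at h1
  have h2 : (Quotient.mk s w : Quotient s) ∈
      (Finset.univ.filter (fun u => G.Adj v u)).val.map (fun u => (Quotient.mk s u : Quotient s)) :=
    by
      rw [← h1]
      exact Multiset.mem_map_of_mem _ (by simpa using hw)
  obtain ⟨x, hx, hx'⟩ := Multiset.mem_map.1 h2
  exact ⟨x, by simpa using hx, Quotient.exact hx'.symm⟩

/-- Vertices that stay together have neighbors that stay together. -/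
theorem stablePartition_exists_neighbor {u v w : V} (h : stablePartition G s u v)
    (hw : G.Adj u w) : ∃ x, G.Adj v x ∧ stablePartition G s w x := by
  classical
  by_contra! hne
  have h1 : ∀ x, ∃ r : ℕ, G.Adj v x → ¬ ((refineStep G)^[r] s) w x := by
    intro x
    by_cases hx : G.Adj v x
    · have h2 := hne x hx
      rw [stablePartition_iff] at h2
      obtain ⟨r, hr⟩ := not_forall.1 h2
      exact ⟨r, fun _ => hr⟩
    · exact ⟨0, fun h => absurd h hx⟩
  choose r hr using h1
  -- By finiteness one round separates `w` from all neighbors of `v`; one further round would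
  -- separate `u` from `v`.
  have h2 : ((refineStep G)^[Finset.univ.sup r + 1] s) u v :=
    iInf_le (fun r : ℕ => (refineStep G)^[r] s) (Finset.univ.sup r + 1) h
  rw [Function.iterate_succ_apply'] at h2
  obtain ⟨x, hx, hx'⟩ := refineStep_exists_neighbor h2 hw
  exact hr x hx (refineStep_iterate_antitone G s (Finset.le_sup (Finset.mem_univ x)) hx')

/-- An equitable partition that refines the initial one refines the stable one. -/
theorem le_stablePartition {E : Setoid V} (hE : E ≤ s)
    (h : ∀ u v, E u v → ∃ φ : Equiv.Perm V, (∀ w, G.Adj u w ↔ G.Adj v (φ w)) ∧ ∀ w, E w (φ w)) :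
    E ≤ stablePartition G s := by
  classical
  refine le_iInf fun r => ?_
  induction r with
  | zero => exact hE
  | succ r ih =>
    rw [Function.iterate_succ_apply']
    intro u v huv
    obtain ⟨φ, h1, h2⟩ := h u v huv
    refine Setoid.ker_def.2 (Prod.ext (Quotient.sound (ih huv)) ?_)
    have h3 : Finset.univ.filter (fun w => G.Adj v w) =
        (Finset.univ.filter (fun w => G.Adj u w)).map φ.toEmbedding := by
      ext w
      simp only [Finset.mem_filter, Finset.mem_univ, true_and, Finset.mem_map,
        Equiv.coe_toEmbedding]
      constructor
      · intro hw
        exact ⟨φ.symm w, by rw [h1]; simpa using hw, by simp⟩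
      · rintro ⟨x, hx, rfl⟩
        exact (h1 x).1 hx
    show Multiset.map _ _ = Multiset.map _ _
    rw [h3, Finset.map_val, Multiset.map_map]
    exact Multiset.map_congr rfl fun w _ => Quotient.sound (ih (h2 w))

/-- The neighbor `x` makes the degree of `m` into the common class positive, and the non-neighbor
`y` makes the codegree positive. -/
theorem one_le_colorValence {m x y : V} (hxy : s x y) (hx : G.Adj m x) (hy : ¬ G.Adj m y) :
    1 ≤ colorValence G s := by
  classical
  refine le_trans ?_ (Finset.le_sup (Finset.mem_univ (m, x)))
  refine le_min ?_ ?_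
  · exact Finset.card_pos.2 ⟨x, by simp [hx]⟩
  · refine Nat.sub_pos_of_lt (Finset.card_lt_card ?_)
    rw [Finset.ssubset_iff_of_subset (fun z hz => by simp at hz ⊢; exact hz.1)]
    exact ⟨y, by simpa using hxy, by simp [hy]⟩

theorem colorValence_eq_zero_of_discrete (h : ∀ u v, s u v → u = v) : colorValence G s = 0 := by
  classical
  refine Nat.le_zero.1 (Finset.sup_le fun q _ => ?_)
  by_cases hq : G.Adj q.1 q.2
  · refine (min_le_right _ _).trans (Nat.sub_eq_zero_of_le ?_).le
    refine Finset.card_le_card fun u hu => ?_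
    simp only [Finset.mem_filter, Finset.mem_univ, true_and] at hu ⊢
    rw [← h _ _ hu]
    exact ⟨s.refl _, hq⟩
  · refine (min_le_left _ _).trans (Finset.card_eq_zero.2 ?_).le
    refine Finset.filter_eq_empty_iff.2 fun u _ hu => hq ?_
    rw [h _ _ hu.1]
    exact hu.2

theorem individualize_eq_of_mem {V : Type} {c : V → ℕ} {S : Finset V} {u v : V} (hu : u ∈ S)
    (h : individualize c S u v) : u = v := by
  classical
  have h1 := Setoid.ker_def.1 h
  rw [if_pos hu] at h1
  split_ifs at h1
  exact Sum.inl.inj h1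

theorem individualize_color_eq {V : Type} {c : V → ℕ} {S : Finset V} {u v : V}
    (h : individualize c S u v) : c u = c v := by
  classical
  have h1 := Setoid.ker_def.1 h
  split_ifs at h1
  · rw [Sum.inl.inj h1]
  · exact Sum.inr.inj h1

theorem individualize_of_color_eq {V : Type} {c : V → ℕ} {S : Finset V} {u v : V}
    (hu : u ∉ S) (hv : v ∉ S) (h : c u = c v) : individualize c S u v := by
  classical
  refine Setoid.ker_def.2 ?_
  rw [if_neg hu, if_neg hv, h]

end Stable

/-! ### Graphs of triple systems

Every variable is represented by a pair of vertices. A triple of variables is represented by four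
middle vertices, such that splitting two of the three pairs splits the third. -/

/-- Distinctness within a triple ensures that a middle vertex meets each of its pairs in exactly one
vertex. The variables in `base` are split from the start. -/
structure TripleSys (Var Tr : Type) where
  P : Tr → Var
  Q : Tr → Var
  R : Tr → Var
  hPQ : ∀ τ, P τ ≠ Q τ
  hPR : ∀ τ, P τ ≠ R τ
  hQR : ∀ τ, Q τ ≠ R τ
  base : Var → Prop

namespace TripleSys

variable {Var Tr : Type} (T : TripleSys Var Tr)

/-- The vertices: a pair for every variable, four middle vertices for every triple. -/
abbrev Vert (Var Tr : Type) : Type := (Var × Bool) ⊕ (Tr × Bool × Bool)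

/-- The middle vertex `(τ, a, b)` is adjacent to the vertex `(x, i)`. -/
def Inc (τ : Tr) (a b : Bool) (x : Var) (i : Bool) : Prop :=
  (x = T.P τ ∧ i = a) ∨ (x = T.Q τ ∧ i = b) ∨ (x = T.R τ ∧ i = xor a b)

def Adj : Vert Var Tr → Vert Var Tr → Prop
  | .inl (x, i), .inr (τ, a, b) => T.Inc τ a b x i
  | .inr (τ, a, b), .inl (x, i) => T.Inc τ a b x i
  | _, _ => False

def SameColor : Vert Var Tr → Vert Var Tr → Prop
  | .inl (x, i), .inl (y, j) => x = y ∧ (T.base x → i = j)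
  | .inr (τ, _, _), .inr (τ', _, _) => τ = τ'
  | _, _ => False

/-- The variables whose pairs become split if the vertex is individualized. -/
def Touch : Vert Var Tr → Var → Prop
  | .inl (x, _), y => y = x
  | .inr (τ, _, _), y => y = T.P τ ∨ y = T.Q τ ∨ y = T.R τ

/-- The set of variables contains the base and with two variables of a triple also the third. -/
structure Closed (K : Var → Prop) : Prop where
  base : ∀ x, T.base x → K x
  hR : ∀ τ, K (T.P τ) → K (T.Q τ) → K (T.R τ)
  hQ : ∀ τ, K (T.P τ) → K (T.R τ) → K (T.Q τ)
  hP : ∀ τ, K (T.Q τ) → K (T.R τ) → K (T.P τ)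

/-- The partition in which exactly the pairs of the variables in `K` are split. -/
def maskRel (K : Var → Prop) : Vert Var Tr → Vert Var Tr → Prop
  | .inl (x, i), .inl (y, j) => x = y ∧ (K x → i = j)
  | .inr (τ, a, b), .inr (τ', a', b') =>
      τ = τ' ∧ (K (T.P τ) → a = a') ∧ (K (T.Q τ) → b = b') ∧ (K (T.R τ) → xor a b = xor a' b')
  | _, _ => False

theorem maskRel_equivalence (K : Var → Prop) : Equivalence (T.maskRel K) where
  refl := by rintro (⟨x, i⟩ | ⟨τ, a, b⟩) <;> simp [maskRel]
  symm := by
    rintro (⟨x, i⟩ | ⟨τ, a, b⟩) (⟨y, j⟩ | ⟨τ', a', b'⟩) h <;> simp only [maskRel] at h ⊢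
    · obtain ⟨rfl, h⟩ := h; exact ⟨rfl, fun hk => (h hk).symm⟩
    · obtain ⟨rfl, h1, h2, h3⟩ := h
      exact ⟨rfl, fun hk => (h1 hk).symm, fun hk => (h2 hk).symm, fun hk => (h3 hk).symm⟩
  trans := by
    rintro (⟨x, i⟩ | ⟨τ, a, b⟩) (⟨y, j⟩ | ⟨τ', a', b'⟩) (⟨z, l⟩ | ⟨τ'', a'', b''⟩) h h' <;>
      simp only [maskRel] at h h' ⊢
    · obtain ⟨rfl, h⟩ := h
      obtain ⟨rfl, h'⟩ := h'
      exact ⟨rfl, fun hk => (h hk).trans (h' hk)⟩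
    · obtain ⟨rfl, h1, h2, h3⟩ := h
      obtain ⟨rfl, h1', h2', h3'⟩ := h'
      exact ⟨rfl, fun hk => (h1 hk).trans (h1' hk), fun hk => (h2 hk).trans (h2' hk),
        fun hk => (h3 hk).trans (h3' hk)⟩

/-- Flip the middle vertices of every triple as prescribed. -/
def flipMid (α β : Tr → Bool) : Equiv.Perm (Vert Var Tr) :=
  Function.Involutive.toPerm (fun
    | .inl y => .inl y
    | .inr (τ, a, b) => .inr (τ, xor a (α τ), xor b (β τ)))
    (by rintro (y | ⟨τ, a, b⟩) <;> simp)

/-- Flip the pairs of variables as prescribed. -/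
def flipVar (γ : Var → Bool) : Equiv.Perm (Vert Var Tr) :=
  Function.Involutive.toPerm (fun
    | .inl (x, i) => .inl (x, xor i (γ x))
    | .inr y => .inr y)
    (by rintro (⟨x, i⟩ | y) <;> simp)

variable {T}

/-- The parity condition forces an even number of coordinates to flip. If the unknown `p` occurs in
the triple, closedness supplies a second unknown variable, and exactly these two coordinates are
flipped. -/
theorem Closed.exists_flip {K : Var → Prop} (hK : T.Closed K) {p : Var} (hp : ¬ K p) (τ : Tr) :
    ∃ α β : Bool, (T.P τ = p → α = true) ∧ (T.Q τ = p → β = true) ∧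
      (T.R τ = p → xor α β = true) ∧ (K (T.P τ) → α = false) ∧ (K (T.Q τ) → β = false) ∧
      (K (T.R τ) → xor α β = false) := by
  have h1 := T.hPQ τ
  have h2 := T.hPR τ
  have h3 := T.hQR τ
  by_cases e1 : T.P τ = p
  · subst e1
    by_cases hR : K (T.R τ)
    · exact ⟨true, true, by simp, by simp, fun h => absurd h h2.symm, fun h => absurd h hp,
        fun h => absurd (hK.hP τ h hR) hp, by simp⟩
    · exact ⟨true, false, by simp, fun h => absurd h h1.symm, by simp, fun h => absurd h hp,
        by simp, fun h => absurd h hR⟩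
  by_cases e2 : T.Q τ = p
  · subst e2
    by_cases hR : K (T.R τ)
    · exact ⟨true, true, by simp, by simp, fun h => absurd h h3.symm,
        fun h => absurd (hK.hQ τ h hR) hp, fun h => absurd h hp, by simp⟩
    · exact ⟨false, true, fun h => absurd h e1, by simp, by simp, by simp,
        fun h => absurd h hp, fun h => absurd h hR⟩
  by_cases e3 : T.R τ = p
  · subst e3
    by_cases hP : K (T.P τ)
    · exact ⟨false, true, fun h => absurd h e1, by simp, by simp, by simp,
        fun h => absurd (hK.hR τ hP h) hp, fun h => absurd h hp⟩
    · exact ⟨true, false, by simp, fun h => absurd h e2, by simp, fun h => absurd h hP, by simp,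
        fun h => absurd h hp⟩
  exact ⟨false, false, fun h => absurd h e1, fun h => absurd h e2, fun h => absurd h e3, by simp⟩

/-- The permutation need not be an automorphism: it only has to match the neighborhoods of the two
given vertices while moving every vertex within its class. For two vertices of an unsplit pair it
flips middle vertices; for two middle vertices of a triple it flips pairs. -/
theorem Closed.equitable {K : Var → Prop} (hK : T.Closed K) (u v : Vert Var Tr)
    (h : T.maskRel K u v) : ∃ φ : Equiv.Perm (Vert Var Tr),
      (∀ w, T.Adj u w ↔ T.Adj v (φ w)) ∧ ∀ w, T.maskRel K w (φ w) := by
  classical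
  have hrefl : ∀ w, T.maskRel K w w := (T.maskRel_equivalence K).refl
  rcases u with ⟨x, i⟩ | ⟨τ, a, b⟩ <;> rcases v with ⟨y, j⟩ | ⟨τ', a', b'⟩ <;>
    simp only [maskRel] at h
  · obtain ⟨rfl, h⟩ := h
    by_cases hij : i = j
    · subst hij
      exact ⟨Equiv.refl _, fun w => Iff.rfl, hrefl⟩
    have hx : ¬ K x := fun hk => hij (h hk)
    have hj : j = !i := by cases i <;> cases j <;> simp_all
    subst hj
    -- In each triple the flip toggles the coordinate of `x` and preserves the coordinates of all
    -- known variables.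
    choose α β h1 h2 h3 h4 h5 h6 using fun τ => hK.exists_flip hx τ
    refine ⟨flipMid α β, ?_, ?_⟩
    · rintro (⟨y, j⟩ | ⟨τ, a, b⟩)
      · exact Iff.rfl
      · show T.Inc τ a b x i ↔ T.Inc τ (xor a (α τ)) (xor b (β τ)) x (!i)
        unfold Inc
        refine or_congr ?_ (or_congr ?_ ?_)
        · refine and_congr_right fun hx' => ?_
          rw [h1 τ hx'.symm]; cases i <;> cases a <;> simp
        · refine and_congr_right fun hx' => ?_
          rw [h2 τ hx'.symm]; cases i <;> cases b <;> simp
        · refine and_congr_right fun hx' => ?_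
          have := h3 τ hx'.symm
          exact (by decide : ∀ i a b A B : Bool, xor A B = true →
            (i = xor a b ↔ (!i) = xor (xor a A) (xor b B))) i a b _ _ this
    · rintro (⟨y, j⟩ | ⟨τ, a, b⟩)
      · exact hrefl _
      · refine ⟨rfl, fun hk => ?_, fun hk => ?_, fun hk => ?_⟩
        · simp [h4 τ hk]
        · simp [h5 τ hk]
        · have := h6 τ hk
          exact (by decide : ∀ a b A B : Bool, xor A B = false →
            xor a b = xor (xor a A) (xor b B)) a b _ _ this
  · obtain ⟨rfl, h1, h2, h3⟩ := h
    -- Each of the three pairs is flipped exactly if the two middle vertices disagree in its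
    -- coordinate, which cannot happen for a known variable.
    refine ⟨flipVar (fun x => if x = T.P τ then xor a a' else if x = T.Q τ then xor b b' else
      if x = T.R τ then xor (xor a b) (xor a' b') else false), ?_, ?_⟩
    · rintro (⟨x, i⟩ | y)
      · show T.Inc τ a b x i ↔ T.Inc τ a' b' x (xor i _)
        have h12 := T.hPQ τ
        have h13 := T.hPR τ
        have h23 := T.hQR τ
        unfold Inc
        by_cases e1 : x = T.P τ
        · subst e1
          simp only [if_true, true_and, h12, h13, false_and, or_false]
          exact (by decide : ∀ i a a' : Bool, i = a ↔ xor i (xor a a') = a') i a a'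
        by_cases e2 : x = T.Q τ
        · subst e2
          simp only [if_true, true_and, h12.symm, h23, false_and, or_false, false_or, if_false]
          exact (by decide : ∀ i a a' : Bool, i = a ↔ xor i (xor a a') = a') i b b'
        by_cases e3 : x = T.R τ
        · subst e3
          simp only [if_true, true_and, h13.symm, h23.symm, false_and, false_or, if_false]
          exact (by decide : ∀ i a a' : Bool, i = a ↔ xor i (xor a a') = a') i _ _
        simp [e1, e2, e3]
      · exact Iff.rfl
    · rintro (⟨x, i⟩ | y)
      · refine ⟨rfl, fun hk => ?_⟩
        beta_reduce
        split_ifs with e1 e2 e3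
        · subst e1; simp [h1 hk]
        · subst e2; simp [h2 hk]
        · subst e3; simp [h3 hk]
        · simp
      · exact hrefl _

/-! ### Color refinement on a graph that realizes a triple system -/

section Realize

variable {V : Type} [Fintype V] {G : SimpleGraph V} {c : V → ℕ} {S : Finset V}
  (e : Vert Var Tr ≃ V)

/-- If some closed set of variables contains everything that is touched by `S`, then the pairs
outside of it are not split. -/
theorem Closed.not_split (hadj : ∀ u v, G.Adj (e u) (e v) ↔ T.Adj u v)
    (hcol : ∀ u v, T.SameColor u v → c (e u) = c (e v))
    {K : Var → Prop} (hK : T.Closed K) (hS : ∀ u, e u ∈ S → ∀ x, T.Touch u x → K x) {p : Var}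
    (hp : ¬ K p) (i j : Bool) :
    stablePartition G (individualize c S) (e (.inl (p, i))) (e (.inl (p, j))) := by
  let E : Setoid V := Setoid.comap e.symm ⟨T.maskRel K, T.maskRel_equivalence K⟩
  have hE : ∀ u v, E (e u) (e v) ↔ T.maskRel K u v := by
    intro u v
    show T.maskRel K _ _ ↔ _
    simp
  have hdisc : ∀ u v, e u ∈ S → T.maskRel K u v → u = v := by
    rintro (⟨x, i⟩ | ⟨τ, a, b⟩) (⟨y, j⟩ | ⟨τ', a', b'⟩) hu h <;> simp only [maskRel] at h
    · obtain ⟨rfl, h⟩ := h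
      rw [h (hS _ hu x rfl)]
    · obtain ⟨rfl, h1, h2, h3⟩ := h
      rw [h1 (hS _ hu _ (Or.inl rfl)), h2 (hS _ hu _ (Or.inr (Or.inl rfl)))]
  have hle : E ≤ individualize c S := by
    intro u' v' h
    obtain ⟨u, rfl⟩ := e.surjective u'
    obtain ⟨v, rfl⟩ := e.surjective v'
    have h' := (hE u v).1 h
    by_cases hu : e u ∈ S
    · rw [hdisc u v hu h']
    by_cases hv : e v ∈ S
    · rw [hdisc v u hv ((T.maskRel_equivalence K).symm h')]
    refine individualize_of_color_eq hu hv (hcol u v ?_)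
    rcases u with ⟨x, i⟩ | ⟨τ, a, b⟩ <;> rcases v with ⟨y, j⟩ | ⟨τ', a', b'⟩ <;>
      simp only [maskRel] at h'
    · exact ⟨h'.1, fun hb => h'.2 (hK.base _ hb)⟩
    · exact h'.1
  refine le_stablePartition hle ?_ ((hE _ _).2 ⟨rfl, fun hk => absurd hk hp⟩)
  intro u' v' h
  obtain ⟨u, rfl⟩ := e.surjective u'
  obtain ⟨v, rfl⟩ := e.surjective v'
  obtain ⟨φ, h1, h2⟩ := hK.equitable u v ((hE u v).1 h)
  refine ⟨(e.symm.trans φ).trans e, fun w' => ?_, fun w' => ?_⟩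
  · obtain ⟨w, rfl⟩ := e.surjective w'
    simp [hadj, h1]
  · obtain ⟨w, rfl⟩ := e.surjective w'
    simpa [hE] using h2 w

/-- The middle vertex `(τ, false, false)` is adjacent to exactly one vertex of the pair of `T.R τ`,
and this pair stays in one class. -/
theorem Closed.one_le_colorValence (hadj : ∀ u v, G.Adj (e u) (e v) ↔ T.Adj u v)
    (hcol : ∀ u v, T.SameColor u v → c (e u) = c (e v))
    {K : Var → Prop} (hK : T.Closed K) (hS : ∀ u, e u ∈ S → ∀ x, T.Touch u x → K x) {τ : Tr}
    (hp : ¬ K (T.R τ)) : 1 ≤ colorValence G (stablePartition G (individualize c S)) := by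
  refine FPT.one_le_colorValence (m := e (.inr (τ, false, false)))
    (hK.not_split e hadj hcol hS hp false true) ?_ ?_
  · rw [hadj]; exact Or.inr (Or.inr ⟨rfl, rfl⟩)
  · rw [hadj]
    show ¬ T.Inc _ _ _ _ _
    simp [Inc, (T.hPR τ).symm, (T.hQR τ).symm]

/-- If every closed set of variables that contains everything touched by `S` is full, then color
refinement makes the graph discrete. -/
theorem discrete_of_closed (hadj : ∀ u v, G.Adj (e u) (e v) ↔ T.Adj u v)
    (hcol : ∀ u v, c (e u) = c (e v) → T.SameColor u v)
    (hS : ∀ K : Var → Prop, T.Closed K → (∀ x i, e (.inl (x, i)) ∈ S → K x) → ∀ x, K x)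
    (u' v' : V) (h : stablePartition G (individualize c S) u' v') : u' = v' := by
  set s := stablePartition G (individualize c S) with hs
  -- `K` collects the variables whose pairs are split in the stable partition; the aim is to show
  -- that it is closed.
  let K : Var → Prop := fun x => ¬ s (e (.inl (x, false))) (e (.inl (x, true)))
  have hsame : ∀ u v, s (e u) (e v) → T.SameColor u v := fun u v h =>
    hcol _ _ (individualize_color_eq (stablePartition_le _ _ h))
  have hKx : ∀ x i j, K x → s (e (.inl (x, i))) (e (.inl (x, j))) → i = j := by
    intro x i j hk h
    cases i <;> cases j
    · rfl
    · exact absurd h hk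
    · exact absurd (s.symm h) hk
    · rfl
  have key : ∀ τ a b a' b', s (e (.inr (τ, a, b))) (e (.inr (τ, a', b'))) →
      (K (T.P τ) → a = a') ∧ (K (T.Q τ) → b = b') ∧ (K (T.R τ) → xor a b = xor a' b') := by
    intro τ a b a' b' h
    have h12 := T.hPQ τ
    have h13 := T.hPR τ
    have h23 := T.hQR τ
    -- Equivalent middle vertices have equivalent neighbors, and within a split pair equivalent
    -- means equal.
    have main : ∀ x i, T.Inc τ a b x i → K x → T.Inc τ a' b' x i := by
      intro x i hi hk
      obtain ⟨w', hw', hsw⟩ := stablePartition_exists_neighbor h ((hadj _ (.inl (x, i))).2 hi)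
      obtain ⟨w, rfl⟩ := e.surjective w'
      have hsc := hsame _ _ hsw
      rcases w with ⟨y, j⟩ | ⟨τ', a'', b''⟩
      · obtain ⟨rfl, -⟩ := hsc
        have := hKx x i j hk hsw
        subst this
        exact (hadj _ _).1 hw'
      · exact hsc.elim
    refine ⟨fun hk => ?_, fun hk => ?_, fun hk => ?_⟩
    · rcases main _ _ (Or.inl ⟨rfl, rfl⟩) hk with h | h | h
      · exact h.2
      · exact absurd h.1 h12
      · exact absurd h.1 h13
    · rcases main _ _ (Or.inr (Or.inl ⟨rfl, rfl⟩)) hk with h | h | h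
      · exact absurd h.1.symm h12
      · exact h.2
      · exact absurd h.1 h23
    · rcases main _ _ (Or.inr (Or.inr ⟨rfl, rfl⟩)) hk with h | h | h
      · exact absurd h.1.symm h13
      · exact absurd h.1.symm h23
      · exact h.2
  -- If the pair of `x` is unsplit, the middle vertex `(τ, false, false)` at one end must have an
  -- equivalent partner at the other end. When the other two pairs are split, both remaining
  -- coordinates are fixed and parity excludes such a partner.
  have back : ∀ τ x, ¬ K x → T.Inc τ false false x false → ∃ a b, T.Inc τ a b x true ∧
      s (e (.inr (τ, false, false))) (e (.inr (τ, a, b))) := by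
    intro τ x hk hi
    obtain ⟨w', hw', hsw⟩ := stablePartition_exists_neighbor (not_not.1 hk)
      ((hadj _ (.inr (τ, false, false))).2 hi)
    obtain ⟨w, rfl⟩ := e.surjective w'
    have hsc := hsame _ _ hsw
    rcases w with ⟨y, j⟩ | ⟨τ', a', b'⟩
    · exact hsc.elim
    · have : τ = τ' := hsc
      subst this
      exact ⟨a', b', (hadj _ _).1 hw', hsw⟩
  have hKc : T.Closed K := by
    refine ⟨fun x hb hsx => ?_, fun τ h1 h2 => ?_, fun τ h1 h2 => ?_, fun τ h1 h2 => ?_⟩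
    · exact absurd ((hsame _ _ hsx).2 hb) (by simp)
    · by_contra hk
      obtain ⟨a, b, hi, hsw⟩ := back τ _ (not_not.2 hk) (Or.inr (Or.inr ⟨rfl, rfl⟩))
      obtain ⟨k1, k2, -⟩ := key _ _ _ _ _ hsw
      rcases hi with hi | hi | hi
      · exact T.hPR τ hi.1.symm
      · exact T.hQR τ hi.1.symm
      · rw [← k1 h1, ← k2 h2] at hi; exact absurd hi.2 (by decide)
    · by_contra hk
      obtain ⟨a, b, hi, hsw⟩ := back τ _ (not_not.2 hk) (Or.inr (Or.inl ⟨rfl, rfl⟩))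
      obtain ⟨k1, -, k2⟩ := key _ _ _ _ _ hsw
      have k2' := k2 h2
      rcases hi with hi | hi | hi
      · exact T.hPQ τ hi.1.symm
      · rw [← k1 h1, ← hi.2] at k2'; exact absurd k2' (by decide)
      · exact T.hQR τ hi.1
    · by_contra hk
      obtain ⟨a, b, hi, hsw⟩ := back τ _ (not_not.2 hk) (Or.inl ⟨rfl, rfl⟩)
      obtain ⟨-, k1, k2⟩ := key _ _ _ _ _ hsw
      have k2' := k2 h2
      rcases hi with hi | hi | hi
      · rw [← k1 h1, ← hi.2] at k2'; exact absurd k2' (by decide)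
      · exact T.hPQ τ hi.1
      · exact T.hPR τ hi.1
  have hall : ∀ x, K x := by
    -- An individualized vertex is a singleton class, so its pair is split.
    refine hS K hKc fun x i hx hsx => ?_
    have h1 := stablePartition_le _ _ hsx
    cases i
    · exact absurd (e.injective (individualize_eq_of_mem hx h1)) (by simp)
    · exact absurd (e.injective (individualize_eq_of_mem hx (Setoid.symm' _ h1))) (by simp)
  obtain ⟨u, rfl⟩ := e.surjective u'
  obtain ⟨v, rfl⟩ := e.surjective v'
  have hsc := hsame u v h
  rcases u with ⟨x, i⟩ | ⟨τ, a, b⟩ <;> rcases v with ⟨y, j⟩ | ⟨τ', a', b'⟩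
  · obtain ⟨rfl, -⟩ := hsc
    rw [hKx x i j (hall x) h]
  · exact hsc.elim
  · exact hsc.elim
  · have : τ = τ' := hsc
    subst this
    obtain ⟨k1, k2, -⟩ := key _ _ _ _ _ h
    rw [k1 (hall _), k2 (hall _)]

end Realize

end TripleSys

end FPT

namespace FPT

/-! ### Horn systems

A rule lets two atoms imply a third. It is simulated by four triples on three fresh variables, in
such a way that nothing propagates from the conclusion to the premises. -/

structure Horn (Atom Rule : Type) where
  a : Rule → Atom
  b : Rule → Atom
  c : Rule → Atom
  truth : Atom

namespace Horn

variable {Atom Rule : Type} (H : Horn Atom Rule)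

/-- The variables of the triple system: an auxiliary one, the atoms, three for every rule. -/
abbrev Var (Atom Rule : Type) : Type := Unit ⊕ Atom ⊕ (Rule × Fin 3)

abbrev aux : Var Atom Rule := .inl ()

abbrev atom (p : Atom) : Var Atom Rule := .inr (.inl p)

abbrev fresh (ρ : Rule) (i : Fin 3) : Var Atom Rule := .inr (.inr (ρ, i))

/-- The triple system that simulates the rules. -/
def sys : TripleSys (Var Atom Rule) (Rule × Fin 4) where
  P τ := ![atom (H.a τ.1), fresh τ.1 0, fresh τ.1 1, fresh τ.1 1] τ.2
  Q τ := ![aux, atom (H.b τ.1), aux, fresh τ.1 2] τ.2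
  R τ := ![fresh τ.1 0, fresh τ.1 1, fresh τ.1 2, atom (H.c τ.1)] τ.2
  hPQ := by rintro ⟨ρ, i⟩; fin_cases i <;> simp [atom, fresh, aux]
  hPR := by rintro ⟨ρ, i⟩; fin_cases i <;> simp [atom, fresh]
  hQR := by rintro ⟨ρ, i⟩; fin_cases i <;> simp [atom, fresh, aux]
  base x := x = aux ∨ x = atom H.truth

/-- The set of atoms contains `truth` and is closed under the rules. -/
structure Closed (K : Atom → Prop) : Prop where
  truth : K H.truth
  rule : ∀ ρ, K (H.a ρ) → K (H.b ρ) → K (H.c ρ)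

/-- The atoms that may become known if the vertex is individualized. -/
def Touch : TripleSys.Vert (Var Atom Rule) (Rule × Fin 4) → Atom → Prop
  | .inl (.inl _, _), _ => False
  | .inl (.inr (.inl p), _), q => q = p
  | .inl (.inr (.inr (ρ, _)), _), q => q = H.a ρ ∨ q = H.b ρ ∨ q = H.c ρ
  | .inr ((ρ, _), _), q => q = H.a ρ ∨ q = H.b ρ ∨ q = H.c ρ

/-- The variables that are known if exactly the atoms in `K` are. -/
def extend (K : Atom → Prop) : Var Atom Rule → Prop
  | .inl _ => True
  | .inr (.inl p) => K p
  | .inr (.inr (ρ, i)) => K (H.a ρ) ∧ (i ≠ 0 → K (H.b ρ))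

variable {H}

/-- The first fresh variable is equivalent to the first premise, the other two to both premises
together. Only the last triple mentions the conclusion, and there the rule itself gives the forward
direction while the two fresh variables have equal status. -/
theorem Closed.extend {K : Atom → Prop} (hK : H.Closed K) : H.sys.Closed (H.extend K) := by
  refine ⟨?_, ?_, ?_, ?_⟩
  · rintro x (rfl | rfl)
    · trivial
    · exact hK.truth
  all_goals
    rintro ⟨ρ, i⟩
    have := hK.rule ρ
    fin_cases i <;> simp [sys, Horn.extend, atom, fresh, aux] <;> tauto

/-- Individualizing anything inside the gadget of a rule is charged with knowledge of both premises
and the conclusion. -/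
theorem extend_of_touch {K : Atom → Prop} {u} (h : ∀ p, H.Touch u p → K p) (x)
    (hx : H.sys.Touch u x) : H.extend K x := by
  rcases u with ⟨y, i⟩ | ⟨⟨ρ, j⟩, d⟩
  · have hx' : x = y := hx
    subst hx'
    rcases x with _ | p | ⟨ρ, j⟩
    · trivial
    · exact h p rfl
    · exact ⟨h _ (Or.inl rfl), fun _ => h _ (Or.inr (Or.inl rfl))⟩
  · have h1 : K (H.a ρ) := h _ (Or.inl rfl)
    have h2 : K (H.b ρ) := h _ (Or.inr (Or.inl rfl))
    have h3 : K (H.c ρ) := h _ (Or.inr (Or.inr rfl))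
    rcases hx with hx | hx | hx <;> rw [hx] <;> fin_cases j <;>
      simp [sys, Horn.extend, atom, fresh, aux, h1, h2, h3]

variable {V : Type} [Fintype V] {G : SimpleGraph V} {c : V → ℕ} {S : Finset V}
  (e : TripleSys.Vert (Var Atom Rule) (Rule × Fin 4) ≃ V)

theorem Closed.one_le_colorValence (hadj : ∀ u v, G.Adj (e u) (e v) ↔ H.sys.Adj u v)
    (hcol : ∀ u v, H.sys.SameColor u v → c (e u) = c (e v)) {K : Atom → Prop} (hK : H.Closed K)
    (hS : ∀ u, e u ∈ S → ∀ p, H.Touch u p → K p) {ρ : Rule} (hp : ¬ K (H.c ρ)) :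
    1 ≤ colorValence G (stablePartition G (individualize c S)) :=
  hK.extend.one_le_colorValence e hadj hcol (fun u hu => extend_of_touch (hS u hu))
    -- The fourth triple of a rule has the conclusion as its third variable.
    (τ := (ρ, 3)) hp

theorem discrete_of_closed (hadj : ∀ u v, G.Adj (e u) (e v) ↔ H.sys.Adj u v)
    (hcol : ∀ u v, c (e u) = c (e v) → H.sys.SameColor u v)
    (hS : ∀ K : Atom → Prop, H.Closed K → (∀ p, e (.inl (atom p, false)) ∈ S → K p) → ∀ p, K p)
    (u v : V) (h : stablePartition G (individualize c S) u v) : u = v := by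
  refine TripleSys.discrete_of_closed e hadj hcol (fun K hK hKS => ?_) u v h
  have haux : K aux := hK.base _ (Or.inl rfl)
  have key : ∀ ρ, K (atom (H.a ρ)) → K (fresh ρ 0) ∧ (K (atom (H.b ρ)) → K (fresh ρ 1) ∧
      K (fresh ρ 2) ∧ K (atom (H.c ρ))) := by
    intro ρ ha
    have h0 : K (fresh ρ 0) := hK.hR (ρ, 0) ha haux
    refine ⟨h0, fun hb => ?_⟩
    have h1 : K (fresh ρ 1) := hK.hR (ρ, 1) h0 hb
    have h2 : K (fresh ρ 2) := hK.hR (ρ, 2) h1 haux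
    exact ⟨h1, h2, hK.hR (ρ, 3) h1 h2⟩
  have hall : ∀ p, K (atom p) := hS (fun p => K (atom p))
    ⟨hK.base _ (Or.inr rfl), fun ρ ha hb => ((key ρ ha).2 hb).2.2⟩ (fun p hp => hKS _ _ hp)
  rintro (_ | p | ⟨ρ, i⟩)
  · exact haux
  · exact hall p
  · fin_cases i
    · exact (key ρ (hall _)).1
    · exact ((key ρ (hall _)).2 (hall _)).1
    · exact ((key ρ (hall _)).2 (hall _)).2.1

end Horn

end FPT

namespace FPT

/-! ### The Horn system of a circuit -/

/-- The numbers that describe a circuit and a parameter: gate `x` of `G` gates has type `gk x` and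
reads the nodes `gi x` and `gj x`. -/
structure Data where
  k : ℕ
  n : ℕ
  o : ℕ
  G : ℕ
  gk : ℕ → ℕ
  gi : ℕ → ℕ
  gj : ℕ → ℕ

/-- A kind and three arguments. -/
abbrev RawAtom : Type := ℕ × ℕ × ℕ × ℕ

namespace RawAtom

/-- always true -/
abbrev truth : RawAtom := (0, 0, 0, 0)

/-- at least `j` of the inputs below `u` other than `v` are selected -/
abbrev count (v u j : ℕ) : RawAtom := (1, v, u, j)

/-- a private copy of the output for slot `i` and value `v` -/
abbrev copy (i v : ℕ) : RawAtom := (2, i, v, 0)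

/-- slot `i` selects input `v` -/
abbrev pick (i v : ℕ) : RawAtom := (3, i, v, 0)

/-- slot `i` is used -/
abbrev used (i : ℕ) : RawAtom := (4, i, 0, 0)

/-- node `m` has value `s` -/
abbrev lit (m s : ℕ) : RawAtom := (5, m, s, 0)

/-- the circuit is satisfied by a selection of the right weight -/
abbrev out : RawAtom := (6, 0, 0, 0)

end RawAtom

namespace Data

open RawAtom

variable (D : Data)

/-- The common value of the inputs of gate `x` at which both inputs are needed. -/
def pol (x : ℕ) : ℕ := if D.gk x = 1 then 0 else 1

/-- The value of gate `x` if both inputs have value `pol`. -/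
def res (x : ℕ) : ℕ := if D.gk x = 0 then 1 else 0

/-- The Horn rules: two premises and a conclusion. -/
def rule (κ x y z : ℕ) : RawAtom × RawAtom × RawAtom :=
  let skip := (truth, truth, truth)
  match κ with
  | 0 => (pick x y, pick x y, used x)
  | 1 => (used x, copy x y, pick x y)
  | 2 => if y < D.n then (pick x y, pick x y, lit y 1) else skip
  | 3 => (truth, truth, count x 0 0)
  | 4 => if y < D.n then (count x y z, count x y z, count x (y + 1) z) else skip
  | 5 => if y < D.n ∧ x ≠ y ∧ z < D.k then
      (count x y z, lit y 1, count x (y + 1) (z + 1)) else skip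
  | 6 => if x < D.n then (count x D.n D.k, count x D.n D.k, lit x 0) else skip
  | 7 => if x < D.G then
      (lit (D.gi x) (D.pol x), lit (D.gj x) (D.pol x), lit (D.n + x) (D.res x)) else skip
  | 8 => if x < D.G then
      (lit (D.gi x) (1 - D.pol x), lit (D.gi x) (1 - D.pol x), lit (D.n + x) (1 - D.res x)) else skip
  | 9 => if x < D.G then
      (lit (D.gj x) (1 - D.pol x), lit (D.gj x) (1 - D.pol x), lit (D.n + x) (1 - D.res x)) else skip
  | 10 => (count D.n D.n D.k, lit D.o 1, out)
  | 11 => (out, out, (0, x, y, z))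
  | 12 => (out, out, (1, x, y, z))
  | 13 => (out, out, (2, x, y, z))
  | 14 => if x < D.k ∧ z = 0 then skip else (out, out, (3, x, y, z))
  | 15 => if x < D.k ∧ y = 0 ∧ z = 0 then skip else (out, out, (4, x, y, z))
  | 16 => (out, out, (5, x, y, z))
  | _ => (out, out, (6, x, y, z))

/-- All numbers that occur are below `N`. -/
structure Valid (N : ℕ) : Prop where
  two : 2 ≤ N
  hk : D.k < N
  hn : D.n + D.G < N
  ho : D.o < D.n + D.G
  hi : ∀ x < D.G, D.gi x < D.n + x
  hj : ∀ x < D.G, D.gj x < D.n + x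

/-- `val` gives the correct values of the gates. -/
def Correct (val : ℕ → Bool) : Prop := ∀ x < D.G,
  (D.gk x = 0 ∧ val (D.n + x) = (val (D.gi x) && val (D.gj x))) ∨
  (D.gk x = 1 ∧ val (D.n + x) = (val (D.gi x) || val (D.gj x))) ∨
  (D.gk x = 2 ∧ D.gi x = D.gj x ∧ val (D.n + x) = !val (D.gi x))

/-- The set contains `truth` and is closed under all rules with arguments below `N`. -/
structure Closed (N : ℕ) (K : RawAtom → Prop) : Prop where
  truth : K truth
  rule : ∀ κ < 18, ∀ x < N, ∀ y < N, ∀ z < N, K (D.rule κ x y z).1 → K (D.rule κ x y z).2.1 →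
    K (D.rule κ x y z).2.2

/-- The arguments of the atom are below `N`. -/
def Bounded (N : ℕ) (r : RawAtom) : Prop := r.1 < 7 ∧ r.2.1 < N ∧ r.2.2.1 < N ∧ r.2.2.2 < N

variable {D} {N : ℕ}

theorem Valid.bounded (hD : D.Valid N) {κ x y z : ℕ} (hκ : κ < 18) (hx : x < N)
    (hy : y < N) (hz : z < N) : Bounded N (D.rule κ x y z).1 ∧ Bounded N (D.rule κ x y z).2.1 ∧
      Bounded N (D.rule κ x y z).2.2 := by
  obtain ⟨h2, hk, hn, ho, hi, hj⟩ := hD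
  have hi' := hi x
  have hj' := hj x
  have hp : D.pol x ≤ 1 := by unfold pol; split_ifs <;> omega
  have hr : D.res x ≤ 1 := by unfold res; split_ifs <;> omega
  interval_cases κ <;> simp only [rule, Bounded] <;> (try split_ifs) <;> (try simp only) <;>
    omega

/-- The atoms that only an individualization in slot `i` can make known. -/
def Block (i : ℕ) (r : RawAtom) : Prop := r = used i ∨ ∃ v, r = pick i v

/-- The atoms that a selection of `v` in slot `i` justifies. -/
def Justified (D : Data) (i v : ℕ) (r : RawAtom) : Prop :=
  r = used i ∨ r = pick i v ∨ r = copy i v ∨ (r = lit v 1 ∧ v < D.n)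

/-- The rules for `out` skip slots below `k`, and the two remaining rules that conclude an atom of
block `i` have a premise in the same block. So a slot can never be entered from outside. -/
theorem closed_compl_block {i : ℕ} (hi : i < D.k) : D.Closed N (fun r => ¬ Block i r) := by
  refine ⟨by simp [Block], fun κ hκ x _ y _ z _ h1 h2 h3 => ?_⟩
  interval_cases κ <;> simp only [rule, Block] at h1 h2 h3 <;> (try split_ifs at h1 h2 h3) <;>
    simp_all

/-- The only rules touching block `i` are those numbered `0`, `1` and `2`, and their atoms all
belong to the selection `y`. The private copies serve this purpose: with `out` itself as a premise
of rule `1`, individualizing inside its gadget would reveal `out`. -/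
theorem justified_of_block {κ x y z i : ℕ} (hκ : κ < 18) (hy : y < N) (hi : i < D.k)
    (h : Block i (D.rule κ x y z).1 ∨ Block i (D.rule κ x y z).2.1 ∨
      Block i (D.rule κ x y z).2.2) : ∃ v < N, D.Justified i v (D.rule κ x y z).1 ∧
      D.Justified i v (D.rule κ x y z).2.1 ∧ D.Justified i v (D.rule κ x y z).2.2 := by
  refine ⟨y, hy, ?_⟩
  interval_cases κ <;> simp only [rule, Block, Justified] at h ⊢ <;> (try split_ifs at h ⊢) <;>
    simp_all

theorem justified_block_eq {i j v : ℕ} {r : RawAtom} (h : D.Justified i v r) (hb : Block j r) :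
    i = j := by
  rcases hb with rfl | ⟨w, rfl⟩ <;> simp [Justified] at h
  · exact h.symm
  · exact h.1.symm

/-- The number of true nodes below `u` other than `x`. -/
def trueCount (val : ℕ → Bool) (x u : ℕ) : ℕ :=
  ((Finset.range u).filter (fun m => m ≠ x ∧ val m = true)).card

theorem trueCount_succ (val : ℕ → Bool) (x u : ℕ) :
    trueCount val x (u + 1) = trueCount val x u + if u ≠ x ∧ val u = true then 1 else 0 := by
  unfold trueCount
  rw [Finset.range_add_one, Finset.filter_insert]
  split_ifs with h
  · rw [Finset.card_insert_of_notMem (by simp)]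
  · rfl

/-- The number of true inputs. -/
def weight (n : ℕ) (val : ℕ → Bool) : ℕ := ((Finset.range n).filter (fun m => val m = true)).card

theorem trueCount_eq_weight (n : ℕ) (val : ℕ → Bool) {x : ℕ} (h : x < n → val x = false) :
    trueCount val x n = weight n val := by
  unfold trueCount weight
  congr 1
  refine Finset.filter_congr fun m hm => ?_
  rw [Finset.mem_range] at hm
  refine ⟨And.right, fun h' => ⟨?_, h'⟩⟩
  rintro rfl
  rw [h hm] at h'
  cases h'

theorem trueCount_lt_weight {n : ℕ} {val : ℕ → Bool} {x : ℕ} (hx : x < n) (h : val x = true) :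
    trueCount val x n < weight n val := by
  refine Finset.card_lt_card ?_
  rw [Finset.ssubset_iff_of_subset
    (fun m hm => by simp at hm ⊢; exact ⟨hm.1, hm.2.2⟩)]
  exact ⟨x, by simp [hx, h], by simp⟩

/-- The atoms that are true if slot `i` selects input `v i` and the circuit is not satisfied. -/
def Fact (D : Data) (v : ℕ → ℕ) (val : ℕ → Bool) : RawAtom → Prop
  | (0, _) => True
  | (1, x, y, z) => z ≤ trueCount val x y
  | (2, x, y, z) => x < D.k ∧ y = v x ∧ z = 0
  | (3, x, y, z) => x < D.k ∧ y = v x ∧ z = 0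
  | (4, x, y, z) => x < D.k ∧ y = 0 ∧ z = 0
  | (5, x, y, _) => x < D.n + D.G ∧ y = (val x).toNat
  | _ => False

/-- Every rule is sound for the actual values of the nodes, provided that at most `k` inputs are
selected. Only rule `10` could conclude `out`, and its premises would say that the circuit is
satisfied with weight `k`. -/
theorem closed_fact (hD : D.Valid N) {v : ℕ → ℕ} {val : ℕ → Bool} (hc : D.Correct val)
    (hval : ∀ m < D.n, val m = true ↔ ∃ i < D.k, v i = m)
    (hunsat : ¬ (weight D.n val = D.k ∧ val D.o = true)) : D.Closed N (D.Fact v val) := by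
  -- The true inputs are among the values of `k` slots; repeated or invalid selections only lower
  -- the weight.
  have hw : weight D.n val ≤ D.k := by
    have h1 : (Finset.range D.n).filter (fun m => val m = true) ⊆ (Finset.range D.k).image v := by
      intro m hm
      simp only [Finset.mem_filter, Finset.mem_range] at hm
      obtain ⟨i, hi, rfl⟩ := (hval m hm.1).1 hm.2
      exact Finset.mem_image_of_mem _ (Finset.mem_range.2 hi)
    calc _ ≤ _ := Finset.card_le_card h1
      _ ≤ _ := Finset.card_image_le
      _ = _ := Finset.card_range _
  refine ⟨trivial, fun κ hκ x _ y _ z _ h1 h2 => ?_⟩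
  have hi := hD.hi x
  have hj := hD.hj x
  have hcx := hc x
  interval_cases κ <;> simp only [rule] at h1 h2 ⊢ <;> (try split_ifs at h1 h2 ⊢ with h) <;>
    first
      | trivial
      | exact h1.elim
      | skip
  · exact ⟨h1.1, rfl, rfl⟩
  · exact ⟨by omega, by rw [(hval y h).2 ⟨x, h1.1, h1.2.1.symm⟩]; rfl⟩
  · exact Nat.zero_le _
  · have h1' : z ≤ trueCount val x y := h1
    show z ≤ trueCount val x (y + 1)
    rw [trueCount_succ]; omega
  · have h1' : z ≤ trueCount val x y := h1
    have hy : val y = true := by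
      have := h2.2
      cases hv : val y
      · rw [hv] at this; cases this
      · rfl
    show z + 1 ≤ trueCount val x (y + 1)
    rw [trueCount_succ, if_pos ⟨Ne.symm h.2.1, hy⟩]; omega
  -- A true input `x` would leave fewer than `k` other true inputs.
  · have h1' : D.k ≤ trueCount val x D.n := h1
    refine ⟨by omega, ?_⟩
    cases hv : val x
    · rfl
    · have := trueCount_lt_weight h hv
      omega
  · refine ⟨by omega, ?_⟩
    have e1 : D.pol x = (val (D.gi x)).toNat := h1.2
    have e2 : D.pol x = (val (D.gj x)).toNat := h2.2
    show D.res x = _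
    revert e1 e2
    unfold pol res
    rcases hcx h with ⟨hg, hv⟩ | ⟨hg, hv⟩ | ⟨hg, hij, hv⟩ <;> rw [hv, hg] <;>
      cases val (D.gi x) <;> cases val (D.gj x) <;> decide
  · refine ⟨by omega, ?_⟩
    have e1 : 1 - D.pol x = (val (D.gi x)).toNat := h1.2
    show 1 - D.res x = _
    revert e1
    unfold pol res
    rcases hcx h with ⟨hg, hv⟩ | ⟨hg, hv⟩ | ⟨hg, hij, hv⟩ <;> rw [hv, hg] <;>
      cases val (D.gi x) <;> cases val (D.gj x) <;> decide
  · refine ⟨by omega, ?_⟩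
    have e1 : 1 - D.pol x = (val (D.gj x)).toNat := h1.2
    show 1 - D.res x = _
    revert e1
    unfold pol res
    rcases hcx h with ⟨hg, hv⟩ | ⟨hg, hv⟩ | ⟨hg, hij, hv⟩ <;> rw [hv, hg] <;> (try rw [hij]) <;>
      cases val (D.gi x) <;> cases val (D.gj x) <;> decide
  -- The excluded node `D.n` is not an input, so this count is the full weight.
  · have h1' : D.k ≤ trueCount val D.n D.n := h1
    rw [trueCount_eq_weight _ _ (by omega)] at h1'
    refine (hunsat ⟨le_antisymm hw h1', ?_⟩).elim
    have := h2.2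
    cases hv : val D.o
    · rw [hv] at this; cases this
    · rfl

theorem fact_of_justified {v : ℕ → ℕ} {val : ℕ → Bool}
    (hval : ∀ m < D.n, val m = true ↔ ∃ i < D.k, v i = m) {i : ℕ} (hi : i < D.k) {r : RawAtom}
    (h : D.Justified i (v i) r) : D.Fact v val r := by
  rcases h with rfl | rfl | rfl | ⟨rfl, h⟩
  · exact ⟨hi, rfl, rfl⟩
  · exact ⟨hi, rfl, rfl⟩
  · exact ⟨hi, rfl, rfl⟩
  · exact ⟨by omega, by rw [(hval _ h).2 ⟨i, hi, rfl⟩]; rfl⟩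

/-- A satisfying selection makes all atoms derivable. -/
theorem Closed.all (hD : D.Valid N) {K : RawAtom → Prop} (hK : D.Closed N K) {v : ℕ → ℕ}
    {val : ℕ → Bool} (hc : D.Correct val) (hval : ∀ m < D.n, val m = true → ∃ i < D.k, v i = m)
    (hv : ∀ i < D.k, v i < D.n) (hpick : ∀ i < D.k, K (pick i (v i)))
    (hw : weight D.n val = D.k) (ho : val D.o = true) : ∀ r, Bounded N r → K r := by
  obtain ⟨h2, hkN, hnN, hoN, hi, hj⟩ := hD
  have R := hK.rule
  have hpos : ∀ m < D.n, val m = true → K (lit m 1) := by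
    intro m hm h
    obtain ⟨i, hi, rfl⟩ := hval m hm h
    have := R 2 (by omega) i (by omega) (v i) (by omega) 0 (by omega)
    simp only [Data.rule, if_pos hm] at this
    exact this (hpick i hi) (hpick i hi)
  have hcount : ∀ x < N, ∀ u ≤ D.n, ∀ j ≤ D.k, j ≤ trueCount val x u → K (count x u j) := by
    intro x hx u
    induction u with
    | zero =>
      intro _ j _ hj
      have hj0 : j = 0 := by simpa [trueCount] using hj
      subst hj0
      exact R 3 (by omega) x hx 0 (by omega) 0 (by omega) hK.truth hK.truth
    | succ u ih =>
      intro hu j hj hjc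
      rw [trueCount_succ] at hjc
      have hun : u < D.n := by omega
      by_cases hju : j ≤ trueCount val x u
      · have := R 4 (by omega) x hx u (by omega) j (by omega)
        simp only [Data.rule, if_pos hun] at this
        exact this (ih (by omega) j hj hju) (ih (by omega) j hj hju)
      · split_ifs at hjc with h
        -- The counter advances only because node `u` is true and different from `x`.
        · obtain ⟨j, rfl⟩ : ∃ i, j = i + 1 := ⟨j - 1, by omega⟩
          have := R 5 (by omega) x hx u (by omega) j (by omega)
          simp only [Data.rule, if_pos (⟨hun, h.1.symm, by omega⟩ : u < D.n ∧ x ≠ u ∧ j < D.k)] at this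
          exact this (ih (by omega) j (by omega) (by omega)) (hpos u hun h.2)
        · omega
  have hneg : ∀ m < D.n, val m = false → K (lit m 0) := by
    intro m hm h
    have := R 6 (by omega) m (by omega) 0 (by omega) 0 (by omega)
    simp only [Data.rule, if_pos hm] at this
    have hK' : K (count m D.n D.k) :=
      hcount m (by omega) D.n le_rfl D.k le_rfl (by rw [trueCount_eq_weight _ _ (fun _ => h), hw])
    exact this hK' hK'
  have hlit : ∀ m < D.n + D.G, K (lit m (val m).toNat) := by
    intro m
    induction m using Nat.strong_induction_on with
    | _ m ih =>
      intro hm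
      by_cases hmn : m < D.n
      · cases h : val m
        · exact hneg m hmn h
        · exact hpos m hmn h
      · obtain ⟨x, rfl⟩ : ∃ x, m = D.n + x := ⟨m - D.n, by omega⟩
        have hx : x < D.G := by omega
        have h7 := R 7 (by omega) x (by omega) 0 (by omega) 0 (by omega)
        have h8 := R 8 (by omega) x (by omega) 0 (by omega) 0 (by omega)
        have h9 := R 9 (by omega) x (by omega) 0 (by omega) 0 (by omega)
        have ki := ih _ (hi x hx) (by have := hi x hx; omega)
        have kj := ih _ (hj x hx) (by have := hj x hx; omega)
        simp only [Data.rule, if_pos hx] at h7 h8 h9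
        rcases hc x hx with ⟨hg, hv⟩ | ⟨hg, hv⟩ | ⟨hg, hij, hv⟩ <;> rw [hv] <;>
          simp only [pol, res, hg] at h7 h8 h9 <;>
          cases hvi : val (D.gi x) <;> cases hvj : val (D.gj x) <;> rw [hvi] at ki <;>
          rw [hvj] at kj <;> simp_all
  have hout : K out := by
    refine R 10 (by omega) 0 (by omega) 0 (by omega) 0 (by omega) ?_ ?_
    · exact hcount D.n (by omega) D.n le_rfl D.k le_rfl
        (by rw [trueCount_eq_weight _ _ (fun h => absurd h (lt_irrefl _)), hw])
    · have := hlit D.o hoN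
      rw [ho] at this
      exact this
  have hused : ∀ i < D.k, K (used i) := fun i hi =>
    R 0 (by omega) i (by omega) (v i) (by have := hv i hi; omega) 0 (by omega) (hpick i hi)
      (hpick i hi)
  have hcopy : ∀ x < N, ∀ y < N, ∀ z < N, K (2, x, y, z) := fun x hx y hy z hz =>
    R 13 (by omega) x hx y hy z hz hout hout
  rintro ⟨κ, x, y, z⟩ ⟨hκ, hx, hy, hz⟩
  simp only at hκ hx hy hz
  interval_cases κ
  · exact R 11 (by omega) x hx y hy z hz hout hout
  · exact R 12 (by omega) x hx y hy z hz hout hout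
  · exact hcopy x hx y hy z hz
  -- Picks in the slots below `k` are withheld from `out`; they come from the used slot and the
  -- copy.
  · by_cases h : x < D.k ∧ z = 0
    · obtain ⟨h, rfl⟩ := h
      exact R 1 (by omega) x hx y hy 0 hz (hused x h) (hcopy x hx y hy 0 hz)
    · have := R 14 (by omega) x hx y hy z hz
      simp only [Data.rule, if_neg h] at this
      exact this hout hout
  · by_cases h : x < D.k ∧ y = 0 ∧ z = 0
    · obtain ⟨h, rfl, rfl⟩ := h
      exact hused x h
    · have := R 15 (by omega) x hx y hy z hz
      simp only [Data.rule, if_neg h] at this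
      exact this hout hout
  · exact R 16 (by omega) x hx y hy z hz hout hout
  · exact R 17 (by omega) x hx y hy z hz hout hout

end Data
end FPT

namespace FPT

/-! ### The colored graph of a circuit -/

namespace Data

section Typed

variable {N : ℕ}

abbrev Cube (N : ℕ) : Type := Fin N × Fin N × Fin N

abbrev Atom (N : ℕ) : Type := Fin 7 × Cube N

abbrev Rule (N : ℕ) : Type := Fin 18 × Cube N

def raw (p : Atom N) : RawAtom := (p.1, p.2.1, p.2.2.1, p.2.2.2)

theorem bounded_raw (p : Atom N) : Bounded N (raw p) :=
  ⟨p.1.2, p.2.1.2, p.2.2.1.2, p.2.2.2.2⟩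

variable [NeZero N]

/-- The atom with the given kind and arguments, reduced modulo `N`. -/
def ofRaw (N : ℕ) [NeZero N] (r : RawAtom) : Atom N :=
  (Fin.ofNat 7 r.1, Fin.ofNat N r.2.1, Fin.ofNat N r.2.2.1, Fin.ofNat N r.2.2.2)

theorem ofRaw_raw (p : Atom N) : ofRaw N (raw p) = p := by
  obtain ⟨κ, x, y, z⟩ := p
  simp [ofRaw, raw]

theorem raw_ofRaw {r : RawAtom} (h : Bounded N r) : raw (ofRaw N r) = r := by
  obtain ⟨κ, x, y, z⟩ := r
  obtain ⟨h1, h2, h3, h4⟩ := h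
  simp only at h1 h2 h3 h4
  simp [ofRaw, raw, Nat.mod_eq_of_lt, h1, h2, h3, h4]

/-- The rules with arguments below `N`. -/
def horn (D : Data) (N : ℕ) [NeZero N] : Horn (Atom N) (Rule N) where
  a ρ := ofRaw N (D.rule ρ.1 ρ.2.1 ρ.2.2.1 ρ.2.2.2).1
  b ρ := ofRaw N (D.rule ρ.1 ρ.2.1 ρ.2.2.1 ρ.2.2.2).2.1
  c ρ := ofRaw N (D.rule ρ.1 ρ.2.1 ρ.2.2.1 ρ.2.2.2).2.2
  truth := ofRaw N RawAtom.truth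

theorem Closed.horn {D : Data} (hD : D.Valid N) {K : RawAtom → Prop} (hK : D.Closed N K) :
    (D.horn N).Closed (fun p => K (raw p)) := by
  have h2 := hD.two
  refine ⟨?_, fun ρ h1 h2 => ?_⟩
  · show K (raw (ofRaw N RawAtom.truth))
    rw [raw_ofRaw (by simp [Bounded]; omega)]
    exact hK.truth
  · obtain ⟨κ, x, y, z⟩ := ρ
    obtain ⟨b1, b2, b3⟩ := hD.bounded κ.2 x.2 y.2 z.2
    simp only [Data.horn, raw_ofRaw b1, raw_ofRaw b2, raw_ofRaw b3] at h1 h2 ⊢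
    exact hK.rule κ κ.2 x x.2 y y.2 z z.2 h1 h2

theorem closed_of_horn {D : Data} {K : Atom N → Prop} (hK : (D.horn N).Closed K) :
    D.Closed N (fun r => K (ofRaw N r)) :=
  ⟨hK.truth, fun κ hκ x hx y hy z hz =>
    hK.rule (⟨κ, hκ⟩, ⟨x, hx⟩, ⟨y, hy⟩, ⟨z, hz⟩)⟩

end Typed

/-! #### Numbering -/

abbrev Vert (N : ℕ) : Type := TripleSys.Vert (Horn.Var (Atom N) (Rule N)) (Rule N × Fin 4)

def cubeCard (N : ℕ) : ℕ := N * (N * N)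

def varCard (N : ℕ) : ℕ := 1 + (7 * cubeCard N + 18 * cubeCard N * 3)

def vertCard (N : ℕ) : ℕ := varCard N * 2 + 18 * cubeCard N * 4 * 4

def cubeEquiv (N : ℕ) : Cube N ≃ Fin (cubeCard N) :=
  ((Equiv.refl _).prodCongr finProdFinEquiv).trans finProdFinEquiv

def atomEquiv (N : ℕ) : Atom N ≃ Fin (7 * cubeCard N) :=
  ((Equiv.refl _).prodCongr (cubeEquiv N)).trans finProdFinEquiv

def ruleEquiv (N : ℕ) : Rule N ≃ Fin (18 * cubeCard N) :=
  ((Equiv.refl _).prodCongr (cubeEquiv N)).trans finProdFinEquiv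

def varEquiv (N : ℕ) : Horn.Var (Atom N) (Rule N) ≃ Fin (varCard N) :=
  (Equiv.sumCongr (Equiv.ofUnique Unit (Fin 1)) ((Equiv.sumCongr (atomEquiv N)
    (((ruleEquiv N).prodCongr (Equiv.refl _)).trans finProdFinEquiv)).trans
      finSumFinEquiv)).trans finSumFinEquiv

def vertEquiv (N : ℕ) : Vert N ≃ Fin (vertCard N) :=
  (Equiv.sumCongr (((varEquiv N).prodCongr finTwoEquiv.symm).trans finProdFinEquiv)
    (((((ruleEquiv N).prodCongr (Equiv.refl _)).trans finProdFinEquiv).prodCongr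
      ((finTwoEquiv.symm.prodCongr finTwoEquiv.symm).trans finProdFinEquiv)).trans
        finProdFinEquiv)).trans finSumFinEquiv

theorem finTwoEquiv_symm_val (a : Bool) : ((finTwoEquiv.symm a : Fin 2) : ℕ) = a.toNat := by
  cases a <;> rfl

theorem cubeEquiv_val {N : ℕ} (x y z : Fin N) :
    (cubeEquiv N (x, y, z) : ℕ) = z + N * y + N * N * x := rfl

theorem atomEquiv_val {N : ℕ} (κ : Fin 7) (q : Cube N) :
    (atomEquiv N (κ, q) : ℕ) = cubeEquiv N q + cubeCard N * κ := rfl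

theorem ruleEquiv_val {N : ℕ} (κ : Fin 18) (q : Cube N) :
    (ruleEquiv N (κ, q) : ℕ) = cubeEquiv N q + cubeCard N * κ := rfl

theorem varEquiv_aux {N : ℕ} : (varEquiv N Horn.aux : ℕ) = 0 := rfl

theorem varEquiv_atom {N : ℕ} (p : Atom N) :
    (varEquiv N (Horn.atom p) : ℕ) = 1 + atomEquiv N p := rfl

theorem varEquiv_fresh {N : ℕ} (ρ : Rule N) (i : Fin 3) :
    (varEquiv N (Horn.fresh ρ i) : ℕ) = 1 + (7 * cubeCard N + (i + 3 * ruleEquiv N ρ)) := rfl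

theorem vertEquiv_inl {N : ℕ} (x : Horn.Var (Atom N) (Rule N)) (i : Bool) :
    (vertEquiv N (.inl (x, i)) : ℕ) = i.toNat + 2 * varEquiv N x := by
  rw [← finTwoEquiv_symm_val]; rfl

theorem vertEquiv_inr {N : ℕ} (ρ : Rule N) (j : Fin 4) (a b : Bool) :
    (vertEquiv N (.inr ((ρ, j), a, b)) : ℕ) =
      varCard N * 2 + (b.toNat + 2 * a.toNat + 4 * (j + 4 * ruleEquiv N ρ)) := by
  rw [← finTwoEquiv_symm_val, ← finTwoEquiv_symm_val]; rfl

/-! #### The graph -/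

/-- The color of a vertex, in terms of its number. -/
def colorNum (N m : ℕ) : ℕ :=
  if m < 4 then m else if m < varCard N * 2 then 2 * (m / 2) else
    varCard N * 2 + 4 * ((m - varCard N * 2) / 4)

section Graph

variable (D : Data) (N : ℕ) [NeZero N]

def midEdges (ρ : Rule N) (j : Fin 4) (a b : Bool) :
    List (Fin (vertCard N) × Fin (vertCard N)) :=
  [(vertEquiv N (.inr ((ρ, j), a, b)), vertEquiv N (.inl ((D.horn N).sys.P (ρ, j), a))),
   (vertEquiv N (.inr ((ρ, j), a, b)), vertEquiv N (.inl ((D.horn N).sys.Q (ρ, j), b))),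
   (vertEquiv N (.inr ((ρ, j), a, b)), vertEquiv N (.inl ((D.horn N).sys.R (ρ, j), xor a b)))]

def ruleEdges (ρ : Rule N) : List (Fin (vertCard N) × Fin (vertCard N)) :=
  (List.finRange 4).flatMap fun j => [false, true].flatMap fun a => [false, true].flatMap fun b =>
    D.midEdges N ρ j a b

def edgeList : List (Fin (vertCard N) × Fin (vertCard N)) :=
  (List.finRange N).flatMap fun x => (List.finRange N).flatMap fun y =>
    (List.finRange N).flatMap fun z => (List.finRange 18).flatMap fun κ =>
      D.ruleEdges N (κ, x, y, z)

/-- The colored graph of the Horn system. -/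
abbrev graph : ColoredGraph where
  n := vertCard N
  color := fun v => colorNum N v
  edges := D.edgeList N

theorem mem_edgeList (u v : Vert N) :
    (vertEquiv N u, vertEquiv N v) ∈ D.edgeList N ↔
      ∃ τ a b x i, (D.horn N).sys.Inc τ a b x i ∧ u = .inr (τ, a, b) ∧ v = .inl (x, i) := by
  have h1 : (vertEquiv N u, vertEquiv N v) ∈ D.edgeList N ↔
      ∃ ρ j a b, (vertEquiv N u, vertEquiv N v) ∈ D.midEdges N ρ j a b := by
    simp only [edgeList, ruleEdges, List.mem_flatMap, List.mem_finRange, true_and, List.mem_cons,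
      List.not_mem_nil, or_false]
    constructor
    · rintro ⟨x, y, z, κ, j, a, -, b, -, h⟩
      exact ⟨_, j, a, b, h⟩
    · rintro ⟨⟨κ, x, y, z⟩, j, a, b, h⟩
      exact ⟨x, y, z, κ, j, a, by cases a <;> simp, b, by cases b <;> simp, h⟩
  rw [h1]
  simp only [midEdges, List.mem_cons, List.not_mem_nil, or_false, Prod.mk.injEq,
    EmbeddingLike.apply_eq_iff_eq]
  constructor
  · rintro ⟨ρ, j, a, b, ⟨rfl, rfl⟩ | ⟨rfl, rfl⟩ | ⟨rfl, rfl⟩⟩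
    · exact ⟨_, _, _, _, _, Or.inl ⟨rfl, rfl⟩, rfl, rfl⟩
    · exact ⟨_, _, _, _, _, Or.inr (Or.inl ⟨rfl, rfl⟩), rfl, rfl⟩
    · exact ⟨_, _, _, _, _, Or.inr (Or.inr ⟨rfl, rfl⟩), rfl, rfl⟩
  · rintro ⟨⟨ρ, j⟩, a, b, x, i, ⟨rfl, rfl⟩ | ⟨rfl, rfl⟩ | ⟨rfl, rfl⟩, rfl, rfl⟩
    · exact ⟨ρ, j, _, _, Or.inl ⟨rfl, rfl⟩⟩
    · exact ⟨ρ, j, _, _, Or.inr (Or.inl ⟨rfl, rfl⟩)⟩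
    · exact ⟨ρ, j, _, _, Or.inr (Or.inr ⟨rfl, rfl⟩)⟩

theorem graph_adj (u v : Vert N) :
    (D.graph N).graph.Adj (vertEquiv N u) (vertEquiv N v) ↔ (D.horn N).sys.Adj u v := by
  have h : (D.graph N).graph.Adj (vertEquiv N u) (vertEquiv N v) ↔
      vertEquiv N u ≠ vertEquiv N v ∧ ((vertEquiv N u, vertEquiv N v) ∈ D.edgeList N ∨
        (vertEquiv N v, vertEquiv N u) ∈ D.edgeList N) := SimpleGraph.fromRel_adj _ _ _
  rw [h, mem_edgeList, mem_edgeList]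
  rcases u with ⟨x, i⟩ | ⟨τ, a, b⟩ <;> rcases v with ⟨y, j⟩ | ⟨τ', a', b'⟩
  · simp [TripleSys.Adj]
  · simp only [TripleSys.Adj, ne_eq, EmbeddingLike.apply_eq_iff_eq, reduceCtorEq,
      not_false_eq_true, true_and, and_false, exists_false, false_or]
    constructor
    · rintro ⟨_, _, _, _, _, h, h1, h2⟩
      cases h1; cases h2; exact h
    · exact fun h => ⟨_, _, _, _, _, h, rfl, rfl⟩
  · simp only [TripleSys.Adj, ne_eq, EmbeddingLike.apply_eq_iff_eq, reduceCtorEq,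
      not_false_eq_true, true_and, and_false, exists_false, or_false]
    constructor
    · rintro ⟨_, _, _, _, _, h, h1, h2⟩
      cases h1; cases h2; exact h
    · exact fun h => ⟨_, _, _, _, _, h, rfl, rfl⟩
  · simp [TripleSys.Adj]

/-- The auxiliary variable has number `0` and `truth`, being the atom with all entries `0`, has
number `1`. Their four vertices are therefore numbered `0` to `3`, the range in which `colorNum` is
injective. -/
theorem base_iff (x : Horn.Var (Atom N) (Rule N)) :
    (D.horn N).sys.base x ↔ (varEquiv N x : ℕ) < 2 := by
  have h0 : (varEquiv N (Horn.aux : Horn.Var (Atom N) (Rule N)) : ℕ) = 0 := varEquiv_aux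
  have h1 : (varEquiv N (Horn.atom (ofRaw N RawAtom.truth)) : ℕ) = 1 := by
    rw [varEquiv_atom]
    show 1 + (atomEquiv N (_, _) : ℕ) = 1
    rw [atomEquiv_val, cubeEquiv_val]
    simp
  constructor
  · rintro (rfl | rfl)
    · omega
    · show (varEquiv N (Horn.atom (ofRaw N RawAtom.truth)) : ℕ) < 2
      omega
  · intro h
    rcases (by omega : (varEquiv N x : ℕ) = 0 ∨ (varEquiv N x : ℕ) = 1) with h2 | h2
    · exact Or.inl ((varEquiv N).injective (Fin.ext (h2.trans h0.symm)))
    · exact Or.inr ((varEquiv N).injective (Fin.ext (h2.trans h1.symm)))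

/-- Pairs and quadruples of middle vertices occupy consecutive numbers, and apart from the base the
color is the first number of the block. -/
theorem graph_color (u v : Vert N) :
    (D.graph N).color (vertEquiv N u) = (D.graph N).color (vertEquiv N v) ↔
      (D.horn N).sys.SameColor u v := by
  show colorNum N (vertEquiv N u) = colorNum N (vertEquiv N v) ↔ _
  have hV : 2 ≤ varCard N := by
    have : 0 < cubeCard N := by
      have := NeZero.pos N
      unfold cubeCard; positivity
    unfold varCard; omega
  rcases u with ⟨x, i⟩ | ⟨⟨ρ, l⟩, a, b⟩ <;> rcases v with ⟨y, j⟩ | ⟨⟨ρ', l'⟩, a', b'⟩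
  · have hx := (varEquiv N x).2
    have hy := (varEquiv N y).2
    have hi := Bool.toNat_lt i
    have hj := Bool.toNat_lt j
    rw [vertEquiv_inl, vertEquiv_inl]
    simp only [TripleSys.SameColor, base_iff]
    have hxy : x = y ↔ (varEquiv N x : ℕ) = varEquiv N y := by
      rw [← Fin.ext_iff, EmbeddingLike.apply_eq_iff_eq]
    have hij : i = j ↔ i.toNat = j.toNat := by cases i <;> cases j <;> simp
    rw [hxy, hij]
    unfold colorNum
    split_ifs <;> omega
  · have hx := (varEquiv N x).2
    have hi := Bool.toNat_lt i
    rw [vertEquiv_inl, vertEquiv_inr]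
    simp only [TripleSys.SameColor, iff_false]
    unfold colorNum
    split_ifs <;> omega
  · have hy := (varEquiv N y).2
    have hj := Bool.toNat_lt j
    rw [vertEquiv_inl, vertEquiv_inr]
    simp only [TripleSys.SameColor, iff_false]
    unfold colorNum
    split_ifs <;> omega
  · have ha := Bool.toNat_lt a
    have hb := Bool.toNat_lt b
    have ha' := Bool.toNat_lt a'
    have hb' := Bool.toNat_lt b'
    rw [vertEquiv_inr, vertEquiv_inr]
    simp only [TripleSys.SameColor, Prod.mk.injEq]
    have hρ : ρ = ρ' ↔ (ruleEquiv N ρ : ℕ) = ruleEquiv N ρ' := by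
      rw [← Fin.ext_iff, EmbeddingLike.apply_eq_iff_eq]
    rw [hρ, Fin.ext_iff]
    have := l.2
    have := l'.2
    unfold colorNum
    split_ifs <;> omega

end Graph

/-! #### Correctness -/

section Correctness

variable {D : Data} {N : ℕ} [NeZero N]

/-- One vertex is individualized for each slot, from the pair of the atom for its selected input;
different slots give different vertices. -/
theorem canReachDiscrete (hD : D.Valid N) {v : ℕ → ℕ} {val : ℕ → Bool} (hc : D.Correct val)
    (hval : ∀ m < D.n, val m = true → ∃ i < D.k, v i = m) (hv : ∀ i < D.k, v i < D.n)
    (hw : weight D.n val = D.k) (ho : val D.o = true) : (D.graph N).CanReachDiscrete D.k := by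
  classical
  have hkN := hD.hk
  have hnN := hD.hn
  have hb : ∀ i < D.k, Bounded N (RawAtom.pick i (v i)) := fun i hi => by
    have := hv i hi
    simp [Bounded]; omega
  let f : ℕ → Fin (vertCard N) := fun i =>
    vertEquiv N (.inl (Horn.atom (ofRaw N (RawAtom.pick i (v i))), false))
  have hf : Set.InjOn f (Finset.range D.k : Set ℕ) := by
    intro i hi j hj hij
    rw [Finset.coe_range, Set.mem_Iio] at hi hj
    have h1 := (vertEquiv N).injective hij
    simp only [Sum.inl.injEq, Prod.mk.injEq, Sum.inr.injEq, and_true] at h1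
    have h2 := congrArg raw h1
    rw [raw_ofRaw (hb i hi), raw_ofRaw (hb j hj)] at h2
    simpa using congrArg (fun r : RawAtom => r.2.1) h2
  refine ⟨(Finset.range D.k).image f, ?_, ?_⟩
  · rw [Finset.card_image_of_injOn hf, Finset.card_range]
  · refine Horn.discrete_of_closed (H := D.horn N) (vertEquiv N) (D.graph_adj N)
      (fun u v => (D.graph_color N u v).1) fun K hK hKS p => ?_
    rw [← ofRaw_raw p]
    refine (closed_of_horn hK).all hD hc hval hv (fun i hi => hKS _ ?_) hw ho (raw p)
      (bounded_raw p)
    exact Finset.mem_image_of_mem f (Finset.mem_range.2 hi)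

/-- If valence `0` can be reached, then there is a satisfying selection. -/
theorem exists_selection (hD : D.Valid N) (h : (D.graph N).CanReachValence D.k 0) :
    ∃ v : ℕ → ℕ, ∀ val : ℕ → Bool, D.Correct val →
      (∀ m < D.n, val m = true ↔ ∃ i < D.k, v i = m) → weight D.n val = D.k ∧ val D.o = true := by
  classical
  have h2 := hD.two
  have hkN := hD.hk
  obtain ⟨S, hS, hval⟩ := h
  -- Since the valence is `0`, a closed set that contains all touched atoms contains the conclusion
  -- of every rule.
  have key : ∀ K : RawAtom → Prop, D.Closed N K →
      (∀ u, vertEquiv N u ∈ S → ∀ p, (D.horn N).Touch u p → K (raw p)) →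
      ∀ κ < 18, ∀ x < N, ∀ y < N, ∀ z < N, K (D.rule κ x y z).2.2 := by
    intro K hK hKS κ hκ x hx y hy z hz
    by_contra hne
    have := (hK.horn hD).one_le_colorValence (vertEquiv N) (D.graph_adj N)
      (fun u v => (D.graph_color N u v).2) hKS (ρ := (⟨κ, hκ⟩, ⟨x, hx⟩, ⟨y, hy⟩, ⟨z, hz⟩))
      (by
        simp only [horn, raw_ofRaw (hD.bounded hκ hx hy hz).2.2]
        exact hne)
    have h0 : colorValence (D.graph N).graph ((D.graph N).stableAfter S) ≤ 0 := hval
    have h1 : 1 ≤ colorValence (D.graph N).graph ((D.graph N).stableAfter S) := this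
    omega
  have hit : ∀ i : Fin D.k, ∃ u, vertEquiv N u ∈ S ∧
      ∃ p, (D.horn N).Touch u p ∧ Block i (raw p) := by
    intro i
    by_contra! hne
    -- Rule `0` concludes `used i`, which lies in the block.
    refine key _ (closed_compl_block i.2) hne 0 (by omega) i (by omega) 0 (by omega) 0
      (by omega) (Or.inl rfl)
  have hjust : ∀ (i : Fin D.k) (u : Vert N), (∃ p, (D.horn N).Touch u p ∧ Block i (raw p)) →
      ∃ v, ∀ q, (D.horn N).Touch u q → D.Justified i v (raw q) := by
    rintro i (⟨_ | p | ⟨ρ, j⟩, s⟩ | ⟨⟨ρ, j⟩, d⟩) ⟨q, hq, hb⟩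
    · exact hq.elim
    · have : q = p := hq
      subst this
      rcases hb with hb | ⟨v, hb⟩
      -- Individualizing `used i` commits to no input: this atom is justified by any value.
      · refine ⟨0, fun q' hq' => ?_⟩
        have : q' = q := hq'
        subst this
        exact Or.inl hb
      · refine ⟨v, fun q' hq' => ?_⟩
        have : q' = q := hq'
        subst this
        exact Or.inr (Or.inl hb)
    all_goals
      obtain ⟨κ, x, y, z⟩ := ρ
      obtain ⟨b1, b2, b3⟩ := hD.bounded κ.2 x.2 y.2 z.2
      have hq' : q = (D.horn N).a (κ, x, y, z) ∨ q = (D.horn N).b (κ, x, y, z) ∨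
        q = (D.horn N).c (κ, x, y, z) := hq
      have hbl : Block i (D.rule κ x y z).1 ∨ Block i (D.rule κ x y z).2.1 ∨
          Block i (D.rule κ x y z).2.2 := by
        rcases hq' with rfl | rfl | rfl
        · left; simpa only [horn, raw_ofRaw b1] using hb
        · right; left; simpa only [horn, raw_ofRaw b2] using hb
        · right; right; simpa only [horn, raw_ofRaw b3] using hb
      obtain ⟨v, -, v1, v2, v3⟩ := justified_of_block κ.2 y.2 i.2 hbl
      refine ⟨v, ?_⟩
      rintro q'' (rfl | rfl | rfl)
      · simpa only [horn, raw_ofRaw b1] using v1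
      · simpa only [horn, raw_ofRaw b2] using v2
      · simpa only [horn, raw_ofRaw b3] using v3
  choose u huS hu using hit
  choose v hv using fun i => hjust i (u i) (hu i)
  have hinj : Function.Injective (fun i => vertEquiv N (u i)) := by
    intro i j hij
    have hij' : u i = u j := (vertEquiv N).injective hij
    obtain ⟨p, hp, hb⟩ := hu j
    exact Fin.ext (justified_block_eq (hv i p (hij' ▸ hp)) hb)
  -- The vertices hitting the `k` blocks are distinct, so they exhaust `S` and no vertex is left for
  -- other purposes.
  have himg : Finset.univ.image (fun i => vertEquiv N (u i)) = S := by
    refine Finset.eq_of_subset_of_card_le (fun w hw => ?_) ?_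
    · obtain ⟨i, -, rfl⟩ := Finset.mem_image.1 hw
      exact huS i
    · rw [Finset.card_image_of_injective _ hinj]
      rw [Finset.card_univ, Fintype.card_fin]
      exact hS.le
  let v' : ℕ → ℕ := fun i => if h : i < D.k then v ⟨i, h⟩ else 0
  have hv' : ∀ i : Fin D.k, v' i = v i := fun i => by simp [v']
  refine ⟨v', fun val hc hval' => ?_⟩
  by_contra hunsat
  -- Rule `17` with zero arguments concludes `out`, which is never a fact.
  refine key _ (closed_fact hD hc hval' hunsat) ?_ 17 (by omega) 0 (by omega) 0 (by omega) 0
    (by omega)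
  intro w hw p hp
  rw [← himg] at hw
  obtain ⟨i, -, hi⟩ := Finset.mem_image.1 hw
  have : u i = w := (vertEquiv N).injective hi
  subst this
  refine fact_of_justified hval' i.2 ?_
  rw [hv']
  exact hv i p hp

end Correctness

end Data

end FPT

namespace FPT

/-! ### Circuits -/

/-- Appending does not alter earlier entries, and a gate reads only earlier entries, so it may be
evaluated on the final list instead of its prefix. -/
theorem foldl_values (gs : List Gate) : ∀ vals : List Bool,
    (∀ (t : ℕ) (h : t < gs.length), gs[t].ReadsBelow (vals.length + t)) →
    let W := gs.foldl (fun vals g => vals ++ [g.eval vals]) vals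
    (∀ m < vals.length, W.getD m false = vals.getD m false) ∧
    ∀ (t : ℕ) (h : t < gs.length), W.getD (vals.length + t) false = gs[t].eval W := by
  induction gs with
  | nil => intro vals _; simp
  | cons g gs ih =>
    intro vals hr
    obtain ⟨h1, h2⟩ := ih (vals ++ [g.eval vals]) (fun t ht => by
      have := hr (t + 1) (by simpa using ht)
      simpa [add_assoc, add_comm 1 t] using this)
    have h3 : ∀ m < vals.length, (gs.foldl (fun vals g => vals ++ [g.eval vals])
        (vals ++ [g.eval vals])).getD m false = vals.getD m false := by
      intro m hm
      rw [h1 m (by simp; omega), List.getD_append _ _ _ _ hm]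
    refine ⟨h3, fun t ht => ?_⟩
    rw [List.foldl_cons]
    cases t with
    | zero =>
      have h4 := h1 vals.length (by simp)
      rw [List.getD_append_right _ _ _ _ le_rfl] at h4
      have h5 := hr 0 (by simp)
      simp only [List.getElem_cons_zero, Nat.add_zero] at h5 ⊢
      rw [h4, Nat.sub_self, List.getD_cons_zero]
      generalize gs.foldl _ _ = W at h3 ⊢
      cases g
      · simp only [Gate.eval, h3 _ h5.1, h3 _ h5.2]
      · simp only [Gate.eval, h3 _ h5.1, h3 _ h5.2]
      · simp only [Gate.eval, h3 _ h5]
    | succ t =>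
      have h4 := h2 t (by simpa using ht)
      simp only [List.length_append, List.length_singleton] at h4
      rw [show vals.length + (t + 1) = vals.length + 1 + t by ring, h4]
      simp

theorem Circuit.values_input (C : Circuit) (x : Fin C.inputs → Bool) (m : Fin C.inputs) :
    (C.values x).getD m false = x m := by
  have h := (foldl_values C.gates (List.ofFn x) (by simpa using C.acyclic)).1 m (by simp)
  rw [Circuit.values, h]
  simp

theorem Circuit.values_gate (C : Circuit) (x : Fin C.inputs → Bool) (t : ℕ)
    (h : t < C.gates.length) :
    (C.values x).getD (C.inputs + t) false = C.gates[t].eval (C.values x) := by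
  have h1 := (foldl_values C.gates (List.ofFn x) (by simpa using C.acyclic)).2 t h
  rwa [List.length_ofFn] at h1

theorem getD_flatMap_code (gs : List Gate) : ∀ (t : ℕ) (h : t < gs.length) (r : ℕ), r < 3 →
    (gs.flatMap Gate.code).getD (3 * t + r) 0 = (gs[t].code).getD r 0 := by
  induction gs with
  | nil => intro t h; simp at h
  | cons g gs ih =>
    intro t h r hr
    have hl : g.code.length = 3 := by cases g <;> rfl
    rw [List.flatMap_cons]
    cases t with
    | zero => rw [List.getD_append _ _ _ _ (by omega)]; simp
    | succ t =>
      rw [List.getD_append_right _ _ _ _ (by omega), hl,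
        show 3 * (t + 1) + r - 3 = 3 * t + r by omega, ih t (by simpa using h) r hr]
      simp

theorem length_flatMap_code (gs : List Gate) : (gs.flatMap Gate.code).length = 3 * gs.length := by
  induction gs with
  | nil => rfl
  | cons g gs ih =>
    have hl : g.code.length = 3 := by cases g <;> rfl
    rw [List.flatMap_cons, List.length_append, hl, ih, List.length_cons]
    ring

/-- The numbers listed in the word of an instance. -/
def Circuit.numbers (C : Circuit) (k : ℕ) : List ℕ :=
  k :: C.inputs :: C.output :: C.gates.flatMap Gate.code

theorem Circuit.word_eq (C : Circuit) (k : ℕ) :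
    weightedCircuitSat.word C k = encNats (C.numbers k) := by
  simp [ParamProblem.word, weightedCircuitSat, Circuit.encode, encNats, Circuit.numbers]

/-- The data of a circuit, read from the list of numbers. -/
def Circuit.data (C : Circuit) (k : ℕ) : Data where
  k := k
  n := C.inputs
  o := C.output
  G := C.gates.length
  gk x := (C.numbers k).getD (3 * x + 3) 0
  gi x := (C.numbers k).getD (3 * x + 4) 0
  gj x := (C.numbers k).getD (3 * x + 5) 0

/-- A bound for all arguments of atoms. -/
def Circuit.size (C : Circuit) (k : ℕ) : ℕ := (weightedCircuitSat.word C k).length + 3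

instance (C : Circuit) (k : ℕ) : NeZero (C.size k) := ⟨by unfold Circuit.size; omega⟩

theorem Circuit.data_gate (C : Circuit) (k : ℕ) {x : ℕ} (h : x < C.gates.length) :
    (C.data k).gk x = C.gates[x].code.getD 0 0 ∧ (C.data k).gi x = C.gates[x].code.getD 1 0 ∧
      (C.data k).gj x = C.gates[x].code.getD 2 0 := by
  refine ⟨?_, ?_, ?_⟩
  · exact getD_flatMap_code _ x h 0 (by omega)
  · exact getD_flatMap_code _ x h 1 (by omega)
  · exact getD_flatMap_code _ x h 2 (by omega)

theorem length_encNats (l : List ℕ) : (encNats l).length = l.sum + l.length := by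
  induction l with
  | nil => rfl
  | cons m l ih =>
    have : encNats (m :: l) = encNat m ++ encNats l := rfl
    rw [this, List.length_append, ih]
    simp [encNat]
    ring

/-- Unary encoding makes the word at least as long as the sum of its numbers plus their count, and
every gate contributes three numbers. -/
theorem Circuit.data_valid (C : Circuit) (k : ℕ) : (C.data k).Valid (C.size k) := by
  have h := length_encNats (C.numbers k)
  rw [← C.word_eq] at h
  simp only [Circuit.numbers, List.sum_cons, List.length_cons, length_flatMap_code] at h
  refine ⟨?_, ?_, ?_, C.output_lt, fun x hx => ?_, fun x hx => ?_⟩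
  · unfold Circuit.size; omega
  · simp only [Circuit.size, Circuit.data]; omega
  · simp only [Circuit.size, Circuit.data]; omega
  · have h1 := C.acyclic x hx
    rw [(C.data_gate k hx).2.1]
    cases hg : C.gates[x] <;> rw [hg] at h1
    · exact h1.1
    · exact h1.1
    · exact h1
  · have h1 := C.acyclic x hx
    rw [(C.data_gate k hx).2.2]
    cases hg : C.gates[x] <;> rw [hg] at h1
    · exact h1.2
    · exact h1.2
    · exact h1

theorem Circuit.data_correct (C : Circuit) (k : ℕ) (x : Fin C.inputs → Bool) :
    (C.data k).Correct (fun m => (C.values x).getD m false) := by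
  intro t ht
  have h1 := C.values_gate x t ht
  obtain ⟨h2, h3, h4⟩ := C.data_gate k ht
  rw [h2, h3, h4]
  show (_ ∧ (C.values x).getD (C.inputs + t) false = _) ∨
    (_ ∧ (C.values x).getD (C.inputs + t) false = _) ∨
    (_ ∧ _ ∧ (C.values x).getD (C.inputs + t) false = _)
  rw [h1]
  cases C.gates[t] <;> simp [Gate.eval, Gate.code]

theorem Circuit.data_weight (C : Circuit) (x : Fin C.inputs → Bool) :
    Data.weight C.inputs (fun m => (C.values x).getD m false) =
      (Finset.univ.filter (fun i => x i = true)).card := by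
  have : (Finset.range C.inputs).filter (fun m => (C.values x).getD m false = true) =
      (Finset.univ.filter (fun i => x i = true)).map Fin.valEmbedding := by
    ext m
    simp only [Finset.mem_filter, Finset.mem_range, Finset.mem_map, Finset.mem_univ, true_and,
      Fin.valEmbedding_apply]
    constructor
    · rintro ⟨hm, h⟩
      exact ⟨⟨m, hm⟩, by rw [← C.values_input x ⟨m, hm⟩]; exact h, rfl⟩
    · rintro ⟨i, hi, rfl⟩
      exact ⟨i.2, by rw [C.values_input, hi]⟩
  rw [Data.weight, this, Finset.card_map]

/-- The colored graph to which a circuit with a parameter is reduced. -/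
def Circuit.toGraph (C : Circuit) (k : ℕ) : ColoredGraph := (C.data k).graph (C.size k)

theorem Circuit.canReachDiscrete (C : Circuit) (k : ℕ) (h : weightedCircuitSat.yes C k) :
    (C.toGraph k).CanReachDiscrete k := by
  obtain ⟨x, hx, hC⟩ := h
  let f := Finset.orderEmbOfFin _ hx
  -- Slot `i` selects the `i`-th true input in increasing order; the default `0` is never consulted
  -- below `k`.
  refine Data.canReachDiscrete (C.data_valid k) (C.data_correct k x)
    (v := fun i => if hi : i < k then (f ⟨i, hi⟩ : ℕ) else 0) ?_ ?_
    ((C.data_weight x).trans hx) hC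
  · intro m hm h
    have hm' : (⟨m, hm⟩ : Fin C.inputs) ∈ Set.range f := by
      rw [Finset.range_orderEmbOfFin]
      have := C.values_input x ⟨m, hm⟩
      simpa [← this] using h
    obtain ⟨i, hi⟩ := hm'
    exact ⟨i, i.2, by simp [hi]⟩
  · intro i hi
    have hi' : i < k := hi
    show (if hi : i < k then (f ⟨i, hi⟩ : ℕ) else 0) < C.inputs
    rw [dif_pos hi']
    exact (f _).2

theorem Circuit.yes_of_canReachValence (C : Circuit) (k : ℕ)
    (h : (C.toGraph k).CanReachValence k 0) : weightedCircuitSat.yes C k := by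
  classical
  obtain ⟨v, hv⟩ := Data.exists_selection (C.data_valid k) h
  let x : Fin C.inputs → Bool := fun m => decide (∃ i < k, v i = m)
  obtain ⟨h1, h2⟩ := hv _ (C.data_correct k x) (fun m hm => by
    have := C.values_input x ⟨m, hm⟩
    simp only at this
    rw [this]
    simp [x, Circuit.data])
  exact ⟨x, (C.data_weight x).symm.trans h1, h2⟩

theorem ColoredGraph.CanReachDiscrete.canReachValence {X : ColoredGraph} {k : ℕ}
    (h : X.CanReachDiscrete k) : X.CanReachValence k 0 := by
  obtain ⟨S, hS, h⟩ := h
  exact ⟨S, hS, (colorValence_eq_zero_of_discrete h).le⟩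

theorem Circuit.yes_iff (C : Circuit) (k : ℕ) :
    (weightedCircuitSat.yes C k ↔ (C.toGraph k).CanReachDiscrete k) ∧
      (weightedCircuitSat.yes C k ↔ (C.toGraph k).CanReachValence k 0) :=
  ⟨⟨C.canReachDiscrete k, fun h => C.yes_of_canReachValence k h.canReachValence⟩,
    ⟨fun h => (C.canReachDiscrete k h).canReachValence, C.yes_of_canReachValence k⟩⟩

end FPT

namespace FPT

/-! ### A program that prints the graph -/

/-- The printed form of a list of numbers. -/
def bits (l : List ℕ) : List ℕ := (encNats l).map Bool.toNat

theorem bits_append (l l' : List ℕ) : bits (l ++ l') = bits l ++ bits l' := by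
  simp [bits, encNats]

theorem bits_cons (m : ℕ) (l : List ℕ) : bits (m :: l) = List.replicate m 1 ++ 0 :: bits l := by
  simp [bits, encNats, encNat]

theorem bits_nil : bits [] = [] := rfl

theorem bits_flatMap {α : Type} (l : List α) (f : α → List ℕ) :
    bits (l.flatMap f) = l.flatMap fun i => bits (f i) := by
  simp [bits, encNats, List.flatMap_assoc, List.map_flatMap]

namespace Ex

instance : Add Ex := ⟨Ex.add⟩
instance : Sub Ex := ⟨Ex.sub⟩
instance : Mul Ex := ⟨Ex.mul⟩

variable (w : List ℕ) (ρ : ℕ → ℕ)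

@[simp] theorem eval_const (n : ℕ) : (const n).eval w ρ = n := rfl
@[simp] theorem eval_var (r : ℕ) : (var r).eval w ρ = ρ r := rfl
@[simp] theorem eval_add (a b : Ex) : (a + b).eval w ρ = a.eval w ρ + b.eval w ρ := rfl
@[simp] theorem eval_sub (a b : Ex) : (a - b).eval w ρ = a.eval w ρ - b.eval w ρ := rfl
@[simp] theorem eval_mul (a b : Ex) : (a * b).eval w ρ = a.eval w ρ * b.eval w ρ := rfl
@[simp] theorem eval_ite (c a b : Ex) : (ite c a b).eval w ρ =
    if c.eval w ρ ≠ 0 then a.eval w ρ else b.eval w ρ := rfl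

/-- The value is `1` if both expressions have the same value, otherwise `0`. -/
def eq (a b : Ex) : Ex := (const 1 - (a - b)) - (b - a)

@[simp] theorem eval_eq (a b : Ex) : (a.eq b).eval w ρ =
    if a.eval w ρ = b.eval w ρ then 1 else 0 := by
  simp only [eq, eval_sub, eval_const]
  split_ifs <;> omega

/-- The number of end markers before the position in variable `5`. -/
def markers : Ex := sum 6 (var 5) (const 1 - read (var 6))

/-- The number at position `j` of the list that is encoded by the input word. The expression `j`
must not mention variable `5`. -/
def num (j : Ex) : Ex := sum 5 len (read (var 5) * markers.eq j)

/-- The length of the list that is encoded by the input word. -/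
def count : Ex := sum 6 len (const 1 - read (var 6))

end Ex

theorem sum_markers_bits (l : List ℕ) :
    ∑ i ∈ Finset.range (bits l).length, (1 - (bits l).getD i 0) = l.length := by
  induction l with
  | nil => rfl
  | cons m l ih =>
    rw [bits_cons, List.length_append, List.length_cons, List.length_replicate,
      Finset.sum_range_add, Finset.sum_range_succ', List.length_cons, ← ih]
    have h1 : ∀ i ∈ Finset.range m,
        1 - (List.replicate m 1 ++ 0 :: bits l).getD i 0 = 0 := by
      intro i hi
      rw [Finset.mem_range] at hi
      rw [List.getD_append _ _ _ _ (by simpa using hi)]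
      simp [hi]
    rw [Finset.sum_eq_zero h1, zero_add]
    have h2 : ∀ i, (List.replicate m 1 ++ 0 :: bits l).getD (m + i) 0 = (0 :: bits l).getD i 0 := by
      intro i
      rw [List.getD_append_right _ _ _ _ (by simp)]
      simp
    simp only [h2, List.getD_cons_succ, List.getD_cons_zero]

/-- The entry at `j` is the number of ones preceded by exactly `j` markers. The induction strips the
first unary block, whose marker shifts all later counts by one. -/
theorem sum_num_bits (l : List ℕ) : ∀ j, ∑ p ∈ Finset.range (bits l).length,
    (bits l).getD p 0 * (if ∑ i ∈ Finset.range p, (1 - (bits l).getD i 0) = j then 1 else 0) =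
      l.getD j 0 := by
  induction l with
  | nil => intro j; simp [bits_nil]
  | cons m l ih =>
    intro j
    have h1 : ∀ i < m, (List.replicate m 1 ++ 0 :: bits l).getD i 0 = 1 := by
      intro i hi
      rw [List.getD_append _ _ _ _ (by simpa using hi)]
      simp [hi]
    have h2 : ∀ i, (List.replicate m 1 ++ 0 :: bits l).getD (m + i) 0 = (0 :: bits l).getD i 0 := by
      intro i
      rw [List.getD_append_right _ _ _ _ (by simp)]
      simp
    rw [bits_cons, List.length_append, List.length_cons, List.length_replicate,
      Finset.sum_range_add, Finset.sum_range_succ']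
    generalize List.replicate m 1 ++ 0 :: bits l = W at h1 h2
    have h3 : ∀ p ≤ m, ∑ i ∈ Finset.range p, (1 - W.getD i 0) = 0 := fun p hp =>
      Finset.sum_eq_zero fun i hi => by
        rw [Finset.mem_range] at hi
        rw [h1 i (by omega), Nat.sub_self]
    have h4 : ∀ q, ∑ i ∈ Finset.range (m + (q + 1)), (1 - W.getD i 0) =
        ∑ i ∈ Finset.range q, (1 - (bits l).getD i 0) + 1 := by
      intro q
      rw [Finset.sum_range_add, h3 m le_rfl, zero_add, Finset.sum_range_succ']
      simp only [h2, List.getD_cons_succ, List.getD_cons_zero]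
    have h5 : ∑ p ∈ Finset.range m, W.getD p 0 *
        (if ∑ i ∈ Finset.range p, (1 - W.getD i 0) = j then 1 else 0) = if j = 0 then m else 0 := by
      rw [Finset.sum_congr rfl (g := fun _ => if j = 0 then 1 else 0) (fun p hp => ?_)]
      · simp
      · rw [Finset.mem_range] at hp
        rw [h1 p hp, h3 p hp.le]
        simp [eq_comm]
    have h6 : W.getD m 0 = 0 := by
      have := h2 0
      rwa [add_zero, List.getD_cons_zero] at this
    rw [h5]
    simp only [h4, h2, List.getD_cons_succ, h6, zero_mul, add_zero]
    cases j with
    | zero => simp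
    | succ j => simpa using ih j

theorem Ex.eval_num (l : List ℕ) (ρ : ℕ → ℕ) (j : Ex) (v : ℕ)
    (hj : ∀ p, j.eval (bits l) (Function.update ρ 5 p) = v) :
    (Ex.num j).eval (bits l) ρ = l.getD v 0 := by
  rw [← sum_num_bits l v]
  refine Finset.sum_congr rfl fun p _ => ?_
  rw [eval_mul, eval_eq, hj]
  have h1 : (read (var 5)).eval (bits l) (Function.update ρ 5 p) = (bits l).getD p 0 := by
    simp [eval]
  have h2 : markers.eval (bits l) (Function.update ρ 5 p) =
      ∑ i ∈ Finset.range p, (1 - (bits l).getD i 0) := by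
    simp [markers, eval, eval_sub]
  rw [h1, h2]

theorem Ex.eval_count (l : List ℕ) (ρ : ℕ → ℕ) : Ex.count.eval (bits l) ρ = l.length := by
  rw [← sum_markers_bits l]
  simp [count, eval, eval_sub]

namespace St

/-- One statement after the other. -/
def seqs (l : List St) : St := l.foldr seq skip

theorem out_seqs (w : List ℕ) (l : List St) (ρ : ℕ → ℕ) :
    (seqs l).out w ρ = l.flatMap fun p => p.out w ρ := by
  induction l with
  | nil => rfl
  | cons p l ih => rw [List.flatMap_cons, ← ih]; rfl

/-- Print a number in unary. -/
def put (e : Ex) : St := .seq (.loop 7 e (.emit (.const 1))) (.emit (.const 0))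

theorem out_put (w : List ℕ) (e : Ex) (ρ : ℕ → ℕ) : (put e).out w ρ = bits [e.eval w ρ] := by
  rw [bits_cons, bits_nil]
  simp only [put, out, Ex.eval_const]
  congr 1
  generalize e.eval w ρ = n
  induction n with
  | zero => rfl
  | succ n ih => rw [List.range_succ, List.flatMap_append, ih, List.replicate_succ']; rfl

/-- Print a list of numbers. -/
def puts (l : List Ex) : St := seqs (l.map put)

theorem out_puts (w : List ℕ) (l : List Ex) (ρ : ℕ → ℕ) :
    (puts l).out w ρ = bits (l.map fun e => e.eval w ρ) := by
  rw [puts, out_seqs]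
  induction l with
  | nil => rfl
  | cons e l ih =>
    rw [List.map_cons, List.flatMap_cons, ih, List.map_cons, out_put, ← bits_append]
    rfl

end St

namespace Data

open Ex RawAtom

/-- The number of the variable of an atom. -/
def varNum (N : ℕ) (r : RawAtom) : ℕ :=
  1 + (r.2.2.2 + N * r.2.2.1 + N * N * r.2.1 + cubeCard N * r.1)

theorem varEquiv_ofRaw {N : ℕ} [NeZero N] {r : RawAtom} (h : Bounded N r) :
    (varEquiv N (Horn.atom (ofRaw N r)) : ℕ) = varNum N r := by
  rw [varEquiv_atom]
  show 1 + (atomEquiv N (_, _, _, _) : ℕ) = _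
  rw [atomEquiv_val, cubeEquiv_val]
  obtain ⟨h1, h2, h3, h4⟩ := h
  simp [varNum, Nat.mod_eq_of_lt, h1, h2, h3, h4]

def sizeEx : Ex := len + const 3

def cubeEx : Ex := sizeEx * (sizeEx * sizeEx)

def atomEx (κ : ℕ) (x y z : Ex) : Ex :=
  const 1 + (z + sizeEx * y + sizeEx * sizeEx * x + cubeEx * const κ)

def kEx : Ex := num (const 0)
def nEx : Ex := num (const 1)
def oEx : Ex := num (const 2)

/-- The entry `r` of the code of the gate whose number is in variable `0`. -/
def gateEx (r : ℕ) : Ex := num (const 3 * var 0 + const (r + 3))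

def polEx : Ex := .ite ((gateEx 0).eq (const 1)) (const 0) (const 1)
def resEx : Ex := .ite ((gateEx 0).eq (const 0)) (const 1) (const 0)

/-- The fallback `1` is the number of the variable `truth`, so a failed guard yields the trivial
rule. -/
def guard (c : Ex) (t : Ex × Ex × Ex) : Ex × Ex × Ex :=
  (.ite c t.1 (const 1), .ite c t.2.1 (const 1), .ite c t.2.2 (const 1))

/-- The variables of a rule whose arguments are in variables `0`, `1` and `2`. -/
def ruleEx (κ : ℕ) : Ex × Ex × Ex :=
  let x := var 0
  let y := var 1
  let z := var 2
  let o := const 0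
  let i := const 1
  let isGate := Ex.count - (const 3 * x + const 5)
  let outEx := atomEx 6 o o o
  match κ with
  | 0 => (atomEx 3 x y o, atomEx 3 x y o, atomEx 4 x o o)
  | 1 => (atomEx 4 x o o, atomEx 2 x y o, atomEx 3 x y o)
  | 2 => guard (nEx - y) (atomEx 3 x y o, atomEx 3 x y o, atomEx 5 y i o)
  | 3 => (const 1, const 1, atomEx 1 x o o)
  | 4 => guard (nEx - y) (atomEx 1 x y z, atomEx 1 x y z, atomEx 1 x (y + i) z)
  | 5 => guard ((nEx - y) * (((x - y) + (y - x)) * (kEx - z)))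
      (atomEx 1 x y z, atomEx 5 y i o, atomEx 1 x (y + i) (z + i))
  | 6 => guard (nEx - x) (atomEx 1 x nEx kEx, atomEx 1 x nEx kEx, atomEx 5 x o o)
  | 7 => guard isGate
      (atomEx 5 (gateEx 1) polEx o, atomEx 5 (gateEx 2) polEx o, atomEx 5 (nEx + x) resEx o)
  | 8 => guard isGate (atomEx 5 (gateEx 1) (i - polEx) o, atomEx 5 (gateEx 1) (i - polEx) o,
      atomEx 5 (nEx + x) (i - resEx) o)
  | 9 => guard isGate (atomEx 5 (gateEx 2) (i - polEx) o, atomEx 5 (gateEx 2) (i - polEx) o,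
      atomEx 5 (nEx + x) (i - resEx) o)
  | 10 => (atomEx 1 nEx nEx kEx, atomEx 5 oEx i o, outEx)
  | 11 => (outEx, outEx, atomEx 0 x y z)
  | 12 => (outEx, outEx, atomEx 1 x y z)
  | 13 => (outEx, outEx, atomEx 2 x y z)
  | 14 => guard (i - (kEx - x) * (i - z)) (outEx, outEx, atomEx 3 x y z)
  | 15 => guard (i - (kEx - x) * ((i - y) * (i - z))) (outEx, outEx, atomEx 4 x y z)
  | 16 => (outEx, outEx, atomEx 5 x y z)
  | _ => (outEx, outEx, atomEx 6 x y z)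

/-- The expressions have the numbers of the atoms as values. -/
def Eval (w : List ℕ) (ρ : ℕ → ℕ) (t : Ex × Ex × Ex) (r : RawAtom × RawAtom × RawAtom) : Prop :=
  t.1.eval w ρ = varNum (w.length + 3) r.1 ∧ t.2.1.eval w ρ = varNum (w.length + 3) r.2.1 ∧
    t.2.2.eval w ρ = varNum (w.length + 3) r.2.2

theorem eval_sizeEx (w : List ℕ) (ρ : ℕ → ℕ) : sizeEx.eval w ρ = w.length + 3 := rfl

theorem eval_cubeEx (w : List ℕ) (ρ : ℕ → ℕ) : cubeEx.eval w ρ = cubeCard (w.length + 3) := rfl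

theorem eval_atomEx (w : List ℕ) (ρ : ℕ → ℕ) (κ : ℕ) (x y z : Ex) : (atomEx κ x y z).eval w ρ =
    varNum (w.length + 3) (κ, x.eval w ρ, y.eval w ρ, z.eval w ρ) := rfl

theorem Eval.guard {w : List ℕ} {ρ : ℕ → ℕ} {t : Ex × Ex × Ex} {r : RawAtom × RawAtom × RawAtom}
    (h : Eval w ρ t r) {c : Ex} {p : Prop} [Decidable p] (hc : c.eval w ρ ≠ 0 ↔ p) :
    Eval w ρ (guard c t) (if p then r else (truth, truth, truth)) := by
  obtain ⟨h1, h2, h3⟩ := h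
  by_cases hp : p
  · have := hc.2 hp
    simp only [if_pos hp, Eval, Data.guard, eval_ite, if_pos this]
    exact ⟨h1, h2, h3⟩
  · have h' := mt hc.1 hp
    simp only [if_neg hp, Eval, Data.guard, eval_ite, if_neg h', eval_const, varNum]
    simp

theorem Eval.guard_not {w : List ℕ} {ρ : ℕ → ℕ} {t : Ex × Ex × Ex}
    {r : RawAtom × RawAtom × RawAtom} (h : Eval w ρ t r) {c : Ex} {p : Prop} [Decidable p]
    (hc : c.eval w ρ ≠ 0 ↔ ¬ p) :
    Eval w ρ (Data.guard c t) (if p then (truth, truth, truth) else r) := by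
  have := h.guard hc
  rwa [ite_not] at this

variable (C : Circuit) (k : ℕ) (ρ : ℕ → ℕ)

theorem eval_kEx : kEx.eval (bits (C.numbers k)) ρ = k :=
  eval_num _ _ _ 0 fun _ => rfl

theorem eval_nEx : nEx.eval (bits (C.numbers k)) ρ = C.inputs :=
  eval_num _ _ _ 1 fun _ => rfl

theorem eval_oEx : oEx.eval (bits (C.numbers k)) ρ = C.output :=
  eval_num _ _ _ 2 fun _ => rfl

theorem eval_gateEx (r : ℕ) : (gateEx r).eval (bits (C.numbers k)) ρ =
    (C.numbers k).getD (3 * ρ 0 + (r + 3)) 0 :=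
  eval_num _ _ _ _ fun p => by simp

/-- Comparisons are expressed by truncated subtraction and conjunctions by products. The list has `3
+ 3 * G` numbers, so its length exceeds `3 * x + 5` exactly when `x` is a gate. -/
theorem eval_ruleEx {κ : ℕ} (hκ : κ < 18) : Eval (bits (C.numbers k)) ρ (ruleEx κ)
    ((C.data k).rule κ (ρ 0) (ρ 1) (ρ 2)) := by
  have hG : (Ex.count - (const 3 * var 0 + const 5)).eval (bits (C.numbers k)) ρ ≠ 0 ↔
      ρ 0 < (C.data k).G := by
    simp only [eval_sub, eval_add, eval_mul, eval_count, eval_const, eval_var, Circuit.numbers,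
      List.length_cons, length_flatMap_code, Circuit.data]
    omega
  have h0 : (gateEx 0).eval (bits (C.numbers k)) ρ = (C.data k).gk (ρ 0) := eval_gateEx C k ρ 0
  have h1 : (gateEx 1).eval (bits (C.numbers k)) ρ = (C.data k).gi (ρ 0) := eval_gateEx C k ρ 1
  have h2 : (gateEx 2).eval (bits (C.numbers k)) ρ = (C.data k).gj (ρ 0) := eval_gateEx C k ρ 2
  have hk : kEx.eval (bits (C.numbers k)) ρ = (C.data k).k := eval_kEx C k ρ
  have hn : nEx.eval (bits (C.numbers k)) ρ = (C.data k).n := eval_nEx C k ρ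
  have ho : oEx.eval (bits (C.numbers k)) ρ = (C.data k).o := eval_oEx C k ρ
  have hp : polEx.eval (bits (C.numbers k)) ρ = (C.data k).pol (ρ 0) := by
    simp [polEx, h0, pol]
  have hr : resEx.eval (bits (C.numbers k)) ρ = (C.data k).res (ρ 0) := by
    simp [resEx, h0, res]
  generalize C.data k = D at *
  generalize bits (C.numbers k) = w at *
  have hx : (var 0).eval w ρ = ρ 0 := rfl
  match κ, hκ with
  | 0, _ => simp [ruleEx, Data.rule, Eval, eval_atomEx]
  | 1, _ => simp [ruleEx, Data.rule, Eval, eval_atomEx]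
  | 2, _ => exact Eval.guard (by simp [Eval, eval_atomEx]) (by simp [hn]; omega)
  | 3, _ => simp [ruleEx, Data.rule, Eval, eval_atomEx, varNum]
  | 4, _ => exact Eval.guard (by simp [Eval, eval_atomEx]) (by simp [hn]; omega)
  | 5, _ => exact Eval.guard (by simp [Eval, eval_atomEx]) (by simp [hn, hk]; omega)
  | 6, _ => exact Eval.guard (by simp [Eval, eval_atomEx, hn, hk]) (by simp [hn]; omega)
  | 7, _ => exact Eval.guard (by simp [Eval, eval_atomEx, h1, h2, hp, hr, hn]) hG
  | 8, _ => exact Eval.guard (by simp [Eval, eval_atomEx, h1, hp, hr, hn]) hG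
  | 9, _ => exact Eval.guard (by simp [Eval, eval_atomEx, h2, hp, hr, hn]) hG
  | 10, _ => simp [ruleEx, Data.rule, Eval, eval_atomEx, hn, hk, ho]
  | 11, _ => simp [ruleEx, Data.rule, Eval, eval_atomEx]
  | 12, _ => simp [ruleEx, Data.rule, Eval, eval_atomEx]
  | 13, _ => simp [ruleEx, Data.rule, Eval, eval_atomEx]
  | 14, _ =>
    refine Eval.guard_not (by simp [Eval, eval_atomEx]) ?_
    simp only [eval_sub, eval_mul, eval_const, eval_var, hk]
    rcases Nat.eq_zero_or_pos (ρ 2) with h | h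
    · simp [h]; omega
    · simp [Nat.sub_eq_zero_of_le h]; omega
  | 15, _ =>
    refine Eval.guard_not (by simp [Eval, eval_atomEx]) ?_
    simp only [eval_sub, eval_mul, eval_const, eval_var, hk]
    rcases Nat.eq_zero_or_pos (ρ 1) with h | h
    · rcases Nat.eq_zero_or_pos (ρ 2) with h' | h'
      · simp [h, h']; omega
      · simp [Nat.sub_eq_zero_of_le h']; omega
    · simp [Nat.sub_eq_zero_of_le h]; omega
  | 16, _ => simp [ruleEx, Data.rule, Eval, eval_atomEx]
  | 17, _ => simp [ruleEx, Data.rule, Eval, eval_atomEx]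
  | n + 18, h => omega

end Data

end FPT

/-! ### Printing the colors and edges in the order of the encoding -/

namespace FPT

theorem flatMap_range {α : Type} (n : ℕ) (f : ℕ → List α) :
    (List.range n).flatMap f = (List.finRange n).flatMap fun i : Fin n => f i := by
  rw [← List.map_coe_finRange_eq_range, List.flatMap_map]

theorem map_range_mul {α : Type} (m n : ℕ) (f : ℕ → α) :
    (List.range (m * n)).map f =
      (List.range m).flatMap fun i => (List.range n).map fun j => f (i * n + j) := by
  induction m with
  | zero => simp
  | succ m ih =>
    rw [List.range_succ, List.flatMap_append, ← ih, Nat.succ_mul, List.range_add, List.map_append]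
    simp

namespace Data

open Ex

def varCardEx : Ex := const 1 + (const 7 * cubeEx + const 18 * cubeEx * const 3)

/-- The number of the rule `κ` with arguments in variables `0`, `1` and `2`. -/
def ruleNumEx (κ : ℕ) : Ex :=
  var 2 + sizeEx * var 1 + sizeEx * sizeEx * var 0 + cubeEx * const κ

def freshEx (κ i : ℕ) : Ex :=
  const 1 + (const 7 * cubeEx + (const i + const 3 * ruleNumEx κ))

/-- The variables of a triple. -/
def tripleEx (κ : ℕ) (j : Fin 4) : Ex × Ex × Ex :=
  ![((ruleEx κ).1, const 0, freshEx κ 0), (freshEx κ 0, (ruleEx κ).2.1, freshEx κ 1),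
    (freshEx κ 1, const 0, freshEx κ 2), (freshEx κ 1, freshEx κ 2, (ruleEx κ).2.2)] j

def midEx (κ : ℕ) (j : Fin 4) (a b : Bool) : Ex :=
  varCardEx * const 2 +
    (const b.toNat + const 2 * const a.toNat + const 4 * (const j + const 4 * ruleNumEx κ))

def midList (κ : ℕ) (j : Fin 4) (a b : Bool) : List Ex :=
  [midEx κ j a b, const a.toNat + const 2 * (tripleEx κ j).1,
   midEx κ j a b, const b.toNat + const 2 * (tripleEx κ j).2.1,
   midEx κ j a b, const (xor a b).toNat + const 2 * (tripleEx κ j).2.2]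

def ruleList (κ : ℕ) : List Ex :=
  (List.finRange 4).flatMap fun j => [false, true].flatMap fun a => [false, true].flatMap fun b =>
    midList κ j a b

/-- The arguments are loop variables, but the `18` kinds of rules are separate pieces of code; this
is why the kind is innermost in `edgeList` as well. -/
def edgeSt : St :=
  .loop 0 sizeEx <| .loop 1 sizeEx <| .loop 2 sizeEx <|
    St.seqs ((List.finRange 18).map fun κ : Fin 18 => St.puts (ruleList κ))

def colorSt : St :=
  .seq (St.puts [const 0, const 1, const 2, const 3]) <|
  .seq (.loop 0 (varCardEx - const 2)
    (St.puts (List.replicate 2 (const 2 * (var 0 + const 2)))))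
  (.loop 0 (const 18 * cubeEx * const 4)
    (St.puts (List.replicate 4 (varCardEx * const 2 + const 4 * var 0))))

/-- Prints the instance of k-Color-Valence. -/
def graphSt : St :=
  .seq (St.puts [kEx, const 0, varCardEx * const 2 + const 18 * cubeEx * const 4 * const 4]) <|
  .seq colorSt edgeSt

theorem eval_varCardEx (w : List ℕ) (ρ : ℕ → ℕ) :
    varCardEx.eval w ρ = varCard (w.length + 3) := rfl

/-- The vertex numbers split into the four base vertices, the remaining pairs and the quadruples of
middle vertices; the color is constant on each pair and quadruple. -/
theorem out_colorSt (w : List ℕ) (ρ : ℕ → ℕ) : colorSt.out w ρ =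
    bits ((List.range (vertCard (w.length + 3))).map (colorNum (w.length + 3))) := by
  generalize hN : w.length + 3 = N
  have hV : 2 ≤ varCard N := by
    have : 0 < cubeCard N := by
      have : 0 < N := by omega
      unfold cubeCard; positivity
    unfold varCard; omega
  have h1 : (List.range (vertCard N)).map (colorNum N) = [0, 1, 2, 3] ++
      ((List.range (varCard N - 2)).flatMap fun p => List.replicate 2 (2 * (p + 2))) ++
      (List.range (18 * cubeCard N * 4)).flatMap fun τ =>
        List.replicate 4 (varCard N * 2 + 4 * τ) := by
    have e1 : vertCard N = 4 + (varCard N - 2) * 2 + 18 * cubeCard N * 4 * 4 := by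
      unfold vertCard; omega
    rw [e1, List.range_add, List.range_add, List.map_append, List.map_append, List.map_map,
      List.map_map, map_range_mul, map_range_mul]
    congr 1
    · congr 1
      refine List.flatMap_congr fun p hp => ?_
      rw [List.mem_range] at hp
      refine List.eq_replicate_iff.2 ⟨by simp, fun c hc => ?_⟩
      obtain ⟨j, hj, rfl⟩ := List.mem_map.1 hc
      rw [List.mem_range] at hj
      simp only [Function.comp, colorNum]
      split_ifs <;> omega
    · refine List.flatMap_congr fun τ hτ => ?_
      refine List.eq_replicate_iff.2 ⟨by simp, fun c hc => ?_⟩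
      obtain ⟨j, hj, rfl⟩ := List.mem_map.1 hc
      rw [List.mem_range] at hj
      simp only [Function.comp, colorNum]
      split_ifs <;> omega
  rw [h1, bits_append, bits_append, bits_flatMap, bits_flatMap]
  simp only [colorSt, St.out, St.out_puts, eval_varCardEx, eval_cubeEx, eval_sub, eval_mul,
    eval_add, eval_const, eval_var, hN, List.map_cons, List.map_nil, List.map_replicate,
    Function.update_self, List.append_assoc]

variable (C : Circuit) (k : ℕ)

theorem size_eq : C.size k = (bits (C.numbers k)).length + 3 := by
  rw [Circuit.size, C.word_eq, bits, List.length_map]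

theorem eval_ruleNumEx {w : List ℕ} {ρ : ℕ → ℕ} {N : ℕ} (hN : N = w.length + 3) (κ : Fin 18)
    {x y z : Fin N} (hx : ρ 0 = x) (hy : ρ 1 = y) (hz : ρ 2 = z) :
    (ruleNumEx κ).eval w ρ = ruleEquiv N (κ, x, y, z) := by
  rw [ruleEquiv_val, cubeEquiv_val, ← hx, ← hy, ← hz, hN]
  rfl

theorem eval_freshEx {w : List ℕ} {ρ : ℕ → ℕ} {N : ℕ} (hN : N = w.length + 3) (κ : Fin 18)
    {x y z : Fin N} (hx : ρ 0 = x) (hy : ρ 1 = y) (hz : ρ 2 = z) (i : Fin 3) :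
    (freshEx κ i).eval w ρ = varEquiv N (Horn.fresh (κ, x, y, z) i) := by
  rw [varEquiv_fresh, ← eval_ruleNumEx hN κ hx hy hz, hN]
  rfl

theorem eval_midEx {w : List ℕ} {ρ : ℕ → ℕ} {N : ℕ} (hN : N = w.length + 3) (κ : Fin 18)
    {x y z : Fin N} (hx : ρ 0 = x) (hy : ρ 1 = y) (hz : ρ 2 = z) (j : Fin 4) (a b : Bool) :
    (midEx κ j a b).eval w ρ = vertEquiv N (.inr (((κ, x, y, z), j), a, b)) := by
  rw [vertEquiv_inr, ← eval_ruleNumEx hN κ hx hy hz, hN]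
  rfl

theorem eval_tripleEx {ρ : ℕ → ℕ} (κ : Fin 18) {x y z : Fin (C.size k)} (hx : ρ 0 = x)
    (hy : ρ 1 = y) (hz : ρ 2 = z) (j : Fin 4) :
    let H := (C.data k).horn (C.size k)
    (tripleEx κ j).1.eval (bits (C.numbers k)) ρ = varEquiv _ (H.sys.P ((κ, x, y, z), j)) ∧
    (tripleEx κ j).2.1.eval (bits (C.numbers k)) ρ = varEquiv _ (H.sys.Q ((κ, x, y, z), j)) ∧
    (tripleEx κ j).2.2.eval (bits (C.numbers k)) ρ = varEquiv _ (H.sys.R ((κ, x, y, z), j)) := by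
  have hN := size_eq C k
  obtain ⟨r1, r2, r3⟩ := eval_ruleEx C k ρ κ.2
  obtain ⟨b1, b2, b3⟩ := (C.data_valid k).bounded κ.2 x.2 y.2 z.2
  rw [hx, hy, hz, ← hN] at r1 r2 r3
  rw [← varEquiv_ofRaw b1] at r1
  rw [← varEquiv_ofRaw b2] at r2
  rw [← varEquiv_ofRaw b3] at r3
  have f0 := eval_freshEx hN κ hx hy hz 0
  have f1 := eval_freshEx hN κ hx hy hz 1
  have f2 := eval_freshEx hN κ hx hy hz 2
  fin_cases j
  · exact ⟨r1, rfl, f0⟩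
  · exact ⟨f0, r2, f1⟩
  · exact ⟨f1, rfl, f2⟩
  · exact ⟨f1, f2, r3⟩

theorem eval_ruleList {ρ : ℕ → ℕ} (κ : Fin 18) {x y z : Fin (C.size k)} (hx : ρ 0 = x)
    (hy : ρ 1 = y) (hz : ρ 2 = z) :
    (ruleList κ).map (fun e => e.eval (bits (C.numbers k)) ρ) =
      ((C.data k).ruleEdges (C.size k) (κ, x, y, z)).flatMap fun e => [(e.1 : ℕ), (e.2 : ℕ)] := by
  rw [ruleList, ruleEdges, List.map_flatMap, List.flatMap_assoc]
  refine List.flatMap_congr fun j _ => ?_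
  rw [List.map_flatMap, List.flatMap_assoc]
  refine List.flatMap_congr fun a _ => ?_
  rw [List.map_flatMap, List.flatMap_assoc]
  refine List.flatMap_congr fun b _ => ?_
  obtain ⟨t1, t2, t3⟩ := eval_tripleEx C k κ hx hy hz j
  simp only [midList, midEdges, List.map_cons, List.map_nil, List.flatMap_cons, List.flatMap_nil,
    List.cons_append, List.nil_append, eval_midEx (size_eq C k) κ hx hy hz, eval_add, eval_mul,
    eval_const, t1, t2, t3, vertEquiv_inl]

theorem out_edgeSt (ρ : ℕ → ℕ) : edgeSt.out (bits (C.numbers k)) ρ =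
    bits (((C.data k).edgeList (C.size k)).flatMap fun e => [(e.1 : ℕ), (e.2 : ℕ)]) := by
  simp only [edgeSt, St.out, eval_sizeEx, ← size_eq, flatMap_range, edgeList, List.flatMap_assoc,
    St.out_seqs, List.flatMap_map, St.out_puts]
  rw [bits_flatMap]
  refine List.flatMap_congr fun x _ => ?_
  rw [bits_flatMap]
  refine List.flatMap_congr fun y _ => ?_
  rw [bits_flatMap]
  refine List.flatMap_congr fun z _ => ?_
  rw [bits_flatMap]
  refine List.flatMap_congr fun κ _ => ?_
  -- The nested updates have put `x`, `y`, `z` into variables `0`, `1`, `2`.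
  rw [eval_ruleList C k κ (x := x) (y := y) (z := z) (by simp) (by simp) (by simp)]

theorem out_graphSt (ρ : ℕ → ℕ) : graphSt.out (bits (C.numbers k)) ρ =
    bits (k :: 0 :: (C.toGraph k).code) := by
  have h : (C.toGraph k).code = vertCard (C.size k) ::
      ((List.range (vertCard (C.size k))).map (colorNum (C.size k)) ++
        ((C.data k).edgeList (C.size k)).flatMap fun e => [(e.1 : ℕ), (e.2 : ℕ)]) := by
    show vertCard (C.size k) :: (List.ofFn _ ++ _) = _
    congr 2
    rw [List.ofFn_eq_map, ← List.map_coe_finRange_eq_range, List.map_map]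
    rfl
  rw [h, show ∀ a b c (l : List ℕ), a :: b :: c :: l = [a, b, c] ++ l from fun _ _ _ _ => rfl,
    bits_append, bits_append, graphSt, St.out, St.out, out_colorSt, out_edgeSt, St.out_puts,
    ← size_eq]
  congr 2
  simp only [List.map_cons, List.map_nil, eval_kEx, eval_const, eval_add, eval_mul, eval_varCardEx,
    eval_cubeEx, ← size_eq]
  rfl

end Data

theorem exists_prog_toGraph : ∃ (q : Prog) (c : ℕ), ∀ (C : Circuit) (k : ℕ),
    ∃ t ≤ ((weightedCircuitSat.word C k).length + 2) ^ c, Outputs q (weightedCircuitSat.word C k) t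
      (kColorValence.word (C.toGraph k, 0) k) := by
  obtain ⟨q, c, h⟩ := Data.graphSt.exists_prog
  refine ⟨q, c, fun C k => h _ _ ?_⟩
  have h1 : kColorValence.word (C.toGraph k, 0) k = encNats (k :: 0 :: (C.toGraph k).code) := by
    simp [ParamProblem.word, kColorValence, encNats]
  rw [h1, C.word_eq]
  exact Data.out_graphSt C k _

end FPT

/-! ### Hardness of k-Color-Valence -/

theorem mainTheorem7 :
    FPT.WPHard FPT.kColorValence ∧
    FPT.WPHard (FPT.kColorValence.restrict (fun x => x.2 = 0)) ∧
    ∀ P : FPT.ParamProblem, FPT.InWP P →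
      ∃ (X : P.Inst → ℕ → FPT.ColoredGraph) (k' : P.Inst → ℕ → ℕ),
        FPT.FPTMap P FPT.kColorValence (fun x k => ((X x k, 0), k' x k)) ∧
        ∀ (x : P.Inst) (k : ℕ),
          (P.yes x k ↔ (X x k).CanReachDiscrete (k' x k)) ∧
          (P.yes x k ↔ (X x k).CanReachValence (k' x k) 0) := by
  have main : ∀ P : FPT.ParamProblem, FPT.InWP P →
      ∃ (X : P.Inst → ℕ → FPT.ColoredGraph) (k' : P.Inst → ℕ → ℕ),
        FPT.FPTMap P FPT.kColorValence (fun x k => ((X x k, 0), k' x k)) ∧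
        ∀ (x : P.Inst) (k : ℕ),
          (P.yes x k ↔ (X x k).CanReachDiscrete (k' x k)) ∧
          (P.yes x k ↔ (X x k).CanReachValence (k' x k) 0) := by
    rintro P ⟨R, hR, hyes⟩
    obtain ⟨q, c, hq⟩ := FPT.exists_prog_toGraph
    -- The circuit's parameter becomes the number of individualized vertices unchanged, so the
    -- parameter bound of the given reduction is inherited.
    refine ⟨fun x k => (R x k).1.toGraph (R x k).2, fun x k => (R x k).2,
      hR.comp_poly (Q' := FPT.kColorValence) (fun C k => (C.toGraph k, 0)) q c hq, fun x k => ?_⟩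
    rw [hyes x k]
    exact FPT.Circuit.yes_iff _ _
  refine ⟨fun P hP => ?_, fun P hP => ?_, main⟩
  · obtain ⟨X, k', hmap, hyes⟩ := main P hP
    exact ⟨_, hmap, fun x k => (hyes x k).2⟩
  · obtain ⟨X, k', hmap, hyes⟩ := main P hP
    -- The restricted problem encodes its instances as before, so the same program witnesses the
    -- reduction.
    exact ⟨fun x k => (⟨(X x k, 0), rfl⟩, k' x k), hmap, fun x k => (hyes x k).2⟩
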